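/- Let $0<H<1$, $0<\gamma<2H$ and $\alpha=2H-\gamma\in(0,2)$. Let $B^H=\{B^H_t,t\ge 0\}$ be a fractional Brownian motion (fBm) with Hurst parameter $H$, i.e. a centered Gaussian process with covariance $\frac12(t^{2H}+s^{2H}-|t-s|^{2H})$, and let $Z=\{Z_t,t>0\}$ be a (jointly measurable) centered Gaussian process, independent of $B^H$, with $\mathbb E[Z_sZ_t]=(s+t)^{-\gamma}$. Then the stochastic integrals $\int_0^tZ_{t-r}\,dB^H_r$, $t\ge0$, exist in $L^2(\Omega)$. Let $X=\{X_t,t\ge0\}$ be any centered Gaussian process with covariance $$\mathbb E[X_sX_t]=\mathbb E\Big[\int_0^tZ_{t-r}\,dB^H_r\int_0^sZ_{s-r}\,dB^H_r\Big].$$ Put $C_H=\big(\tfrac{2\pi}{\Gamma(2H+1)\sin(\pi H)}\big)^{1/2}$ and $$\kappa=\frac{\Gamma(2H+1)\sin(\pi H)}{\Gamma(\alpha+1)\sin(\pi\alpha/2)}\cdot\frac1{\Gamma(\gamma)}\int_0^\infty\frac{z^{\gamma-1}}{1+z^2}\,dz,\qquad \lambda_1=\frac{\Gamma(2H+1)\sin(\pi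 H)}{\pi\,\Gamma(\gamma)}\int_0^\infty\frac{\eta^{1-2H}}{1+\eta^2}\,d\eta .$$ Then: (a) On some probability space there are jointly Gaussian (in general dependent) processes $B^{\alpha/2}$ and $Y$ such that $B^{\alpha/2}$ is a fBm with Hurst parameter $\alpha/2$, $Y$ is a centered Gaussian process with covariance $$\mathbb E[Y_tY_s]=\lambda_1\int_0^\infty y^{-\alpha-1}(1-e^{-yt})(1-e^{-ys})\,dy,$$ and $X$ has the same law as $\{\sqrt\kappa\,B^{\alpha/2}_t+Y_t,\ t\ge0\}$. (b) $Y$ has the same law as $\sqrt{\lambda_1}\,Y^{\alpha}$, where $Y^{\alpha}_t=\int_0^\infty y^{-\frac{1+\alpha}2}(1-e^{-yt})\,dW_y$ for a standard Brownian motion $W$. (c) Both components are Wiener–Itô integrals with respect to Brownian sheets: if $B^{(1)},B^{(2)}$ are two independent Brownian sheets on $[0,\infty)^2$, $w(\eta,y)=\frac{\sqrt2}{\sqrt{\Gamma(\gamma)}\,C_H}\,y^{-\frac\alpha2-\frac12}\sqrt{\frac{\eta^{1-2H}}{1+\eta^2}}$, and $$U_t=\int_0^\infty\!\!\int_0^\infty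 w(\eta,y)(\cos(\eta yt)-1)\,B^{(1)}(d\eta,dy),\quad V_t=\int_0^\infty\!\!\int_0^\infty w(\eta,y)\sin(\eta yt)\,B^{(2)}(d\eta,dy),\quad Y_t=\int_0^\infty\!\!\int_0^\infty w(\eta,y)(1-e^{-yt})\,B^{(1)}(d\eta,dy),$$ then $B^{\alpha/2}=\kappa^{-1/2}(U+V)$ and $Y$ have all the properties in (a). -/

import Mathlib

open MeasureTheory ProbabilityTheory Filter Topology
open scoped NNReal ENNReal

noncomputable section

/-- `X` is a centered Gaussian process on `(Ω, P)` with covariance `E[X_s X_t] = K s t`. -/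
structure IsCenteredGaussian {T Ω : Type*} [MeasurableSpace Ω] (X : T → Ω → ℝ)
    (K : T → T → ℝ) (P : Measure Ω) : Prop where
  measurable : ∀ t, Measurable (X t)
  gaussian : IsGaussianProcess X P
  mean : ∀ t, ∫ ω, X t ω ∂P = 0
  cov : ∀ s t, ∫ ω, X s ω * X t ω ∂P = K s t

/-- Fractional Brownian motion with Hurst parameter `H`. -/
def IsFBM {Ω : Type*} [MeasurableSpace Ω] (H : ℝ) (B : ℝ≥0 → Ω → ℝ) (P : Measure Ω) : Prop :=
  IsCenteredGaussian B
    (fun s t => ((t : ℝ) ^ (2 * H) + (s : ℝ) ^ (2 * H) - |(t : ℝ) - (s : ℝ)| ^ (2 * H)) / 2) P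

/-! ### The integral of an independent random integrand with respect to fBm -/

/-- `C_H = (2π / (Γ(2H+1) sin(πH)))^{1/2}`. -/
def fbmConst (H : ℝ) : ℝ :=
  √(2 * Real.pi / (Real.Gamma (2 * H + 1) * Real.sin (Real.pi * H)))

/-- `ℱ g (ξ) = ∫ g(x) e^{iξx} dx`. -/
def fourierInt (g : ℝ → ℝ) (ξ : ℝ) : ℂ :=
  ∫ x : ℝ, (g x : ℂ) * Complex.exp (Complex.I * ξ * x)

/-- The squared norm `C_H⁻² ∫ |ℱ g (ξ)|² |ξ|^{1-2H} dξ` of an integrable function `g` in the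
Hilbert space spanned by the fBm with Hurst parameter `H`. -/
def fbmNormSq (H : ℝ) (g : ℝ → ℝ) : ℝ≥0∞ :=
  ∫⁻ ξ : ℝ, ENNReal.ofReal (((fbmConst H) ^ 2)⁻¹ * (‖fourierInt g ξ‖ ^ 2 * |ξ| ^ (1 - 2 * H)))

/-- The data of a random step function `∑ i, F_i 1_{(a_i, b_i]}` on `[0, ∞)`. -/
structure RandomStep (Ω : Type*) where
  n : ℕ
  left : Fin n → ℝ≥0
  right : Fin n → ℝ≥0
  le : ∀ i, left i ≤ right i
  coef : Fin n → Ω → ℝ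

/-- The random function `x ↦ ∑ i, F_i 1_{(a_i, b_i]}(x)`. -/
def RandomStep.toFun {Ω : Type*} (φ : RandomStep Ω) (x : ℝ) (ω : Ω) : ℝ :=
  ∑ i, φ.coef i ω * (Set.Ioc (φ.left i : ℝ) (φ.right i : ℝ)).indicator (fun _ => 1) x

/-- The elementary integral `∑ i, F_i (B_{b_i} - B_{a_i})`. -/
def RandomStep.integral {Ω : Type*} (φ : RandomStep Ω) (B : ℝ≥0 → Ω → ℝ) (ω : Ω) : ℝ :=
  ∑ i, φ.coef i ω * (B (φ.right i) ω - B (φ.left i) ω)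

/-- `J` is the stochastic integral `∫ f(r) dB_r` of the random function `f` with respect to the
fBm `B` with Hurst parameter `H`, where `f` is measurable with respect to a σ-algebra `𝓖`
(which is independent of `B` when this is used). That is, `J` is the value at `f` of the
isometric extension of the elementary integral: it is the `L²(P)`-limit of the elementary
integrals of `𝓖`-measurable square integrable random step functions that converge to `f` in
mean square for the norm of the Hilbert space of the fBm. -/
def IsFBMIntegral {Ω : Type*} (𝓖 : MeasurableSpace Ω) [MeasurableSpace Ω] (H : ℝ)
    (B : ℝ≥0 → Ω → ℝ) (f : ℝ → Ω → ℝ) (J : Ω → ℝ) (P : Measure Ω) : Prop :=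
  (∀ᵐ ω ∂P, Integrable (fun x => f x ω)) ∧ MemLp J 2 P ∧
    ∃ φ : ℕ → RandomStep Ω,
      (∀ k i, Measurable[𝓖] ((φ k).coef i) ∧ MemLp ((φ k).coef i) 2 P) ∧
      Tendsto (fun k => ∫⁻ ω, fbmNormSq H (fun x => (φ k).toFun x ω - f x ω) ∂P) atTop (𝓝 0) ∧
      Tendsto (fun k => eLpNorm (fun ω => (φ k).integral B ω - J ω) 2 P) atTop (𝓝 0)

/-- The random function `r ↦ 1_{[0,t)}(r) Z_{t-r}` for a process `Z = {Z_t, t > 0}`. -/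
def shiftedIntegrand {Ω : Type*} (Z : Set.Ioi (0 : ℝ) → Ω → ℝ) (t : ℝ≥0) (r : ℝ) (ω : Ω) : ℝ :=
  if h : 0 ≤ r ∧ r < t then Z ⟨(t : ℝ) - r, Set.mem_Ioi.2 (sub_pos.2 h.2)⟩ ω else 0

/-- `J = ∫_0^t Z_{t-r} dB_r`, for a process `Z` that is independent of the fBm `B`. -/
def IsConvolution {Ω : Type*} [MeasurableSpace Ω] (H : ℝ) (B : ℝ≥0 → Ω → ℝ)
    (Z : Set.Ioi (0 : ℝ) → Ω → ℝ) (t : ℝ≥0) (J : Ω → ℝ) (P : Measure Ω) : Prop :=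
  IsFBMIntegral (MeasurableSpace.comap (fun ω s => Z s ω) MeasurableSpace.pi) H B
    (shiftedIntegrand Z t) J P

/-! ### Wiener integrals with respect to a Brownian motion and a Brownian sheet -/

/-- `J = ∫_0^∞ f(y) dW_y`, the Wiener integral of `f ∈ L²(0, ∞)` with respect to a Brownian
motion `W`: the `L²`-limit of the integrals of step functions that converge to `f` in `L²`. -/
def IsWienerIntegral {Ω : Type*} [MeasurableSpace Ω] (W : ℝ≥0 → Ω → ℝ) (f : ℝ → ℝ)
    (J : Ω → ℝ) (P : Measure Ω) : Prop :=
  MemLp f 2 (volume.restrict (Set.Ioi 0)) ∧ MemLp J 2 P ∧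
    ∃ φ : ℕ → RandomStep Unit,
      Tendsto (fun k => eLpNorm (fun x => (φ k).toFun x () - f x) 2
        (volume.restrict (Set.Ioi 0))) atTop (𝓝 0) ∧
      Tendsto (fun k => eLpNorm (fun ω =>
        ∑ i, (φ k).coef i () * (W ((φ k).right i) ω - W ((φ k).left i) ω) - J ω) 2 P)
        atTop (𝓝 0)

/-- A Brownian sheet on `[0, ∞)²`: a continuous centered Gaussian field with covariance
`min(η, ξ) min(t, s)`. -/
structure IsBrownianSheet {Ω : Type*} [MeasurableSpace Ω] (W : ℝ≥0 × ℝ≥0 → Ω → ℝ)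
    (P : Measure Ω) : Prop where
  gaussian : IsCenteredGaussian W
    (fun p q => min (p.1 : ℝ) (q.1 : ℝ) * min (p.2 : ℝ) (q.2 : ℝ)) P
  continuous : ∀ᵐ ω ∂P, Continuous fun p => W p ω

/-- The data of a step function `∑ i, c_i 1_{(a_i, b_i] × (a'_i, b'_i]}` on `[0, ∞)²`. -/
structure RectStep where
  n : ℕ
  left : Fin n → ℝ≥0 × ℝ≥0
  right : Fin n → ℝ≥0 × ℝ≥0
  le : ∀ i, left i ≤ right i
  coef : Fin n → ℝ

/-- The function `∑ i, c_i 1_{(a_i, b_i] × (a'_i, b'_i]}`. -/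
def RectStep.toFun (φ : RectStep) (p : ℝ × ℝ) : ℝ :=
  ∑ i, φ.coef i * (Set.Ioc ((φ.left i).1 : ℝ) ((φ.right i).1 : ℝ) ×ˢ
    Set.Ioc ((φ.left i).2 : ℝ) ((φ.right i).2 : ℝ)).indicator (fun _ => 1) p

/-- The elementary integral: the sum of the `c_i` times the increments of `W` over the
rectangles. -/
def RectStep.integral {Ω : Type*} (φ : RectStep) (W : ℝ≥0 × ℝ≥0 → Ω → ℝ) (ω : Ω) : ℝ :=
  ∑ i, φ.coef i * (W ((φ.right i).1, (φ.right i).2) ω - W ((φ.left i).1, (φ.right i).2) ω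
    - W ((φ.right i).1, (φ.left i).2) ω + W ((φ.left i).1, (φ.left i).2) ω)

/-- `J = ∫_0^∞ ∫_0^∞ f(η, y) W(dη, dy)`, the Wiener–Itô integral of `f ∈ L²((0, ∞)²)` with
respect to a Brownian sheet `W`. -/
def IsSheetIntegral {Ω : Type*} [MeasurableSpace Ω] (W : ℝ≥0 × ℝ≥0 → Ω → ℝ) (f : ℝ × ℝ → ℝ)
    (J : Ω → ℝ) (P : Measure Ω) : Prop :=
  MemLp f 2 (volume.restrict (Set.Ioi 0 ×ˢ Set.Ioi 0)) ∧ MemLp J 2 P ∧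
    ∃ φ : ℕ → RectStep,
      Tendsto (fun k => eLpNorm (fun p => (φ k).toFun p - f p) 2
        (volume.restrict (Set.Ioi 0 ×ˢ Set.Ioi 0))) atTop (𝓝 0) ∧
      Tendsto (fun k => eLpNorm (fun ω => (φ k).integral W ω - J ω) 2 P) atTop (𝓝 0)

/-! ### The decomposition -/

/-- `κ = Γ(2H+1) sin(πH) / (Γ(α+1) sin(πα/2)) · Γ(γ)⁻¹ ∫_0^∞ z^{γ-1} / (1+z²) dz`,
with `α = 2H - γ`. -/
def kappa (H γ : ℝ) : ℝ :=
  Real.Gamma (2 * H + 1) * Real.sin (Real.pi * H) /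
      (Real.Gamma (2 * H - γ + 1) * Real.sin (Real.pi * (2 * H - γ) / 2)) *
    ((Real.Gamma γ)⁻¹ * ∫ z in Set.Ioi (0 : ℝ), z ^ (γ - 1) / (1 + z ^ 2))

/-- `λ₁ = Γ(2H+1) sin(πH) / (π Γ(γ)) · ∫_0^∞ η^{1-2H} / (1+η²) dη`. -/
def lambdaOne (H γ : ℝ) : ℝ :=
  Real.Gamma (2 * H + 1) * Real.sin (Real.pi * H) / (Real.pi * Real.Gamma γ) *
    ∫ η in Set.Ioi (0 : ℝ), η ^ (1 - 2 * H) / (1 + η ^ 2)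

/-- The covariance `λ₁ ∫_0^∞ y^{-α-1} (1-e^{-yt}) (1-e^{-ys}) dy` of `Y`, with `α = 2H - γ`. -/
def covY (H γ : ℝ) (s t : ℝ≥0) : ℝ :=
  lambdaOne H γ * ∫ y in Set.Ioi (0 : ℝ),
    y ^ (-(2 * H - γ) - 1) * (1 - Real.exp (-(y * t))) * (1 - Real.exp (-(y * s)))

/-- The weight `√2 / (√Γ(γ) C_H) · y^{-α/2-1/2} √(η^{1-2H} / (1+η²))` at `(η, y)`, with
`α = 2H - γ`. -/
def sheetWeight (H γ : ℝ) (p : ℝ × ℝ) : ℝ :=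
  √2 / (√(Real.Gamma γ) * fbmConst H) *
    (p.2 ^ (-(2 * H - γ) / 2 - 1 / 2) * √(p.1 ^ (1 - 2 * H) / (1 + p.1 ^ 2)))

/-- `B` and `Y` are jointly Gaussian, `B` is a fBm with Hurst parameter `α/2 = H - γ/2`, `Y` is
a centered Gaussian process with covariance `covY H γ`, and the process `√κ B + Y` has the same
law as the process `X`. -/
structure IsDecomposition {Ω Ω' : Type*} [MeasurableSpace Ω] [MeasurableSpace Ω'] (H γ : ℝ)
    (X : ℝ≥0 → Ω → ℝ) (P : Measure Ω) (B Y : ℝ≥0 → Ω' → ℝ) (P' : Measure Ω') : Prop where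
  fbm : IsFBM ((2 * H - γ) / 2) B P'
  gaussianY : IsCenteredGaussian Y (covY H γ) P'
  joint : IsGaussianProcess (Sum.elim B Y) P'
  law : IdentDistrib (fun ω t => X t ω) (fun ω t => √(kappa H γ) * B t ω + Y t ω) P P'

end

/-!
# Convolutions with fractional Brownian motion as a sum of Gaussian processes

Everything reduces to the computation of one covariance, followed by a realization of it in a
Gaussian Hilbert space.

**The covariance.** The increments of an fBm `B` satisfy
`E[(B_b - B_a)(B_b' - B_a')] = ∫ ⟪ℱ1_(a,b], ℱ1_(a',b']⟫ dμ_H` with the spectral measure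
`μ_H = C_H⁻² |ξ|^{1-2H} dξ`. For integrands independent of `B` the elementary integral is therefore
an isometry into `L²(P ⊗ μ_H)` (`inner_stepLp_eq_inner_incrLp`), and the product of two stochastic
integrals has mean `E ∫ ⟪ℱf, ℱg⟫ dμ_H` (`IsFBMIntegral.integral_mul`). By Fubini, this number
depends on the integrands only through their covariances (`MeanSqIntegrable.integral_inner_congr`).
As `(s + t)^{-γ} = Γ(γ)⁻¹ ∫ e^{-sy} e^{-ty} y^{γ-1} dy`, the process `Z` may be replaced by the
deterministic family `s ↦ e^{-sy}`, regarded as a process on the measure space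
`((0, ∞), Γ(γ)⁻¹ y^{γ-1} dy)`. Its shifts have the explicit Fourier transforms
`(e^{iξt} - e^{-yt}) / (y + iξ)` (`fourierInt_lagged_expProcess`), and the substitution `ξ = η y`
turns their inner products into the sum of the inner products in `L²((0, ∞)²)` of the functions
`w(η, y) (cos(ηyt) - e^{-yt})` and of the functions `w(η, y) sin(ηyt)` (`integral_inner_lagExp`).

The same device gives the existence of the stochastic integrals: on the exponentials, the
left-point step approximations have the transforms above times a multiplier which is bounded
by `2` and tends to `1` (`fourierInt_laggedStep`, `norm_stepRatio_le`, `tendsto_stepRatio`), so that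
dominated convergence applies, and the convergence is carried over to `Z`, again because it
depends on covariances only (`IsLaplaceProcess.tendsto_fbmNormSq`).

**The decomposition.** Write `cos(ηyt) - e^{-yt} = (cos(ηyt) - 1) + (1 - e^{-yt})`. The functions
`w (cos(ηyt) - 1)` and `w sin(ηyt)` together have the Gram matrix `κ` times the covariance of the
fBm with Hurst parameter `α/2` (`integral_sheetCos_add_sheetSin`, by
`∫ (1 - cos ux) x^{-1-α} dx = c |u|^α`), and the functions `w (1 - e^{-yt})` have the Gram matrix
of `Y` (`integral_sheetExp`). If `j₁` and `j₂` are independent isonormal processes on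
`L²((0, ∞)²)`, then `U = j₁(w (cos - 1))`, `V = j₂(w sin)` and `Y = j₁(w (1 - e^{-yt}))` therefore
solve the problem (`isDecomposition_of_isonormal`), since a centered Gaussian process is determined
in law by its covariance (`IsCenteredGaussian.identDistrib`). Isonormal processes come from any
centered Gaussian family whose covariance is the Gram matrix of a total family of vectors
(`exists_isonormal`): from the indicators of rectangles for a Brownian sheet, of intervals for a
Brownian motion, and from an orthonormal basis for independent standard Gaussian variables.
-/

/-! ### Special integrals -/

lemma setLIntegral_ofReal_eq {f : ℝ → ℝ} {c : ℝ} (hf : IntegrableOn f (Set.Ioi 0))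
    (h0 : ∀ x, 0 < x → 0 ≤ f x) (hc : ∫ x in Set.Ioi (0 : ℝ), f x = c) :
    ∫⁻ x in Set.Ioi (0 : ℝ), ENNReal.ofReal (f x) = ENNReal.ofReal c := by
  rw [← hc, ofReal_integral_eq_lintegral_ofReal hf]
  exact (ae_restrict_iff' measurableSet_Ioi).2 (ae_of_all _ fun x hx => h0 x hx)

lemma integrableOn_of_setLIntegral_ofReal {f : ℝ → ℝ} {c : ℝ} (hm : Measurable f)
    (h0 : ∀ x, 0 < x → 0 ≤ f x)
    (h : ∫⁻ x in Set.Ioi (0 : ℝ), ENNReal.ofReal (f x) = ENNReal.ofReal c) :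
    IntegrableOn f (Set.Ioi 0) := by
  refine ⟨hm.aestronglyMeasurable, ?_⟩
  rw [hasFiniteIntegral_iff_ofReal, h]
  · exact ENNReal.ofReal_lt_top
  · exact (ae_restrict_iff' measurableSet_Ioi).2 (ae_of_all _ fun x hx => h0 x hx)

lemma setIntegral_of_setLIntegral_ofReal {f : ℝ → ℝ} {c : ℝ} (hm : Measurable f)
    (h0 : ∀ x, 0 < x → 0 ≤ f x) (hc : 0 ≤ c)
    (h : ∫⁻ x in Set.Ioi (0 : ℝ), ENNReal.ofReal (f x) = ENNReal.ofReal c) :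
    ∫ x in Set.Ioi (0 : ℝ), f x = c := by
  rw [integral_eq_lintegral_of_nonneg_ae _ hm.aestronglyMeasurable, h, ENNReal.toReal_ofReal hc]
  exact (ae_restrict_iff' measurableSet_Ioi).2 (ae_of_all _ fun x hx => h0 x hx)

lemma integrableOn_rpow_mul_exp_neg {a x : ℝ} (ha : 0 < a) (hx : 0 < x) :
    IntegrableOn (fun y : ℝ => y ^ (a - 1) * Real.exp (-(x * y))) (Set.Ioi 0) := by
  simpa using integrableOn_rpow_mul_exp_neg_mul_rpow (p := 1) (s := a - 1) (b := x)
    (by linarith) one_pos hx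

lemma integral_rpow_mul_exp_neg {a x : ℝ} (ha : 0 < a) (hx : 0 < x) :
    ∫ y in Set.Ioi (0 : ℝ), y ^ (a - 1) * Real.exp (-(x * y)) = Real.Gamma a * x ^ (-a) := by
  rw [Real.integral_rpow_mul_exp_neg_mul_Ioi ha hx, mul_comm, one_div, Real.inv_rpow hx.le,
    Real.rpow_neg hx.le]

lemma lintegral_rpow_mul_exp_neg {a x : ℝ} (ha : 0 < a) (hx : 0 < x) :
    ∫⁻ y in Set.Ioi (0 : ℝ), ENNReal.ofReal (y ^ (a - 1) * Real.exp (-(x * y)))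
      = ENNReal.ofReal (Real.Gamma a * x ^ (-a)) :=
  setLIntegral_ofReal_eq (integrableOn_rpow_mul_exp_neg ha hx)
    (fun y hy => by positivity) (integral_rpow_mul_exp_neg ha hx)

/-- The Mellin transform of `1 / (1 + z²)`, by writing `1 / (1 + z²) = ∫ e^{-u(1+z²)} du` and
using the reflection formula for the Gamma function. -/
lemma lintegral_rpow_div_one_add_sq {a : ℝ} (ha0 : 0 < a) (ha2 : a < 2) :
    ∫⁻ z in Set.Ioi (0 : ℝ), ENNReal.ofReal (z ^ (a - 1) / (1 + z ^ 2))
      = ENNReal.ofReal (Real.pi / (2 * Real.sin (Real.pi * a / 2))) := by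
  have h1 : ∀ z ∈ Set.Ioi (0 : ℝ), ENNReal.ofReal (z ^ (a - 1) / (1 + z ^ 2)) =
      ∫⁻ u in Set.Ioi (0 : ℝ), ENNReal.ofReal (Real.exp (-u)) *
        ENNReal.ofReal (z ^ (a - 1) * Real.exp (-u * z ^ (2 : ℝ))) := by
    intro z hz
    have hz0 : (0 : ℝ) < z := hz
    have h := lintegral_rpow_mul_exp_neg (a := 1) (x := 1 + z ^ 2) one_pos (by positivity)
    rw [Real.Gamma_one, one_mul, Real.rpow_neg_one] at h
    rw [div_eq_mul_inv, ENNReal.ofReal_mul (by positivity), ← h, ← lintegral_const_mul _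
      (by fun_prop)]
    refine lintegral_congr fun u => ?_
    rw [← ENNReal.ofReal_mul (by positivity), ← ENNReal.ofReal_mul (by positivity)]
    congr 1
    rw [sub_self, Real.rpow_zero, one_mul, mul_left_comm, ← Real.exp_add]
    congr 2
    rw [Real.rpow_two]
    ring
  rw [setLIntegral_congr_fun measurableSet_Ioi h1, lintegral_lintegral_swap (by fun_prop)]
  have h2 : ∀ u ∈ Set.Ioi (0 : ℝ), (∫⁻ z in Set.Ioi (0 : ℝ), ENNReal.ofReal (Real.exp (-u)) *
        ENNReal.ofReal (z ^ (a - 1) * Real.exp (-u * z ^ (2 : ℝ)))) =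
      ENNReal.ofReal (Real.Gamma (a / 2) / 2) *
        ENNReal.ofReal (u ^ ((1 - a / 2) - 1) * Real.exp (-(1 * u))) := by
    intro u hu
    have hu0 : (0 : ℝ) < u := hu
    rw [lintegral_const_mul _ (by fun_prop),
      setLIntegral_ofReal_eq (integrableOn_rpow_mul_exp_neg_mul_rpow (by linarith) two_pos hu)
      (fun y hy => by positivity)
      (integral_rpow_mul_exp_neg_mul_rpow (q := a - 1) two_pos (by linarith) hu)]
    have := Real.Gamma_pos_of_pos (half_pos ha0)
    rw [← ENNReal.ofReal_mul (by positivity), ← ENNReal.ofReal_mul (by positivity)]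
    congr 1
    rw [show -(a - 1 + 1) / 2 = 1 - a / 2 - 1 by ring, show (a - 1 + 1) / 2 = a / 2 by ring, one_mul]
    ring
  have hG := Real.Gamma_pos_of_pos (half_pos ha0)
  rw [setLIntegral_congr_fun measurableSet_Ioi h2, lintegral_const_mul _ (by fun_prop),
    lintegral_rpow_mul_exp_neg (by linarith) one_pos, Real.one_rpow, mul_one,
    ← ENNReal.ofReal_mul (by positivity), div_mul_eq_mul_div, Real.Gamma_mul_Gamma_one_sub]
  congr 1
  rw [div_div, mul_comm 2, mul_div_assoc]

lemma sin_pi_mul_half_pos {a : ℝ} (ha0 : 0 < a) (ha2 : a < 2) :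
    0 < Real.sin (Real.pi * a / 2) :=
  Real.sin_pos_of_pos_of_lt_pi (by positivity) (by nlinarith [Real.pi_pos])

lemma integrableOn_rpow_div_one_add_sq {a : ℝ} (ha0 : 0 < a) (ha2 : a < 2) :
    IntegrableOn (fun z : ℝ => z ^ (a - 1) / (1 + z ^ 2)) (Set.Ioi 0) :=
  integrableOn_of_setLIntegral_ofReal (by fun_prop) (fun z hz => by positivity)
    (lintegral_rpow_div_one_add_sq ha0 ha2)

lemma integral_rpow_div_one_add_sq {a : ℝ} (ha0 : 0 < a) (ha2 : a < 2) :
    ∫ z in Set.Ioi (0 : ℝ), z ^ (a - 1) / (1 + z ^ 2) =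
      Real.pi / (2 * Real.sin (Real.pi * a / 2)) :=
  setIntegral_of_setLIntegral_ofReal (by fun_prop) (fun z hz => by positivity)
    (by have := sin_pi_mul_half_pos ha0 ha2; positivity) (lintegral_rpow_div_one_add_sq ha0 ha2)

/-- The Laplace transform of `1 - cos`. -/
lemma lintegral_one_sub_cos_mul_exp_neg {y : ℝ} (hy : 0 < y) :
    ∫⁻ x in Set.Ioi (0 : ℝ), ENNReal.ofReal ((1 - Real.cos x) * Real.exp (-(x * y)))
      = ENNReal.ofReal (1 / (y * (1 + y ^ 2))) := by
  have ha : ((-y : ℂ) + Complex.I).re < 0 := by simpa using hy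
  have hb : (-y : ℂ).re < 0 := by simpa using hy
  have i1 := integrableOn_exp_mul_complex_Ioi ha 0
  have i2 := integrableOn_exp_mul_complex_Ioi hb 0
  have e : ∀ x : ℝ, (1 - Real.cos x) * Real.exp (-(x * y)) =
      RCLike.re (Complex.exp (-y * x) - Complex.exp ((-y + Complex.I) * x)) := by
    intro x
    simp [Complex.exp_re]
    ring_nf
  have hne : (-y + Complex.I : ℂ) ≠ 0 := by
    intro h
    have := congrArg Complex.im h
    simp at this
  refine setLIntegral_ofReal_eq ?_ (fun x _ => mul_nonneg (by linarith [Real.cos_le_one x])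
    (Real.exp_nonneg _)) ?_
  · simp_rw [e]
    exact (i2.sub i1).re
  · simp_rw [e]
    rw [integral_re (f := fun x : ℝ => Complex.exp (-y * x) - Complex.exp ((-y + Complex.I) * x))
      (i2.sub i1), integral_sub i2 i1, integral_exp_mul_complex_Ioi ha,
      integral_exp_mul_complex_Ioi hb]
    have : (-Complex.exp (-y * (0 : ℝ)) / (-y) - -Complex.exp ((-y + Complex.I) * (0 : ℝ)) /
        (-y + Complex.I) : ℂ) = ((1 / (y * (1 + y ^ 2)) : ℝ) : ℂ) - Complex.I / (1 + y ^ 2) := by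
      have hy' : (y : ℂ) ≠ 0 := by exact_mod_cast hy.ne'
      have h2 : (1 + y ^ 2 : ℂ) ≠ 0 := by
        have : (1 + y ^ 2 : ℝ) ≠ 0 := by positivity
        exact_mod_cast this
      have h3 : (-y + Complex.I) * (-y - Complex.I) = (1 + y ^ 2 : ℂ) := by
        linear_combination -Complex.I_sq
      push_cast
      simp only [mul_zero, Complex.exp_zero]
      have h4 : (1 : ℂ) / (-y + Complex.I) = (-y - Complex.I) / (1 + y ^ 2) := by
        rw [div_eq_div_iff hne h2]
        linear_combination -h3
      rw [neg_div, neg_div, h4]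
      field_simp
      ring
    have h2 : (1 + y ^ 2 : ℂ) = ((1 + y ^ 2 : ℝ) : ℂ) := by push_cast; ring
    rw [this, h2, map_sub]
    change (((1 / (y * (1 + y ^ 2)) : ℝ) : ℂ)).re - (Complex.I / ((1 + y ^ 2 : ℝ) : ℂ)).re = _
    rw [Complex.ofReal_re, Complex.div_ofReal_re, Complex.I_re, zero_div, sub_zero]

/-- The constant `∫_0^∞ (1 - cos x) x^{-1-a} dx = Γ(a+1)⁻¹ π / (2 sin(πa/2))`. -/
noncomputable def cosConst (a : ℝ) : ℝ :=
  Real.pi / (2 * Real.sin (Real.pi * a / 2)) / Real.Gamma (a + 1)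

lemma cosConst_pos {a : ℝ} (ha0 : 0 < a) (ha2 : a < 2) : 0 < cosConst a := by
  have := sin_pi_mul_half_pos ha0 ha2
  have := Real.Gamma_pos_of_pos (show 0 < a + 1 by linarith)
  have := Real.pi_pos
  unfold cosConst
  positivity

/-- The value of `∫_0^∞ (1 - cos x) x^{-1-a} dx`: write `x^{-1-a}` as the Gamma integral
`Γ(a+1)⁻¹ ∫ y^a e^{-xy} dy` and exchange the integrals. -/
lemma lintegral_one_sub_cos_mul_rpow {a : ℝ} (ha0 : 0 < a) (ha2 : a < 2) :
    ∫⁻ x in Set.Ioi (0 : ℝ), ENNReal.ofReal ((1 - Real.cos x) * x ^ (-a - 1))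
      = ENNReal.ofReal (cosConst a) := by
  have hG := Real.Gamma_pos_of_pos (show 0 < a + 1 by linarith)
  have hc : ∀ x, 0 ≤ 1 - Real.cos x := fun x => by linarith [Real.cos_le_one x]
  have h1 : ∀ x ∈ Set.Ioi (0 : ℝ), ENNReal.ofReal ((1 - Real.cos x) * x ^ (-a - 1)) =
      ∫⁻ y in Set.Ioi (0 : ℝ), ENNReal.ofReal ((Real.Gamma (a + 1))⁻¹ * y ^ a) *
        ENNReal.ofReal ((1 - Real.cos x) * Real.exp (-(x * y))) := by
    intro x hx
    have h := lintegral_rpow_mul_exp_neg (a := a + 1) (x := x) (by linarith) hx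
    rw [show (1 - Real.cos x) * x ^ (-a - 1) = ((Real.Gamma (a + 1))⁻¹ * (1 - Real.cos x)) *
      (Real.Gamma (a + 1) * x ^ (-(a + 1))) by rw [neg_add']; field_simp,
      ENNReal.ofReal_mul (mul_nonneg (by positivity) (hc x)), ← h, ← lintegral_const_mul _
      (by fun_prop)]
    refine setLIntegral_congr_fun measurableSet_Ioi fun y hy => ?_
    have hy0 : (0 : ℝ) < y := hy
    rw [← ENNReal.ofReal_mul (mul_nonneg (by positivity) (hc x)),
      ← ENNReal.ofReal_mul (by positivity)]
    congr 1
    rw [add_sub_cancel_right]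
    ring
  rw [setLIntegral_congr_fun measurableSet_Ioi h1, lintegral_lintegral_swap (by fun_prop)]
  have h2 : ∀ y ∈ Set.Ioi (0 : ℝ), (∫⁻ x in Set.Ioi (0 : ℝ),
        ENNReal.ofReal ((Real.Gamma (a + 1))⁻¹ * y ^ a) *
        ENNReal.ofReal ((1 - Real.cos x) * Real.exp (-(x * y)))) =
      ENNReal.ofReal (Real.Gamma (a + 1))⁻¹ *
        ENNReal.ofReal (y ^ (a - 1) / (1 + y ^ 2)) := by
    intro y hy
    have hy0 : (0 : ℝ) < y := hy
    rw [lintegral_const_mul _ (by fun_prop), lintegral_one_sub_cos_mul_exp_neg hy,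
      ← ENNReal.ofReal_mul (by positivity), ← ENNReal.ofReal_mul (by positivity)]
    congr 1
    rw [Real.rpow_sub_one hy0.ne']
    field_simp
  rw [setLIntegral_congr_fun measurableSet_Ioi h2, lintegral_const_mul _ (by fun_prop),
    lintegral_rpow_div_one_add_sq ha0 ha2, ← ENNReal.ofReal_mul (by positivity)]
  congr 1
  rw [cosConst, div_eq_mul_inv _ (Real.Gamma _), mul_comm]

lemma lintegral_one_sub_cos_mul_const_mul_rpow {a : ℝ} (ha0 : 0 < a) (ha2 : a < 2) {u : ℝ}
    (hu : 0 ≤ u) :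
    ∫⁻ x in Set.Ioi (0 : ℝ), ENNReal.ofReal ((1 - Real.cos (u * x)) * x ^ (-a - 1))
      = ENNReal.ofReal (u ^ a * cosConst a) := by
  rcases hu.eq_or_lt with rfl | hu
  · simp [Real.zero_rpow ha0.ne']
  have hK := (cosConst_pos ha0 ha2).le
  have hint := integrableOn_of_setLIntegral_ofReal (by fun_prop)
    (fun x hx => mul_nonneg (by linarith [Real.cos_le_one x]) (by positivity))
    (lintegral_one_sub_cos_mul_rpow ha0 ha2)
  have hval := setIntegral_of_setLIntegral_ofReal (by fun_prop)
    (fun x hx => mul_nonneg (by linarith [Real.cos_le_one x]) (by positivity)) hK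
    (lintegral_one_sub_cos_mul_rpow ha0 ha2)
  have e : ∀ x ∈ Set.Ioi (0 : ℝ), (1 - Real.cos (u * x)) * x ^ (-a - 1) =
      u ^ (a + 1) * ((1 - Real.cos (u * x)) * (u * x) ^ (-a - 1)) := by
    intro x hx
    have hx0 : (0 : ℝ) < x := hx
    rw [Real.mul_rpow hu.le hx0.le, show -a - 1 = -(a + 1) by ring, Real.rpow_neg hu.le]
    have := Real.rpow_pos_of_pos hu (a + 1)
    field_simp
  have hint' := (integrableOn_Ioi_comp_mul_left_iff
    (fun x : ℝ => (1 - Real.cos x) * x ^ (-a - 1)) 0 hu).2 (by simpa using hint)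
  refine setLIntegral_ofReal_eq ?_ (fun x hx =>
    mul_nonneg (by linarith [Real.cos_le_one (u * x)]) (by positivity)) ?_
  · exact IntegrableOn.congr_fun (hint'.const_mul (u ^ (a + 1))) (fun x hx => (e x hx).symm) measurableSet_Ioi
  · rw [setIntegral_congr_fun measurableSet_Ioi e, integral_const_mul,
      integral_comp_mul_left_Ioi (fun x : ℝ => (1 - Real.cos x) * x ^ (-a - 1)) _ hu, mul_zero, hval,
      Real.rpow_add_one hu.ne', smul_eq_mul]
    field_simp

lemma integrableOn_one_sub_cos_mul_rpow {a : ℝ} (ha0 : 0 < a) (ha2 : a < 2) (u : ℝ) :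
    IntegrableOn (fun x : ℝ => (1 - Real.cos (u * x)) * x ^ (-a - 1)) (Set.Ioi 0) := by
  have h := integrableOn_of_setLIntegral_ofReal (by fun_prop)
    (fun x hx => mul_nonneg (by linarith [Real.cos_le_one (|u| * x)]) (by positivity))
    (lintegral_one_sub_cos_mul_const_mul_rpow ha0 ha2 (abs_nonneg u))
  refine h.congr_fun (fun x hx => ?_) measurableSet_Ioi
  have hx0 : (0 : ℝ) < x := hx
  rw [← Real.cos_abs (u * x), abs_mul, abs_of_pos hx0]

lemma integral_one_sub_cos_mul_rpow {a : ℝ} (ha0 : 0 < a) (ha2 : a < 2) (u : ℝ) :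
    ∫ x in Set.Ioi (0 : ℝ), (1 - Real.cos (u * x)) * x ^ (-a - 1) = |u| ^ a * cosConst a := by
  rw [← setIntegral_of_setLIntegral_ofReal (by fun_prop)
    (fun x hx => mul_nonneg (by linarith [Real.cos_le_one (|u| * x)]) (by positivity))
    (mul_nonneg (by positivity) (cosConst_pos ha0 ha2).le)
    (lintegral_one_sub_cos_mul_const_mul_rpow ha0 ha2 (abs_nonneg u))]
  refine setIntegral_congr_fun measurableSet_Ioi (fun x hx => ?_)
  have hx0 : (0 : ℝ) < x := hx
  rw [← Real.cos_abs (u * x), abs_mul, abs_of_pos hx0]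

/-! ### Isometries between closed spans of families with the same Gram matrix -/

section Gram
open scoped RealInnerProductSpace

variable {E L T : Type*} [NormedAddCommGroup E] [InnerProductSpace ℝ E]
  [NormedAddCommGroup L] [InnerProductSpace ℝ L]

/-- The linear relation spanned by the pairs `(e t, g t)`. If the families `e` and `g` have the
same Gram matrix, it is the graph of a linear isometry from the span of `e` to the span of `g`. -/
def gramRel (e : T → E) (g : T → L) : Submodule ℝ (E × L) :=
  Submodule.span ℝ (Set.range fun t => (e t, g t))

lemma mem_gramRel (e : T → E) (g : T → L) (t : T) : (e t, g t) ∈ gramRel e g :=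
  Submodule.subset_span ⟨t, rfl⟩

lemma inner_eq_of_mem_gramRel {e : T → E} {g : T → L}
    (h : ∀ s t, ⟪e s, e t⟫ = ⟪g s, g t⟫) {p q : E × L}
    (hp : p ∈ gramRel e g) (hq : q ∈ gramRel e g) : ⟪p.1, q.1⟫ = ⟪p.2, q.2⟫ := by
  induction hp using Submodule.span_induction with
  | mem x hx =>
    obtain ⟨s, rfl⟩ := hx
    induction hq using Submodule.span_induction with
    | mem y hy => obtain ⟨t, rfl⟩ := hy; exact h s t
    | zero => simp
    | add y z _ _ hy hz => simp [inner_add_right, hy, hz]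
    | smul c y _ hy => simp [inner_smul_right, hy]
  | zero => simp
  | add y z _ _ hy hz => simp [inner_add_left, hy, hz]
  | smul c y _ hy => simp [inner_smul_left, hy]

/-- The closure of `gramRel e g`, the graph of the isometry between the closed spans. -/
def gramGraph (e : T → E) (g : T → L) : Submodule ℝ (E × L) := (gramRel e g).topologicalClosure

lemma gramRel_le_gramGraph (e : T → E) (g : T → L) : gramRel e g ≤ gramGraph e g :=
  Submodule.le_topologicalClosure _

lemma mem_gramGraph_iff {e : T → E} {g : T → L} {p : E × L} :
    p ∈ gramGraph e g ↔ ∃ q : ℕ → E × L, (∀ k, q k ∈ gramRel e g) ∧ Tendsto q atTop (𝓝 p) := by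
  rw [gramGraph, ← SetLike.mem_coe, Submodule.topologicalClosure_coe, mem_closure_iff_seq_limit]
  rfl

/-- The relation `gramGraph` preserves inner products if the Gram matrices agree. -/
lemma inner_eq_of_mem_gramGraph {e : T → E} {g : T → L}
    (h : ∀ s t, ⟪e s, e t⟫ = ⟪g s, g t⟫) {p q : E × L}
    (hp : p ∈ gramGraph e g) (hq : q ∈ gramGraph e g) : ⟪p.1, q.1⟫ = ⟪p.2, q.2⟫ := by
  obtain ⟨u, hu, hup⟩ := mem_gramGraph_iff.1 hp
  obtain ⟨v, hv, hvq⟩ := mem_gramGraph_iff.1 hq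
  have h1 := ((continuous_fst.tendsto _).comp hup).inner (𝕜 := ℝ)
    ((continuous_fst.tendsto _).comp hvq)
  have h2 := ((continuous_snd.tendsto _).comp hup).inner (𝕜 := ℝ)
    ((continuous_snd.tendsto _).comp hvq)
  refine tendsto_nhds_unique h1 (h2.congr fun k => ?_)
  exact (inner_eq_of_mem_gramRel h (hu k) (hv k)).symm

lemma norm_eq_of_mem_gramGraph {e : T → E} {g : T → L}
    (h : ∀ s t, ⟪e s, e t⟫ = ⟪g s, g t⟫) {p : E × L} (hp : p ∈ gramGraph e g) : ‖p.1‖ = ‖p.2‖ := by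
  rw [← sq_eq_sq₀ (norm_nonneg _) (norm_nonneg _), ← real_inner_self_eq_norm_sq,
    ← real_inner_self_eq_norm_sq, inner_eq_of_mem_gramGraph h hp hp]

lemma snd_mem_closure_of_mem_gramGraph {e : T → E} {g : T → L} {p : E × L}
    (hp : p ∈ gramGraph e g) : p.2 ∈ (Submodule.span ℝ (Set.range g)).topologicalClosure := by
  obtain ⟨u, hu, hup⟩ := mem_gramGraph_iff.1 hp
  rw [← SetLike.mem_coe, Submodule.topologicalClosure_coe]
  refine mem_closure_of_tendsto ((continuous_snd.tendsto _).comp hup)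
    (Eventually.of_forall fun k => ?_)
  have : (u k).2 ∈ (gramRel e g).map (LinearMap.snd ℝ E L) := ⟨u k, hu k, rfl⟩
  rwa [gramRel, Submodule.map_span, ← Set.range_comp] at this

/-- If `(u k).1` converges for a sequence `u` in the relation, then so does `(u k).2`. -/
lemma exists_tendsto_of_mem_gramRel [CompleteSpace L] {e : T → E} {g : T → L}
    (h : ∀ s t, ⟪e s, e t⟫ = ⟪g s, g t⟫) {u : ℕ → E × L} (hu : ∀ k, u k ∈ gramRel e g) {x : E}
    (hx : Tendsto (fun k => (u k).1) atTop (𝓝 x)) :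
    ∃ j, Tendsto (fun k => (u k).2) atTop (𝓝 j) ∧ (x, j) ∈ gramGraph e g := by
  have hc : CauchySeq fun k => (u k).2 := by
    rw [Metric.cauchySeq_iff]
    intro ε hε
    obtain ⟨N, hN⟩ := Metric.cauchySeq_iff.1 hx.cauchySeq ε hε
    refine ⟨N, fun m hm n hn => ?_⟩
    have := hN m hm n hn
    rw [dist_eq_norm] at this ⊢
    have h2 := norm_eq_of_mem_gramGraph h
      (gramRel_le_gramGraph _ _ (Submodule.sub_mem _ (hu m) (hu n)))
    rw [Prod.fst_sub, Prod.snd_sub] at h2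
    rwa [← h2]
  obtain ⟨j, hj⟩ := cauchySeq_tendsto_of_complete hc
  exact ⟨j, hj, mem_gramGraph_iff.2 ⟨u, hu, hx.prodMk_nhds hj⟩⟩

/-- If `e` is total, then the isometry with graph `gramGraph e g` is defined everywhere. -/
lemma exists_mem_gramGraph [CompleteSpace L] {e : T → E} {g : T → L}
    (h : ∀ s t, ⟪e s, e t⟫ = ⟪g s, g t⟫)
    (hd : (Submodule.span ℝ (Set.range e)).topologicalClosure = ⊤) (x : E) :
    ∃ j, (x, j) ∈ gramGraph e g := by
  have hx : x ∈ (Submodule.span ℝ (Set.range e)).topologicalClosure := hd ▸ Submodule.mem_top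
  rw [← SetLike.mem_coe, Submodule.topologicalClosure_coe, mem_closure_iff_seq_limit] at hx
  obtain ⟨v, hv, hvx⟩ := hx
  have : ∀ k, ∃ p ∈ gramRel e g, p.1 = v k := by
    intro k
    have h1 : v k ∈ (gramRel e g).map (LinearMap.fst ℝ E L) := by
      rw [gramRel, Submodule.map_span, ← Set.range_comp]
      exact hv k
    exact h1
  choose u hu huv using this
  obtain ⟨j, -, hj⟩ := exists_tendsto_of_mem_gramRel h hu (x := x) (by simpa [huv] using hvx)
  exact ⟨j, hj⟩

lemma exists_sum_of_mem_gramRel {e : T → E} {g : T → L} {p : E × L} (hp : p ∈ gramRel e g) :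
    ∃ (n : ℕ) (c : Fin n → ℝ) (τ : Fin n → T),
      p.1 = ∑ i, c i • e (τ i) ∧ p.2 = ∑ i, c i • g (τ i) := by
  obtain ⟨n, c, f, rfl⟩ := Submodule.mem_span_set'.1 hp
  choose τ hτ using fun i => (f i).2
  refine ⟨n, c, τ, ?_, ?_⟩
  · simp [Prod.fst_sum, ← hτ]
  · simp [Prod.snd_sum, ← hτ]

end Gram

/-! ### Gaussian subspaces of `L²` -/

section Gaussian

variable {T S Ω : Type*} [MeasurableSpace Ω] {P : Measure Ω}

lemma coeFn_sum_smul_ae_eq {ι : Type*} [Fintype ι] (c : ι → ℝ) {u : ι → Lp ℝ 2 P}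
    {f : ι → Ω → ℝ} (h : ∀ i, u i =ᵐ[P] f i) :
    ⇑(∑ i, c i • u i) =ᵐ[P] fun ω => ∑ i, c i * f i ω := by
  have h1 := Lp.coeFn_fun_finsetSum Finset.univ fun i => c i • u i
  have h2 : ∀ᵐ ω ∂P, ∀ i, (c i • u i) ω = c i * f i ω := by
    rw [ae_all_iff]
    intro i
    filter_upwards [Lp.coeFn_smul (c i) (u i), h i] with ω h3 h4
    simp [h3, h4]
  filter_upwards [h1, h2] with ω h3 h4
  rw [h3]
  exact Finset.sum_congr rfl fun i _ => h4 i

/-- A process is Gaussian if all its finite linear combinations are Gaussian. -/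
lemma isGaussianProcess_of_forall_sum {X : S → Ω → ℝ} (hX : ∀ s, AEMeasurable (X s) P)
    (h : ∀ (I : Finset S) (c : I → ℝ), HasGaussianLaw (fun ω => ∑ s, c s * X s ω) P) :
    IsGaussianProcess X P := by
  refine ⟨fun I => ⟨isGaussian_of_isGaussian_map fun L => ?_⟩⟩
  have hm : AEMeasurable (fun ω => I.restrict (X · ω)) P :=
    aemeasurable_pi_lambda _ fun s => hX s
  rw [AEMeasurable.map_map_of_aemeasurable (by fun_prop) hm]
  classical
  convert (h I fun s => L (Pi.single s 1)).isGaussian_map using 2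
  ext ω
  have : I.restrict (X · ω) = ∑ s : I, X s ω • (Pi.single s (1 : ℝ) : I → ℝ) := by
    ext s
    simp [Finset.sum_apply, Pi.single_apply]
  rw [Function.comp_apply, this, map_sum]
  simp [mul_comm]

/-- An `L²` limit of centered Gaussian random variables is a centered Gaussian random variable. -/
lemma isClosed_centered_gaussian [IsProbabilityMeasure P] :
    IsClosed {f : Lp ℝ 2 P | HasGaussianLaw f P ∧ ∫ ω, f ω ∂P = 0} := by
  refine IsSeqClosed.isClosed fun u f hu huf => ?_
  have hmean : Tendsto (fun n => ∫ ω, u n ω ∂P) atTop (𝓝 (∫ ω, f ω ∂P)) := by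
    have h1 : Tendsto (fun n => (eLpNorm (⇑(u n) - ⇑f) 1 P)) atTop (𝓝 0) := by
      have h2 := (Lp.tendsto_Lp_iff_tendsto_eLpNorm' u f).1 huf
      refine tendsto_of_tendsto_of_tendsto_of_le_of_le tendsto_const_nhds h2 (fun _ => zero_le)
        fun n => ?_
      exact eLpNorm_le_eLpNorm_of_exponent_le one_le_two
        ((Lp.aestronglyMeasurable _).sub (Lp.aestronglyMeasurable _))
    exact tendsto_integral_of_L1' _ (Lp.aestronglyMeasurable f)
      (Eventually.of_forall fun n => (Lp.memLp (u n)).integrable one_le_two) h1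
  have h0 : ∫ ω, f ω ∂P = 0 := by
    simp_rw [fun n => (hu n).2] at hmean
    exact tendsto_nhds_unique hmean tendsto_const_nhds |>.symm ▸ rfl
  refine ⟨⟨?_⟩, h0⟩
  have hfm : AEMeasurable f P := (Lp.aestronglyMeasurable f).aemeasurable
  have : IsProbabilityMeasure (P.map f) := Measure.isProbabilityMeasure_map hfm
  -- The characteristic functions of the `u n` are explicit in `‖u n‖`, so they converge to that of
  -- the Gaussian law with variance `‖f‖²`. They also converge to that of `f`, by dominated
  -- convergence along a subsequence that converges almost everywhere.
  have hg : P.map f = gaussianReal 0 (‖f‖ ^ 2).toNNReal := by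
    refine Measure.ext_of_charFun (funext fun t => ?_)
    have hlaw : ∀ n, charFun (P.map (u n)) t = Complex.exp (-(‖u n‖ ^ 2 : ℝ) * t ^ 2 / 2) := by
      intro n
      have h3 : Var[u n; P] = ‖u n‖ ^ 2 := by
        rw [variance_of_integral_eq_zero (Lp.aestronglyMeasurable _).aemeasurable (hu n).2,
          ← real_inner_self_eq_norm_sq, L2.inner_def]
        simp [sq]
      rw [(hu n).1.map_eq_gaussianReal, (hu n).2, h3, charFun_gaussianReal]
      congr 1
      rw [Real.coe_toNNReal _ (by positivity)]
      push_cast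
      ring
    have l1 : Tendsto (fun n => charFun (P.map (u n)) t) atTop
        (𝓝 (Complex.exp (-(‖f‖ ^ 2 : ℝ) * t ^ 2 / 2))) := by
      simp_rw [hlaw]
      have : Tendsto (fun n => ((‖u n‖ ^ 2 : ℝ) : ℂ)) atTop (𝓝 ((‖f‖ ^ 2 : ℝ) : ℂ)) :=
        (Complex.continuous_ofReal.tendsto _).comp (huf.norm.pow 2)
      exact (Complex.continuous_exp.tendsto _).comp
        (((this.neg).mul_const _).div_const _)
    have l2 : Tendsto (fun n => charFun (P.map (u n)) t) atTop (𝓝 (charFun (P.map f) t)) := by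
      obtain ⟨ns, hns, hae⟩ := (tendstoInMeasure_of_tendsto_Lp huf).exists_seq_tendsto_ae
      have l3 : Tendsto (fun n => charFun (P.map (u (ns n))) t) atTop
          (𝓝 (charFun (P.map f) t)) := by
        simp_rw [charFun_apply_real]
        rw [integral_map hfm (by fun_prop)]
        have : ∀ n, ∫ x, Complex.exp (t * x * Complex.I) ∂(P.map (u n)) =
            ∫ ω, Complex.exp (t * (u n ω : ℝ) * Complex.I) ∂P := fun n =>
          integral_map (Lp.aestronglyMeasurable (u n)).aemeasurable (by fun_prop)
        simp_rw [this]
        refine tendsto_integral_of_dominated_convergence (fun _ => 1) (fun n => ?_)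
          (integrable_const _) (fun n => ae_of_all _ fun ω => ?_) ?_
        · have := (Lp.aestronglyMeasurable (u (ns n))).aemeasurable
          exact (by fun_prop : AEMeasurable _ P).aestronglyMeasurable
        · rw [← Complex.ofReal_mul, Complex.norm_exp_ofReal_mul_I]
        · filter_upwards [hae] with ω hω
          have hc : Continuous fun x : ℝ => Complex.exp (t * x * Complex.I) := by fun_prop
          exact (hc.tendsto _).comp hω
      exact (tendsto_nhds_unique (l1.comp hns.tendsto_atTop) l3) ▸ l1
    rw [tendsto_nhds_unique l2 l1, charFun_gaussianReal]
    congr 1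
    rw [Real.coe_toNNReal _ (by positivity)]
    push_cast
    ring
  rw [hg]
  infer_instance

lemma centered_gaussian_of_mem_span {G : T → Ω → ℝ} (hG : IsGaussianProcess G P)
    (h0 : ∀ t, ∫ ω, G t ω ∂P = 0) (hL : ∀ t, MemLp (G t) 2 P) {f : Lp ℝ 2 P}
    (hf : f ∈ Submodule.span ℝ (Set.range fun t => (hL t).toLp (G t))) :
    HasGaussianLaw f P ∧ ∫ ω, f ω ∂P = 0 := by
  have := hG.isProbabilityMeasure
  obtain ⟨n, c, v, rfl⟩ := Submodule.mem_span_set'.1 hf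
  choose τ hτ using fun i => (v i).2
  have hae : ⇑(∑ i, c i • (v i : Lp ℝ 2 P)) =ᵐ[P] fun ω => ∑ i, c i * G (τ i) ω :=
    coeFn_sum_smul_ae_eq c fun i => hτ i ▸ (hL (τ i)).coeFn_toLp
  constructor
  · have hp : IsGaussianProcess (fun (_ : Unit) ω => ∑ i, c i * G (τ i) ω) P := by
      refine hG.of_isGaussianProcess fun _ => ?_
      classical
      refine ⟨Finset.univ.image τ, ∑ i, c i • ContinuousLinearMap.proj (R := ℝ)
        (⟨τ i, by simp⟩ : (Finset.univ.image τ : Finset T)), fun ω => ?_⟩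
      simp
    exact (hp.hasGaussianLaw_eval ()).congr hae.symm
  · rw [integral_congr_ae hae, integral_finsetSum]
    · simp [integral_const_mul, h0]
    · exact fun i _ => ((hL (τ i)).integrable one_le_two).const_mul _

/-- A family in the closed span of a centered Gaussian process is a centered Gaussian process. -/
lemma gaussian_of_forall_mem_closure {G : T → Ω → ℝ} (hG : IsGaussianProcess G P)
    (h0 : ∀ t, ∫ ω, G t ω ∂P = 0) (hL : ∀ t, MemLp (G t) 2 P) {X : S → Ω → ℝ}
    (hX : ∀ s, MemLp (X s) 2 P) (h : ∀ s, (hX s).toLp (X s) ∈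
      (Submodule.span ℝ (Set.range fun t => (hL t).toLp (G t))).topologicalClosure) :
    IsGaussianProcess X P ∧ ∀ s, ∫ ω, X s ω ∂P = 0 := by
  have := hG.isProbabilityMeasure
  set M := (Submodule.span ℝ (Set.range fun t => (hL t).toLp (G t))).topologicalClosure with hM
  have hmem : ∀ f ∈ M, HasGaussianLaw f P ∧ ∫ ω, f ω ∂P = 0 := by
    intro f hf
    rw [hM, ← SetLike.mem_coe, Submodule.topologicalClosure_coe] at hf
    exact closure_minimal (fun f hf => centered_gaussian_of_mem_span hG h0 hL hf)
      isClosed_centered_gaussian hf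
  constructor
  · refine isGaussianProcess_of_forall_sum (fun s => (hX s).1.aemeasurable) fun I c => ?_
    have h1 : (∑ s : I, c s • (hX s).toLp (X s)) ∈ M :=
      Submodule.sum_mem _ fun s _ => Submodule.smul_mem _ _ (h s)
    exact (hmem _ h1).1.congr (coeFn_sum_smul_ae_eq c fun s => (hX s).coeFn_toLp)
  · intro s
    rw [← (hmem _ (h s)).2]
    exact integral_congr_ae (hX s).coeFn_toLp.symm

lemma IsCenteredGaussian.memLp {X : T → Ω → ℝ} {K : T → T → ℝ}
    (hX : IsCenteredGaussian X K P) (t : T) : MemLp (X t) 2 P :=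
  (hX.gaussian.hasGaussianLaw_eval t).memLp_two

/-- The characteristic functions of the finite-dimensional marginals of a centered Gaussian process
involve the covariance alone. -/
lemma IsCenteredGaussian.charFunDual_map_restrict [DecidableEq T] {X : T → Ω → ℝ}
    {K : T → T → ℝ} (hX : IsCenteredGaussian X K P) (I : Finset T) (L : StrongDual ℝ (I → ℝ)) :
    charFunDual (P.map fun ω => I.restrict (X · ω)) L = Complex.exp
      (-((∑ s : I, ∑ t : I, L (Pi.single s 1) * L (Pi.single t 1) * K s t : ℝ) : ℂ) / 2) := by
  have := hX.gaussian.isProbabilityMeasure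
  have hL : (L ∘ fun ω => I.restrict (X · ω)) =
      fun ω => ∑ s : I, L (Pi.single s 1) * X s ω := by
    ext ω
    have : I.restrict (X · ω) = ∑ s : I, X s ω • (Pi.single s (1 : ℝ) : I → ℝ) := by
      ext s
      simp [Finset.sum_apply, Pi.single_apply]
    rw [Function.comp_apply, this, map_sum]
    simp [mul_comm]
  have hi : ∀ t, Integrable (X t) P := fun t => (hX.memLp t).integrable one_le_two
  have h0 : ∫ ω, ∑ s : I, L (Pi.single s 1) * X s ω ∂P = 0 := by
    rw [integral_finsetSum _ fun (s : I) _ => (hi s).const_mul _]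
    simp [integral_const_mul, hX.mean]
  have hv : Var[fun ω => ∑ s : I, L (Pi.single s 1) * X s ω; P] =
      ∑ s : I, ∑ t : I, L (Pi.single s 1) * L (Pi.single t 1) * K s t := by
    have hm := hX.measurable
    rw [variance_of_integral_eq_zero (by fun_prop) h0]
    simp_rw [sq, Finset.sum_mul_sum]
    have hii : ∀ s t : I, Integrable (fun ω => L (Pi.single s 1) * X s ω *
        (L (Pi.single t 1) * X t ω)) P := fun s t =>
      MemLp.integrable_mul ((hX.memLp s).const_mul _) ((hX.memLp t).const_mul _)
    rw [integral_finsetSum _ fun s _ => integrable_finsetSum _ fun t _ => hii s t]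
    refine Finset.sum_congr rfl fun s _ => ?_
    rw [integral_finsetSum _ fun t _ => hii s t]
    refine Finset.sum_congr rfl fun t _ => ?_
    rw [← hX.cov, ← integral_const_mul]
    exact integral_congr_ae (ae_of_all _ fun ω => by ring)
  rw [(hX.gaussian.hasGaussianLaw I).charFunDual_map_eq, hL, h0, hv]
  congr 1
  push_cast
  ring

/-- A centered Gaussian process is determined in law by its covariance. -/
lemma IsCenteredGaussian.identDistrib {Ω' : Type*} [MeasurableSpace Ω'] {P' : Measure Ω'}
    {X : T → Ω → ℝ} {X' : T → Ω' → ℝ} {K : T → T → ℝ}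
    (hX : IsCenteredGaussian X K P) (hX' : IsCenteredGaussian X' K P') :
    IdentDistrib (fun ω t => X t ω) (fun ω t => X' t ω) P P' := by
  have := hX.gaussian.isProbabilityMeasure
  have := hX'.gaussian.isProbabilityMeasure
  have m1 : Measurable fun ω t => X t ω := measurable_pi_lambda _ hX.measurable
  have m2 : Measurable fun ω t => X' t ω := measurable_pi_lambda _ hX'.measurable
  refine ⟨m1.aemeasurable, m2.aemeasurable, ?_⟩
  refine (isProjectiveLimit_map m1.aemeasurable).unique ?_
  intro I
  rw [isProjectiveLimit_map m2.aemeasurable I]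
  have p1 : IsProbabilityMeasure (P.map fun ω => I.restrict (X · ω)) :=
    (hX.gaussian.hasGaussianLaw I).isGaussian_map.toIsProbabilityMeasure
  have p2 : IsProbabilityMeasure (P'.map fun ω => I.restrict (X' · ω)) :=
    (hX'.gaussian.hasGaussianLaw I).isGaussian_map.toIsProbabilityMeasure
  refine Measure.ext_of_charFunDual (funext fun L => ?_)
  classical
  rw [hX.charFunDual_map_restrict, hX'.charFunDual_map_restrict]

end Gaussian

/-! ### Isonormal processes -/

section Isonormal
open scoped RealInnerProductSpace

variable {T ι Ω E : Type*} [MeasurableSpace Ω] {P : Measure Ω}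
  [NormedAddCommGroup E] [InnerProductSpace ℝ E]

/-- Let `G i`, `i ∈ ι`, be jointly Gaussian, mutually uncorrelated centered processes, each with
covariance `⟪e s, e t⟫` for a family `e` which is total in `E`. Then each `G i` extends to an
isonormal process `j i` on `E`, and the `j i` are jointly Gaussian and uncorrelated. -/
lemma exists_isonormal {e : T → E}
    (hd : (Submodule.span ℝ (Set.range e)).topologicalClosure = ⊤) {G : ι → T → Ω → ℝ}
    (hG : IsGaussianProcess (fun p : ι × T => G p.1 p.2) P) (h0 : ∀ i t, ∫ ω, G i t ω ∂P = 0)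
    (hL : ∀ i t, MemLp (G i t) 2 P)
    (h1 : ∀ i s t, ∫ ω, G i s ω * G i t ω ∂P = ⟪e s, e t⟫)
    (h2 : ∀ i k, i ≠ k → ∀ s t, ∫ ω, G i s ω * G k t ω ∂P = 0) :
    ∃ j : ι → E → Lp ℝ 2 P,
      (∀ i x, (x, j i x) ∈ gramGraph e fun t => (hL i t).toLp (G i t)) ∧
      IsGaussianProcess (fun p : ι × E => ⇑(j p.1 p.2)) P ∧
      (∀ i x, ∫ ω, j i x ω ∂P = 0) ∧
      (∀ i x y, ∫ ω, j i x ω * j i y ω ∂P = ⟪x, y⟫) ∧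
      ∀ i k, i ≠ k → ∀ x y, ∫ ω, j i x ω * j k y ω ∂P = 0 := by
  have hin : ∀ i k s t, ⟪(hL i s).toLp (G i s), (hL k t).toLp (G k t)⟫ =
      ∫ ω, G i s ω * G k t ω ∂P := by
    intro i k s t
    rw [L2.inner_def]
    refine integral_congr_ae ?_
    filter_upwards [(hL i s).coeFn_toLp, (hL k t).coeFn_toLp] with ω h3 h4
    simp [h3, h4, mul_comm]
  have hg : ∀ i s t, ⟪e s, e t⟫ = ⟪(hL i s).toLp (G i s), (hL i t).toLp (G i t)⟫ := by
    intro i s t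
    rw [hin, h1]
  choose j hj using fun i x => exists_mem_gramGraph (hg i) hd x
  have hin' : ∀ f g : Lp ℝ 2 P, ∫ ω, f ω * g ω ∂P = ⟪f, g⟫ := by
    intro f g
    rw [L2.inner_def]
    exact integral_congr_ae (ae_of_all _ fun ω => by simp [mul_comm])
  -- All the `j i x` lie in the closed span of the single Gaussian process `G`, which makes them
  -- jointly Gaussian.
  have hmem := gaussian_of_forall_mem_closure hG (fun p => h0 p.1 p.2) (fun p => hL p.1 p.2)
    (X := fun p : ι × E => ⇑(j p.1 p.2)) (fun p => Lp.memLp _) (fun p => by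
      rw [Lp.toLp_coeFn]
      refine Submodule.topologicalClosure_mono (Submodule.span_mono ?_)
        (snd_mem_closure_of_mem_gramGraph (hj p.1 p.2))
      rintro _ ⟨t, rfl⟩
      exact ⟨(p.1, t), rfl⟩)
  refine ⟨j, hj, hmem.1, fun i x => hmem.2 (i, x), fun i x y => ?_, fun i k hik x y => ?_⟩
  · rw [hin']
    exact (inner_eq_of_mem_gramGraph (hg i) (hj i x) (hj i y)).symm
  · rw [hin']
    set A := Submodule.span ℝ (Set.range fun t => (hL i t).toLp (G i t))
    set B := Submodule.span ℝ (Set.range fun t => (hL k t).toLp (G k t))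
    have hAB : A ⟂ B := by
      rw [Submodule.isOrtho_span]
      rintro _ ⟨s, rfl⟩ _ ⟨t, rfl⟩
      rw [hin, h2 i k hik]
    have hA : A.topologicalClosure ≤ Bᗮ :=
      Submodule.topologicalClosure_minimal _ hAB (Submodule.isClosed_orthogonal _)
    have hB : B.topologicalClosure ≤ A.topologicalClosureᗮ :=
      Submodule.topologicalClosure_minimal _ (Submodule.IsOrtho.symm hA)
        (Submodule.isClosed_orthogonal _)
    exact Submodule.inner_right_of_mem_orthogonal (snd_mem_closure_of_mem_gramGraph (hj i x))
      (hB (snd_mem_closure_of_mem_gramGraph (hj k y)))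

end Isonormal

/-! ### Totality of the indicator functions of orthants -/

section Dense
open scoped RealInnerProductSpace

variable {α T : Type*} [MeasurableSpace α] [SemilatticeInf α] {μ : Measure α}

/-- If the orthants `{x ≤ p}` generate the σ-algebra and have finite measure, and countably many
of them cover the space, then their indicators are total in `L²`. Orthants of measure zero may be
left out of the family. -/
lemma span_indicator_Iic_dense (hgen : ‹MeasurableSpace α› = MeasurableSpace.generateFrom
      (Set.range Set.Iic)) (hm : ∀ p : α, MeasurableSet (Set.Iic p))
    (hfin : ∀ p : α, μ (Set.Iic p) ≠ ∞) {q : ℕ → α} (hq : ∀ x, ∃ n, x ≤ q n) {v : T → α}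
    (hv : ∀ p, μ (Set.Iic p) = 0 ∨ p ∈ Set.range v) :
    (Submodule.span ℝ (Set.range fun t => indicatorConstLp 2 (hm (v t)) (hfin (v t))
      (1 : ℝ))).topologicalClosure = ⊤ := by
  rw [Submodule.topologicalClosure_eq_top_iff, Submodule.eq_bot_iff]
  intro g hg
  have h0 : ∀ p, ∫ x in Set.Iic p, g x ∂μ = 0 := by
    intro p
    rcases hv p with h | ⟨t, rfl⟩
    · exact setIntegral_measure_zero _ h
    · rw [← L2.inner_indicatorConstLp_one (𝕜 := ℝ) (hm (v t)) (hfin (v t))]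
      exact Submodule.inner_right_of_mem_orthogonal
        (Submodule.subset_span (Set.mem_range_self t)) hg
  have hae : ∀ n, g =ᵐ[μ.restrict (Set.Iic (q n))] 0 := by
    intro n
    have : IsFiniteMeasure (μ.restrict (Set.Iic (q n))) :=
      ⟨by simpa using (hfin (q n)).lt_top⟩
    have hi : Integrable g (μ.restrict (Set.Iic (q n))) :=
      ((Lp.memLp g).restrict _).integrable one_le_two
    refine hi.ae_eq_zero_of_forall_setIntegral_eq_zero fun s hs hs' => ?_
    clear hs'
    have hpi : IsPiSystem (Set.range (Set.Iic : α → Set α)) := by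
      rintro _ ⟨p, rfl⟩ _ ⟨r, rfl⟩ -
      exact ⟨p ⊓ r, Set.Iic_inter_Iic.symm⟩
    induction s, hs using MeasurableSpace.induction_on_inter hgen hpi with
    | empty => simp
    | basic t ht =>
      obtain ⟨p, rfl⟩ := ht
      rw [Measure.restrict_restrict (hm p), Set.Iic_inter_Iic, h0]
    | compl t htm ih =>
      have := integral_add_compl htm hi
      rw [ih, zero_add, h0] at this
      exact this
    | iUnion f hd hfm ih =>
      rw [integral_iUnion hfm hd hi.integrableOn]
      simp [ih]
  have hcov : (⋃ n, Set.Iic (q n)) = Set.univ := by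
    ext x
    simpa using hq x
  have : g =ᵐ[μ] 0 := by
    have h := (ae_restrict_iUnion_iff (fun n => Set.Iic (q n)) fun x => g x = 0).2 hae
    rwa [hcov, Measure.restrict_univ] at h
  exact (Lp.eq_zero_iff_ae_eq_zero).2 this

lemma generateFrom_Iic_prod : (inferInstance : MeasurableSpace (ℝ × ℝ)) =
    MeasurableSpace.generateFrom (Set.range Set.Iic) := by
  have h1 : MeasurableSpace.generateFrom (Set.range (Set.Iic : ℝ → Set ℝ)) = borel ℝ :=
    (borel_eq_generateFrom_Iic ℝ).symm
  have hs : IsCountablySpanning (Set.range (Set.Iic : ℝ → Set ℝ)) := by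
    refine ⟨fun n => Set.Iic (n : ℝ), fun n => ⟨n, rfl⟩, ?_⟩
    ext x
    simpa using exists_nat_ge x
  have h2 := generateFrom_prod_eq hs hs
  rw [h1, ← BorelSpace.measurable_eq] at h2
  refine h2.trans (congrArg _ ?_)
  ext s
  simp only [Set.mem_image2, Set.mem_range]
  constructor
  · rintro ⟨_, ⟨a, rfl⟩, _, ⟨b, rfl⟩, rfl⟩
    exact ⟨(a, b), Set.Iic_prod_eq (a, b)⟩
  · rintro ⟨⟨a, b⟩, rfl⟩
    exact ⟨_, ⟨a, rfl⟩, _, ⟨b, rfl⟩, (Set.Iic_prod_eq (a, b)).symm⟩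

end Dense

/-! ### Wiener integrals -/

section Wiener
open scoped RealInnerProductSpace

/-- Lebesgue measure on `(0, ∞)`. -/
noncomputable abbrev halfLine : Measure ℝ := volume.restrict (Set.Ioi 0)

/-- Lebesgue measure on `(0, ∞)²`. -/
noncomputable abbrev quadrant : Measure (ℝ × ℝ) := volume.restrict (Set.Ioi 0 ×ˢ Set.Ioi 0)

lemma quadrant_eq_prod : quadrant = halfLine.prod halfLine := by
  rw [quadrant, Measure.prod_restrict, Measure.volume_eq_prod]

lemma halfLine_Iic (a : ℝ) : halfLine (Set.Iic a) = ENNReal.ofReal a := by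
  rw [Measure.restrict_apply measurableSet_Iic, Set.inter_comm, Set.Ioi_inter_Iic, Real.volume_Ioc,
    sub_zero]

lemma quadrant_Iic (p : ℝ × ℝ) :
    quadrant (Set.Iic p) = ENNReal.ofReal p.1 * ENNReal.ofReal p.2 := by
  rw [quadrant_eq_prod, Set.Iic_prod_eq, Measure.prod_prod, halfLine_Iic, halfLine_Iic]

lemma halfLine_Iic_ne_top (a : ℝ) : halfLine (Set.Iic a) ≠ ∞ := by
  rw [halfLine_Iic]
  exact ENNReal.ofReal_ne_top

lemma quadrant_Iic_ne_top (p : ℝ × ℝ) : quadrant (Set.Iic p) ≠ ∞ := by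
  rw [quadrant_Iic]
  exact ENNReal.mul_ne_top ENNReal.ofReal_ne_top ENNReal.ofReal_ne_top

/-- The indicator of `(0, t]` in `L²(0, ∞)`. -/
noncomputable def intervalLp (t : ℝ≥0) : Lp ℝ 2 halfLine :=
  indicatorConstLp 2 measurableSet_Iic (halfLine_Iic_ne_top t) 1

/-- The indicator of `(0, p₁] × (0, p₂]` in `L²((0, ∞)²)`. -/
noncomputable def rectLp (p : ℝ≥0 × ℝ≥0) : Lp ℝ 2 quadrant :=
  indicatorConstLp 2 measurableSet_Iic (quadrant_Iic_ne_top ((p.1 : ℝ), (p.2 : ℝ))) 1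

lemma span_intervalLp_dense :
    (Submodule.span ℝ (Set.range intervalLp)).topologicalClosure = ⊤ := by
  refine span_indicator_Iic_dense (μ := halfLine) (v := fun t : ℝ≥0 => (t : ℝ))
    (BorelSpace.measurable_eq.trans (borel_eq_generateFrom_Iic ℝ)) (fun _ => measurableSet_Iic)
    halfLine_Iic_ne_top (q := fun n => (n : ℝ)) exists_nat_ge fun p => ?_
  rcases le_total p 0 with h | h
  · left
    rw [halfLine_Iic, ENNReal.ofReal_of_nonpos h]
  · exact Or.inr ⟨⟨p, h⟩, rfl⟩

lemma span_rectLp_dense :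
    (Submodule.span ℝ (Set.range rectLp)).topologicalClosure = ⊤ := by
  refine span_indicator_Iic_dense (μ := quadrant)
    (v := fun p : ℝ≥0 × ℝ≥0 => ((p.1 : ℝ), (p.2 : ℝ)))
    generateFrom_Iic_prod (fun _ => measurableSet_Iic)
    quadrant_Iic_ne_top (q := fun n => ((n : ℝ), (n : ℝ))) (fun x => ?_) fun p => ?_
  · obtain ⟨n, hn⟩ := exists_nat_ge (max x.1 x.2)
    exact ⟨n, (le_max_left _ _).trans hn, (le_max_right _ _).trans hn⟩
  · rcases le_total p.1 0 with h | h
    · left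
      rw [quadrant_Iic, ENNReal.ofReal_of_nonpos h, zero_mul]
    rcases le_total p.2 0 with h' | h'
    · left
      rw [quadrant_Iic, ENNReal.ofReal_of_nonpos h', mul_zero]
    · exact Or.inr ⟨(⟨p.1, h⟩, ⟨p.2, h'⟩), rfl⟩

lemma inner_intervalLp (s t : ℝ≥0) : ⟪intervalLp s, intervalLp t⟫ = min (s : ℝ) (t : ℝ) := by
  rw [intervalLp, intervalLp, L2.inner_indicatorConstLp_one,
    setIntegral_congr_ae measurableSet_Iic (indicatorConstLp_coeFn.mono fun x hx _ => hx),
    integral_indicator measurableSet_Iic, Measure.restrict_restrict measurableSet_Iic,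
    Set.Iic_inter_Iic]
  simp only [integral_const, MeasurableSet.univ, measureReal_restrict_apply, Set.univ_inter,
    smul_eq_mul, mul_one]
  rw [measureReal_def, halfLine_Iic, ENNReal.toReal_ofReal (by positivity), min_comm]

lemma inner_rectLp (p q : ℝ≥0 × ℝ≥0) :
    ⟪rectLp p, rectLp q⟫ = min (p.1 : ℝ) (q.1 : ℝ) * min (p.2 : ℝ) (q.2 : ℝ) := by
  rw [rectLp, rectLp, L2.inner_indicatorConstLp_one,
    setIntegral_congr_ae measurableSet_Iic (indicatorConstLp_coeFn.mono fun x hx _ => hx),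
    integral_indicator measurableSet_Iic, Measure.restrict_restrict measurableSet_Iic,
    Set.Iic_inter_Iic]
  simp only [integral_const, MeasurableSet.univ, measureReal_restrict_apply, Set.univ_inter,
    smul_eq_mul, mul_one]
  rw [measureReal_def, quadrant_Iic, ENNReal.toReal_mul, ENNReal.toReal_ofReal (by simp),
    ENNReal.toReal_ofReal (by simp)]
  simp [min_comm]

variable {Ω : Type*} [MeasurableSpace Ω] {P : Measure Ω}

/-- The isometric extension of `1_{(0, t]} ↦ W_t` is the Wiener integral. The approximating step
functions consist of intervals `(0, t]`, and `W_0 = 0` almost surely. -/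
lemma isWienerIntegral_of_mem_gramGraph {W : ℝ≥0 → Ω → ℝ} (hW : ∀ t, MemLp (W t) 2 P)
    (hW0 : W 0 =ᵐ[P] 0) {f : ℝ → ℝ} (hf : MemLp f 2 halfLine) {j : Lp ℝ 2 P}
    (hj : (hf.toLp f, j) ∈ gramGraph intervalLp fun t => (hW t).toLp (W t)) :
    IsWienerIntegral W f j P := by
  obtain ⟨q, hq, hqt⟩ := mem_gramGraph_iff.1 hj
  choose n c τ h1 h2 using fun k => exists_sum_of_mem_gramRel (hq k)
  refine ⟨hf, Lp.memLp _, fun k => ⟨n k, fun _ => 0, τ k, fun _ => zero_le, fun i _ => c k i⟩,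
    ?_, ?_⟩
  · have ht := (Lp.tendsto_Lp_iff_tendsto_eLpNorm' _ _).1 ((continuous_fst.tendsto _).comp hqt)
    refine ht.congr fun k => eLpNorm_congr_ae ?_
    have h3 := coeFn_sum_smul_ae_eq (c k) (u := fun i => intervalLp (τ k i)) fun i =>
      indicatorConstLp_coeFn
    have h4 : ∀ᵐ x ∂halfLine, x ∈ Set.Ioi (0 : ℝ) := ae_restrict_mem measurableSet_Ioi
    filter_upwards [h3, h4, hf.coeFn_toLp] with x h3 h4 h5
    have h4' : 0 < x := h4
    simp only [Function.comp_apply, Pi.sub_apply, h1, h3, h5, RandomStep.toFun]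
    congr 1
    refine Finset.sum_congr rfl fun i _ => ?_
    by_cases hx : x ≤ τ k i <;> simp [hx, h4']
  · have ht := (Lp.tendsto_Lp_iff_tendsto_eLpNorm' _ _).1 ((continuous_snd.tendsto _).comp hqt)
    refine ht.congr fun k => eLpNorm_congr_ae ?_
    have h3 := coeFn_sum_smul_ae_eq (c k) fun i => (hW (τ k i)).coeFn_toLp
    filter_upwards [h3, hW0] with ω h3 h4
    simp only [Function.comp_apply, Pi.sub_apply, h2, h3]
    simp [h4]

/-- The isometric extension of `1_{(0, p₁] × (0, p₂]} ↦ W_p` is the Wiener–Itô integral. The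
approximating step functions consist of rectangles with a corner at the origin, for which the
rectangular increment is `W_p` because `W` vanishes almost surely on the axes. -/
lemma isSheetIntegral_of_mem_gramGraph {W : ℝ≥0 × ℝ≥0 → Ω → ℝ} (hW : ∀ t, MemLp (W t) 2 P)
    (hW0 : ∀ p : ℝ≥0 × ℝ≥0, p.1 = 0 ∨ p.2 = 0 → W p =ᵐ[P] 0) {f : ℝ × ℝ → ℝ}
    (hf : MemLp f 2 quadrant) {j : Lp ℝ 2 P}
    (hj : (hf.toLp f, j) ∈ gramGraph rectLp fun t => (hW t).toLp (W t)) :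
    IsSheetIntegral W f j P := by
  obtain ⟨q, hq, hqt⟩ := mem_gramGraph_iff.1 hj
  choose n c τ h1 h2 using fun k => exists_sum_of_mem_gramRel (hq k)
  refine ⟨hf, Lp.memLp _, fun k => ⟨n k, fun _ => 0, τ k, fun _ => zero_le, c k⟩,
    ?_, ?_⟩
  · have ht := (Lp.tendsto_Lp_iff_tendsto_eLpNorm' _ _).1 ((continuous_fst.tendsto _).comp hqt)
    refine ht.congr fun k => eLpNorm_congr_ae ?_
    have h3 := coeFn_sum_smul_ae_eq (c k) (u := fun i => rectLp (τ k i)) fun i =>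
      indicatorConstLp_coeFn
    have h4 : ∀ᵐ x ∂quadrant, x ∈ Set.Ioi (0 : ℝ) ×ˢ Set.Ioi (0 : ℝ) :=
      ae_restrict_mem (measurableSet_Ioi.prod measurableSet_Ioi)
    filter_upwards [h3, h4, hf.coeFn_toLp] with x h3 h4 h5
    have h6 : 0 < x.1 := h4.1
    have h7 : 0 < x.2 := h4.2
    simp only [Function.comp_apply, Pi.sub_apply, h1, h3, h5, RectStep.toFun]
    congr 1
    refine Finset.sum_congr rfl fun i _ => ?_
    congr 1
    simp only [Set.indicator_apply, Set.mem_Iic, Set.mem_prod, Set.mem_Ioc, Prod.le_def]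
    simp [h6, h7]
  · have ht := (Lp.tendsto_Lp_iff_tendsto_eLpNorm' _ _).1 ((continuous_snd.tendsto _).comp hqt)
    refine ht.congr fun k => eLpNorm_congr_ae ?_
    have h3 := coeFn_sum_smul_ae_eq (c k) fun i => (hW (τ k i)).coeFn_toLp
    have h4 : ∀ᵐ ω ∂P, ∀ i, W (0, (τ k i).2) ω = 0 ∧ W ((τ k i).1, 0) ω = 0 ∧ W (0, 0) ω = 0 := by
      rw [ae_all_iff]
      intro i
      filter_upwards [hW0 (0, (τ k i).2) (Or.inl rfl), hW0 ((τ k i).1, 0) (Or.inr rfl),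
        hW0 (0, 0) (Or.inl rfl)] with ω a b c
      exact ⟨a, b, c⟩
    filter_upwards [h3, h4] with ω h3 h4
    simp only [Function.comp_apply, Pi.sub_apply, h2, h3, RectStep.integral]
    congr 1
    refine Finset.sum_congr rfl fun i _ => ?_
    obtain ⟨a, b, d⟩ := h4 i
    simp only [Prod.fst_zero, Prod.snd_zero, a, b, d, sub_zero, add_zero]

lemma ae_eq_zero_of_integral_mul_self {f : Ω → ℝ} (hf : MemLp f 2 P)
    (h : ∫ ω, f ω * f ω ∂P = 0) : f =ᵐ[P] 0 := by
  have := (integral_eq_zero_iff_of_nonneg (fun ω => mul_self_nonneg (f ω))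
    (hf.integrable_mul hf)).1 h
  filter_upwards [this] with ω hω
  simpa using hω

end Wiener

/-! ### The deterministic integrands on the quadrant -/

section Sheet

lemma fbmConst_sq {H : ℝ} (hH0 : 0 < H) (hH1 : H < 1) : fbmConst H ^ 2 =
    2 * Real.pi / (Real.Gamma (2 * H + 1) * Real.sin (Real.pi * H)) := by
  have h1 := Real.Gamma_pos_of_pos (show 0 < 2 * H + 1 by linarith)
  have h2 := sin_pi_mul_half_pos (a := 2 * H) (by linarith) (by linarith)
  rw [show Real.pi * (2 * H) / 2 = Real.pi * H by ring] at h2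
  have := Real.pi_pos
  exact Real.sq_sqrt (by positivity)

lemma fbmConst_pos {H : ℝ} (hH0 : 0 < H) (hH1 : H < 1) : 0 < fbmConst H := by
  have h1 := Real.Gamma_pos_of_pos (show 0 < 2 * H + 1 by linarith)
  have h2 := sin_pi_mul_half_pos (a := 2 * H) (by linarith) (by linarith)
  rw [show Real.pi * (2 * H) / 2 = Real.pi * H by ring] at h2
  have := Real.pi_pos
  exact Real.sqrt_pos.2 (by positivity)

/-- The spectral constant of the fBm: `C_H² = 4 ∫_0^∞ (1 - cos x) x^{-1-2H} dx`. -/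
lemma fbmConst_sq_eq_cosConst {H : ℝ} (hH0 : 0 < H) (hH1 : H < 1) :
    fbmConst H ^ 2 = 4 * cosConst (2 * H) := by
  have h1 := Real.Gamma_pos_of_pos (show 0 < 2 * H + 1 by linarith)
  have h2 := sin_pi_mul_half_pos (a := 2 * H) (by linarith) (by linarith)
  rw [fbmConst_sq hH0 hH1, cosConst]
  rw [show Real.pi * (2 * H) / 2 = Real.pi * H by ring] at h2 ⊢
  field_simp
  ring

variable {H γ : ℝ}

/-- The constant factor `2 / (Γ(γ) C_H²)` of `w²`, where `w` is the weight `sheetWeight H γ`. -/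
noncomputable def weightConst (H γ : ℝ) : ℝ := 2 / (Real.Gamma γ * fbmConst H ^ 2)

lemma weightConst_pos (hH0 : 0 < H) (hH1 : H < 1) (hγ0 : 0 < γ) : 0 < weightConst H γ := by
  have h1 := fbmConst_pos hH0 hH1
  have h2 := Real.Gamma_pos_of_pos hγ0
  unfold weightConst
  positivity

lemma measurable_sheetWeight : Measurable (sheetWeight H γ) := by
  unfold sheetWeight
  fun_prop

lemma sheetWeight_mul_self (hγ0 : 0 < γ) {p : ℝ × ℝ} (h1 : 0 < p.1) (h2 : 0 < p.2) :
    sheetWeight H γ p * sheetWeight H γ p = weightConst H γ *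
      (p.1 ^ (1 - 2 * H) / (1 + p.1 ^ 2) * p.2 ^ (-(2 * H - γ) - 1)) := by
  have hG := Real.Gamma_pos_of_pos hγ0
  have e1 : √2 * √2 = 2 := Real.mul_self_sqrt (by norm_num)
  have e2 : √(Real.Gamma γ) * √(Real.Gamma γ) = Real.Gamma γ := Real.mul_self_sqrt hG.le
  have e3 : √(p.1 ^ (1 - 2 * H) / (1 + p.1 ^ 2)) * √(p.1 ^ (1 - 2 * H) / (1 + p.1 ^ 2)) =
    p.1 ^ (1 - 2 * H) / (1 + p.1 ^ 2) := Real.mul_self_sqrt (by positivity)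
  have e4 : p.2 ^ (-(2 * H - γ) / 2 - 1 / 2) * p.2 ^ (-(2 * H - γ) / 2 - 1 / 2) =
      p.2 ^ (-(2 * H - γ) - 1) := by
    rw [← Real.rpow_add h2]
    congr 1
    ring
  calc sheetWeight H γ p * sheetWeight H γ p
      = (√2 * √2) / ((√(Real.Gamma γ) * √(Real.Gamma γ)) * fbmConst H ^ 2) *
        ((p.2 ^ (-(2 * H - γ) / 2 - 1 / 2) * p.2 ^ (-(2 * H - γ) / 2 - 1 / 2)) *
        (√(p.1 ^ (1 - 2 * H) / (1 + p.1 ^ 2)) * √(p.1 ^ (1 - 2 * H) / (1 + p.1 ^ 2)))) := by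
        unfold sheetWeight
        ring
    _ = _ := by
        rw [e1, e2, e3, e4, weightConst]
        ring

lemma ae_quadrant_pos : ∀ᵐ p ∂quadrant, 0 < p.1 ∧ 0 < p.2 :=
  ae_restrict_mem (measurableSet_Ioi.prod measurableSet_Ioi)

/-- Integrate in `y` first, where `∫_0^∞ (1 - cos(ηuy)) y^{-1-α} dy` is a multiple of `(ηu)^α`. The
remaining integral in `η` is `∫_0^∞ η^{1-γ} / (1 + η²) dη`; it equals the integral
`∫_0^∞ z^{γ-1} / (1 + z²) dz` in the definition of `κ`, since `sin(π - x) = sin x`. -/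
lemma lintegral_weight_one_sub_cos (hH0 : 0 < H) (hH1 : H < 1) (hγ0 : 0 < γ) (hγ1 : γ < 2 * H)
    {u : ℝ} (hu : 0 ≤ u) :
    ∫⁻ p, ENNReal.ofReal (sheetWeight H γ p * sheetWeight H γ p * (1 - Real.cos (p.1 * p.2 * u)))
      ∂quadrant = ENNReal.ofReal (kappa H γ / 2 * u ^ (2 * H - γ)) := by
  have hc := weightConst_pos hH0 hH1 hγ0
  have hK := cosConst_pos (a := 2 * H - γ) (by linarith) (by linarith)
  have hm := measurable_sheetWeight (H := H) (γ := γ)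
  have hκ : kappa H γ / 2 = weightConst H γ * cosConst (2 * H - γ) *
      (Real.pi / (2 * Real.sin (Real.pi * (2 - γ) / 2))) := by
    have h1 := Real.Gamma_pos_of_pos (show 0 < 2 * H + 1 by linarith)
    have h2 := sin_pi_mul_half_pos (a := 2 * H) (by linarith) (by linarith)
    have h3 := Real.Gamma_pos_of_pos (show 0 < 2 * H - γ + 1 by linarith)
    have h4 := sin_pi_mul_half_pos (a := 2 * H - γ) (by linarith) (by linarith)
    have h5 := Real.Gamma_pos_of_pos hγ0
    have h6 := sin_pi_mul_half_pos (a := γ) (by linarith) (by linarith)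
    rw [show Real.pi * (2 * H) / 2 = Real.pi * H by ring] at h2
    have := Real.pi_pos
    rw [show Real.pi * (2 - γ) / 2 = Real.pi - Real.pi * γ / 2 by ring, Real.sin_pi_sub, kappa,
      integral_rpow_div_one_add_sq hγ0 (by linarith), weightConst, fbmConst_sq hH0 hH1, cosConst]
    field_simp
  have e : ∫⁻ p, ENNReal.ofReal (sheetWeight H γ p * sheetWeight H γ p *
      (1 - Real.cos (p.1 * p.2 * u))) ∂quadrant =
      ∫⁻ p, ENNReal.ofReal (weightConst H γ * (p.1 ^ (1 - 2 * H) / (1 + p.1 ^ 2))) *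
        ENNReal.ofReal ((1 - Real.cos ((p.1 * u) * p.2)) * p.2 ^ (-(2 * H - γ) - 1))
        ∂(halfLine.prod halfLine) := by
    rw [← quadrant_eq_prod]
    refine lintegral_congr_ae ?_
    filter_upwards [ae_quadrant_pos] with p hp
    obtain ⟨h1, h2⟩ := hp
    rw [sheetWeight_mul_self hγ0 h1 h2, ← ENNReal.ofReal_mul (by positivity)]
    congr 1
    rw [show p.1 * p.2 * u = p.1 * u * p.2 by ring]
    ring
  rw [e, lintegral_prod _ (by fun_prop)]
  have e2 : ∀ η ∈ Set.Ioi (0 : ℝ), (∫⁻ y, ENNReal.ofReal (weightConst H γ *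
      (η ^ (1 - 2 * H) / (1 + η ^ 2))) * ENNReal.ofReal ((1 - Real.cos ((η * u) * y)) *
      y ^ (-(2 * H - γ) - 1)) ∂halfLine) = ENNReal.ofReal (weightConst H γ * u ^ (2 * H - γ) *
      cosConst (2 * H - γ)) * ENNReal.ofReal (η ^ ((2 - γ) - 1) / (1 + η ^ 2)) := by
    intro η hη
    have hη0 : 0 < η := hη
    rw [lintegral_const_mul _ (by fun_prop), lintegral_one_sub_cos_mul_const_mul_rpow (by linarith)
      (by linarith) (by positivity), ← ENNReal.ofReal_mul (by positivity),
      ← ENNReal.ofReal_mul (by positivity), Real.mul_rpow hη0.le hu,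
      show 2 - γ - 1 = (1 - 2 * H) + (2 * H - γ) by ring, Real.rpow_add hη0]
    congr 1
    ring
  rw [setLIntegral_congr_fun measurableSet_Ioi e2, lintegral_const_mul _ (by fun_prop),
    lintegral_rpow_div_one_add_sq (by linarith) (by linarith), ← ENNReal.ofReal_mul (by positivity),
    hκ]
  congr 1
  ring

lemma kappa_pos (hH0 : 0 < H) (hH1 : H < 1) (hγ0 : 0 < γ) (hγ1 : γ < 2 * H) : 0 < kappa H γ := by
  have h1 := Real.Gamma_pos_of_pos (show 0 < 2 * H + 1 by linarith)
  have h2 := sin_pi_mul_half_pos (a := 2 * H) (by linarith) (by linarith)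
  have h3 := Real.Gamma_pos_of_pos (show 0 < 2 * H - γ + 1 by linarith)
  have h4 := sin_pi_mul_half_pos (a := 2 * H - γ) (by linarith) (by linarith)
  have h5 := Real.Gamma_pos_of_pos hγ0
  have h6 := sin_pi_mul_half_pos (a := γ) (by linarith) (by linarith)
  rw [show Real.pi * (2 * H) / 2 = Real.pi * H by ring] at h2
  have := Real.pi_pos
  rw [kappa, integral_rpow_div_one_add_sq hγ0 (by linarith)]
  positivity

lemma lambdaOne_eq (hH0 : 0 < H) (hH1 : H < 1) (hγ0 : 0 < γ) : lambdaOne H γ =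
    weightConst H γ * ∫ η in Set.Ioi (0 : ℝ), η ^ (1 - 2 * H) / (1 + η ^ 2) := by
  have h1 := Real.Gamma_pos_of_pos (show 0 < 2 * H + 1 by linarith)
  have h2 := sin_pi_mul_half_pos (a := 2 * H) (by linarith) (by linarith)
  have h5 := Real.Gamma_pos_of_pos hγ0
  rw [show Real.pi * (2 * H) / 2 = Real.pi * H by ring] at h2
  have := Real.pi_pos
  rw [lambdaOne, weightConst, fbmConst_sq hH0 hH1]
  congr 1
  field_simp

lemma integrableOn_rpow_one_sub_div (hH0 : 0 < H) (hH1 : H < 1) :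
    IntegrableOn (fun η : ℝ => η ^ (1 - 2 * H) / (1 + η ^ 2)) (Set.Ioi 0) := by
  have := integrableOn_rpow_div_one_add_sq (a := 2 - 2 * H) (by linarith) (by linarith)
  rwa [show 2 - 2 * H - 1 = 1 - 2 * H by ring] at this

lemma lambdaOne_pos (hH0 : 0 < H) (hH1 : H < 1) (hγ0 : 0 < γ) : 0 < lambdaOne H γ := by
  rw [lambdaOne_eq hH0 hH1 hγ0]
  have := integral_rpow_div_one_add_sq (a := 2 - 2 * H) (by linarith) (by linarith)
  rw [show 2 - 2 * H - 1 = 1 - 2 * H by ring] at this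
  rw [this]
  have h1 := weightConst_pos hH0 hH1 hγ0
  have h2 := sin_pi_mul_half_pos (a := 2 - 2 * H) (by linarith) (by linarith)
  have := Real.pi_pos
  positivity

lemma integrable_weight_one_sub_cos (hH0 : 0 < H) (hH1 : H < 1) (hγ0 : 0 < γ) (hγ1 : γ < 2 * H)
    (u : ℝ) : Integrable (fun p => sheetWeight H γ p * sheetWeight H γ p *
      (1 - Real.cos (p.1 * p.2 * u))) quadrant := by
  have hm := measurable_sheetWeight (H := H) (γ := γ)
  have e : (fun p : ℝ × ℝ => sheetWeight H γ p * sheetWeight H γ p *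
      (1 - Real.cos (p.1 * p.2 * u))) =ᵐ[quadrant] fun p => sheetWeight H γ p *
      sheetWeight H γ p * (1 - Real.cos (p.1 * p.2 * |u|)) := by
    filter_upwards [ae_quadrant_pos] with p hp
    rw [← Real.cos_abs (p.1 * p.2 * u), abs_mul, abs_of_pos (mul_pos hp.1 hp.2)]
  refine Integrable.congr ⟨(by fun_prop : Measurable _).aestronglyMeasurable, ?_⟩ e.symm
  rw [hasFiniteIntegral_iff_ofReal, lintegral_weight_one_sub_cos hH0 hH1 hγ0 hγ1 (abs_nonneg u)]
  · exact ENNReal.ofReal_lt_top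
  · exact ae_of_all _ fun p => mul_nonneg (mul_self_nonneg _) (by linarith [Real.cos_le_one (p.1 * p.2 * |u|)])

lemma integral_weight_one_sub_cos (hH0 : 0 < H) (hH1 : H < 1) (hγ0 : 0 < γ) (hγ1 : γ < 2 * H)
    (u : ℝ) : ∫ p, sheetWeight H γ p * sheetWeight H γ p *
      (1 - Real.cos (p.1 * p.2 * u)) ∂quadrant = kappa H γ / 2 * |u| ^ (2 * H - γ) := by
  have hm := measurable_sheetWeight (H := H) (γ := γ)
  have hκ := kappa_pos hH0 hH1 hγ0 hγ1
  have e : (fun p : ℝ × ℝ => sheetWeight H γ p * sheetWeight H γ p *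
      (1 - Real.cos (p.1 * p.2 * u))) =ᵐ[quadrant] fun p => sheetWeight H γ p *
      sheetWeight H γ p * (1 - Real.cos (p.1 * p.2 * |u|)) := by
    filter_upwards [ae_quadrant_pos] with p hp
    rw [← Real.cos_abs (p.1 * p.2 * u), abs_mul, abs_of_pos (mul_pos hp.1 hp.2)]
  rw [integral_congr_ae e, integral_eq_lintegral_of_nonneg_ae _
    (by fun_prop : Measurable _).aestronglyMeasurable,
    lintegral_weight_one_sub_cos hH0 hH1 hγ0 hγ1 (abs_nonneg u), ENNReal.toReal_ofReal]
  · positivity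
  · exact ae_of_all _ fun p => mul_nonneg (mul_self_nonneg _) (by linarith [Real.cos_le_one (p.1 * p.2 * |u|)])

/-- The integrand of `U`. -/
noncomputable def sheetCos (H γ : ℝ) (t : ℝ≥0) (p : ℝ × ℝ) : ℝ :=
  sheetWeight H γ p * (Real.cos (p.1 * p.2 * t) - 1)

/-- The integrand of `V`. -/
noncomputable def sheetSin (H γ : ℝ) (t : ℝ≥0) (p : ℝ × ℝ) : ℝ :=
  sheetWeight H γ p * Real.sin (p.1 * p.2 * t)

/-- The integrand of `Y`. -/
noncomputable def sheetExp (H γ : ℝ) (t : ℝ≥0) (p : ℝ × ℝ) : ℝ :=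
  sheetWeight H γ p * (1 - Real.exp (-(p.2 * t)))

/-- The integrand of `Y^α`. -/
noncomputable def lineExp (H γ : ℝ) (t : ℝ≥0) (y : ℝ) : ℝ :=
  y ^ (-(1 + (2 * H - γ)) / 2) * (1 - Real.exp (-(y * t)))

lemma memLp_sheetCos (hH0 : 0 < H) (hH1 : H < 1) (hγ0 : 0 < γ) (hγ1 : γ < 2 * H) (t : ℝ≥0) :
    MemLp (sheetCos H γ t) 2 quadrant := by
  have hm := measurable_sheetWeight (H := H) (γ := γ)
  have hm' : Measurable (sheetCos H γ t) := by unfold sheetCos; fun_prop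
  refine (memLp_two_iff_integrable_sq hm'.aestronglyMeasurable).2 ?_
  -- `(1 - cos x)² ≤ 2 (1 - cos x)`
  refine ((integrable_weight_one_sub_cos hH0 hH1 hγ0 hγ1 t).const_mul 2).mono'
    (by fun_prop) (ae_of_all _ fun p => ?_)
  rw [Real.norm_of_nonneg (sq_nonneg _), sheetCos]
  nlinarith [mul_nonneg (mul_self_nonneg (sheetWeight H γ p)) (mul_nonneg
    (sub_nonneg.2 (Real.cos_le_one (p.1 * p.2 * t)))
    (neg_le_iff_add_nonneg.1 (Real.neg_one_le_cos (p.1 * p.2 * t))))]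

lemma memLp_sheetSin (hH0 : 0 < H) (hH1 : H < 1) (hγ0 : 0 < γ) (hγ1 : γ < 2 * H) (t : ℝ≥0) :
    MemLp (sheetSin H γ t) 2 quadrant := by
  have hm := measurable_sheetWeight (H := H) (γ := γ)
  have hm' : Measurable (sheetSin H γ t) := by unfold sheetSin; fun_prop
  refine (memLp_two_iff_integrable_sq hm'.aestronglyMeasurable).2 ?_
  -- `sin² x = 1 - cos² x ≤ 2 (1 - cos x)`
  refine ((integrable_weight_one_sub_cos hH0 hH1 hγ0 hγ1 t).const_mul 2).mono'
    (by fun_prop) (ae_of_all _ fun p => ?_)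
  rw [Real.norm_of_nonneg (sq_nonneg _), sheetSin, mul_pow, Real.sin_sq]
  nlinarith [mul_nonneg (mul_self_nonneg (sheetWeight H γ p))
    (mul_self_nonneg (1 - Real.cos (p.1 * p.2 * t)))]

/-- Together, the integrands of `U` and `V` have the Gram matrix `κ` times the covariance of the fBm
with Hurst parameter `α/2`, by
`(cos a - 1)(cos b - 1) + sin a sin b = (1 - cos a) + (1 - cos b) - (1 - cos(b - a))`. -/
lemma integral_sheetCos_add_sheetSin (hH0 : 0 < H) (hH1 : H < 1) (hγ0 : 0 < γ) (hγ1 : γ < 2 * H)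
    (s t : ℝ≥0) :
    ∫ p, sheetCos H γ s p * sheetCos H γ t p ∂quadrant +
      ∫ p, sheetSin H γ s p * sheetSin H γ t p ∂quadrant = kappa H γ *
      (((t : ℝ) ^ (2 * H - γ) + (s : ℝ) ^ (2 * H - γ) -
        |(t : ℝ) - (s : ℝ)| ^ (2 * H - γ)) / 2) := by
  have i := integrable_weight_one_sub_cos hH0 hH1 hγ0 hγ1
  have ic : Integrable (fun p => sheetCos H γ s p * sheetCos H γ t p) quadrant :=
    (memLp_sheetCos hH0 hH1 hγ0 hγ1 s).integrable_mul (memLp_sheetCos hH0 hH1 hγ0 hγ1 t)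
  have is : Integrable (fun p => sheetSin H γ s p * sheetSin H γ t p) quadrant :=
    (memLp_sheetSin hH0 hH1 hγ0 hγ1 s).integrable_mul (memLp_sheetSin hH0 hH1 hγ0 hγ1 t)
  rw [← integral_add ic is]
  have e : ∀ p : ℝ × ℝ, sheetCos H γ s p * sheetCos H γ t p + sheetSin H γ s p * sheetSin H γ t p =
      sheetWeight H γ p * sheetWeight H γ p * (1 - Real.cos (p.1 * p.2 * t)) +
      sheetWeight H γ p * sheetWeight H γ p * (1 - Real.cos (p.1 * p.2 * s)) -
      sheetWeight H γ p * sheetWeight H γ p * (1 - Real.cos (p.1 * p.2 * ((t : ℝ) - s))) := by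
    intro p
    rw [mul_sub (p.1 * p.2), Real.cos_sub]
    unfold sheetCos sheetSin
    ring
  have i2 : Integrable (fun p => sheetWeight H γ p * sheetWeight H γ p *
      (1 - Real.cos (p.1 * p.2 * t)) + sheetWeight H γ p * sheetWeight H γ p *
      (1 - Real.cos (p.1 * p.2 * s))) quadrant := (i t).add (i s)
  simp_rw [e]
  rw [integral_sub i2 (i _), integral_add (i t) (i s),
    integral_weight_one_sub_cos hH0 hH1 hγ0 hγ1, integral_weight_one_sub_cos hH0 hH1 hγ0 hγ1,
    integral_weight_one_sub_cos hH0 hH1 hγ0 hγ1, abs_of_nonneg (NNReal.coe_nonneg t),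
    abs_of_nonneg (NNReal.coe_nonneg s)]
  ring

lemma integrableOn_rpow_mul_one_sub_exp_sq {a : ℝ} (ha0 : 0 < a) (ha2 : a < 2) (t : ℝ≥0) :
    IntegrableOn (fun y : ℝ => y ^ (-a - 1) * (1 - Real.exp (-(y * t))) ^ 2) (Set.Ioi 0) := by
  have h := (integrableOn_rpow_div_one_add_sq (a := 2 - a) (by linarith) (by linarith)).const_mul
    (1 + (t : ℝ) ^ 2)
  refine Integrable.mono' h (by fun_prop)
    ((ae_restrict_iff' measurableSet_Ioi).2 (ae_of_all _ fun y hy => ?_))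
  have hy0 : (0 : ℝ) < y := hy
  have ht0 : (0 : ℝ) ≤ t := t.2
  have h1 : 1 - Real.exp (-(y * t)) ≤ y * t := by linarith [Real.add_one_le_exp (-(y * t))]
  have h2 : 0 ≤ 1 - Real.exp (-(y * t)) := by
    have := Real.exp_le_one_iff.2 (show -(y * t) ≤ 0 by nlinarith)
    linarith
  have h3 : 1 - Real.exp (-(y * t)) ≤ 1 := by linarith [Real.exp_pos (-(y * t))]
  rw [Real.norm_of_nonneg (by positivity), show 2 - a - 1 = -a - 1 + 2 by ring,
    Real.rpow_add hy0, Real.rpow_two, mul_div_assoc, mul_left_comm]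
  refine mul_le_mul_of_nonneg_left ?_ (by positivity)
  -- `(1 - e^{-yt})² ≤ min(1, (yt)²)`
  rw [← mul_div_assoc, le_div_iff₀ (by positivity)]
  have h4 : (1 - Real.exp (-(y * t))) ^ 2 ≤ 1 := by nlinarith
  have h5 : (1 - Real.exp (-(y * t))) ^ 2 ≤ y ^ 2 * (t : ℝ) ^ 2 := by
    rw [← mul_pow]
    gcongr
  nlinarith [mul_le_mul_of_nonneg_right h4 (sq_nonneg y)]

lemma measurable_lineExp (t : ℝ≥0) : Measurable (lineExp H γ t) := by
  unfold lineExp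
  fun_prop

lemma lineExp_mul {y : ℝ} (hy : 0 < y) (s t : ℝ≥0) : lineExp H γ s y * lineExp H γ t y =
    y ^ (-(2 * H - γ) - 1) * (1 - Real.exp (-(y * t))) * (1 - Real.exp (-(y * s))) := by
  have : y ^ (-(1 + (2 * H - γ)) / 2) * y ^ (-(1 + (2 * H - γ)) / 2) =
      y ^ (-(2 * H - γ) - 1) := by
    rw [← Real.rpow_add hy]
    congr 1
    ring
  rw [← this]
  unfold lineExp
  ring

lemma memLp_lineExp (hγ1 : γ < 2 * H) (hH1 : H < 1) (hγ0 : 0 < γ) (t : ℝ≥0) :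
    MemLp (lineExp H γ t) 2 halfLine := by
  refine (memLp_two_iff_integrable_sq (measurable_lineExp t).aestronglyMeasurable).2 ?_
  refine (integrableOn_rpow_mul_one_sub_exp_sq (a := 2 * H - γ) (by linarith) (by linarith)
    t).congr_fun (fun y hy => ?_) measurableSet_Ioi
  simp only
  rw [sq (lineExp H γ t y), lineExp_mul hy]
  ring

lemma integral_lineExp (s t : ℝ≥0) :
    lambdaOne H γ * ∫ y, lineExp H γ s y * lineExp H γ t y ∂halfLine = covY H γ s t := by
  rw [covY]
  congr 1
  exact setIntegral_congr_fun measurableSet_Ioi fun y hy => lineExp_mul hy s t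

lemma sheetExp_mul_ae (hγ0 : 0 < γ) (s t : ℝ≥0) :
    (fun p => sheetExp H γ s p * sheetExp H γ t p) =ᵐ[quadrant] fun p => weightConst H γ *
      ((p.1 ^ (1 - 2 * H) / (1 + p.1 ^ 2)) * (lineExp H γ s p.2 * lineExp H γ t p.2)) := by
  filter_upwards [ae_quadrant_pos] with p hp
  rw [lineExp_mul hp.2]
  have := sheetWeight_mul_self (H := H) hγ0 hp.1 hp.2
  calc sheetExp H γ s p * sheetExp H γ t p = sheetWeight H γ p * sheetWeight H γ p *
        ((1 - Real.exp (-(p.2 * t))) * (1 - Real.exp (-(p.2 * s)))) := by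
        unfold sheetExp
        ring
    _ = _ := by
        rw [this]
        ring

lemma memLp_sheetExp (hH0 : 0 < H) (hH1 : H < 1) (hγ0 : 0 < γ) (hγ1 : γ < 2 * H) (t : ℝ≥0) :
    MemLp (sheetExp H γ t) 2 quadrant := by
  have hm := measurable_sheetWeight (H := H) (γ := γ)
  have hm' : Measurable (sheetExp H γ t) := by unfold sheetExp; fun_prop
  refine (memLp_two_iff_integrable_sq hm'.aestronglyMeasurable).2 ?_
  simp_rw [sq]
  refine Integrable.congr ?_ (sheetExp_mul_ae hγ0 t t).symm
  rw [quadrant_eq_prod]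
  have hi : Integrable (fun y => lineExp H γ t y * lineExp H γ t y) halfLine :=
    (memLp_lineExp hγ1 hH1 hγ0 t).integrable_mul (memLp_lineExp hγ1 hH1 hγ0 t)
  have hη : Integrable (fun η : ℝ => η ^ (1 - 2 * H) / (1 + η ^ 2)) halfLine :=
    integrableOn_rpow_one_sub_div hH0 hH1
  exact (hη.mul_prod hi).const_mul _

/-- The integral over the quadrant factorizes: the integral in `η` is the one in `λ₁`, the integral
in `y` is the one in the covariance of `Y`. -/
lemma integral_sheetExp (hH0 : 0 < H) (hH1 : H < 1) (hγ0 : 0 < γ) (s t : ℝ≥0) :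
    ∫ p, sheetExp H γ s p * sheetExp H γ t p ∂quadrant = covY H γ s t := by
  rw [integral_congr_ae (sheetExp_mul_ae hγ0 s t), integral_const_mul, quadrant_eq_prod,
    integral_prod_mul (fun η : ℝ => η ^ (1 - 2 * H) / (1 + η ^ 2))
      fun y => lineExp H γ s y * lineExp H γ t y, ← mul_assoc,
    ← lambdaOne_eq hH0 hH1 hγ0, integral_lineExp]

end Sheet

/-! ### The spectral measure of fractional Brownian motion -/

section Spectral
open scoped RealInnerProductSpace

lemma integral_add_sub_sub {α : Type*} [MeasurableSpace α] {μ : Measure α} {f g h k : α → ℝ}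
    (hf : Integrable f μ) (hg : Integrable g μ) (hh : Integrable h μ) (hk : Integrable k μ) :
    ∫ x, (f x + g x - h x - k x) ∂μ =
      ∫ x, f x ∂μ + ∫ x, g x ∂μ - ∫ x, h x ∂μ - ∫ x, k x ∂μ := by
  have h1 : Integrable (fun x => f x + g x) μ := hf.add hg
  have h2 : Integrable (fun x => f x + g x - h x) μ := h1.sub hh
  rw [integral_sub h2 hk, integral_sub h1 hh, integral_add hf hg]

variable {H : ℝ}

/-- The density of the spectral measure of the fBm. -/
noncomputable def specDensity (H ξ : ℝ) : ℝ := (fbmConst H ^ 2)⁻¹ * |ξ| ^ (1 - 2 * H)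

lemma specDensity_nonneg (H ξ : ℝ) : 0 ≤ specDensity H ξ := by
  unfold specDensity
  positivity

lemma measurable_specDensity (H : ℝ) : Measurable (specDensity H) := by
  unfold specDensity
  fun_prop

/-- The spectral measure `C_H⁻² |ξ|^{1-2H} dξ` of the fBm. -/
noncomputable def specMeasure (H : ℝ) : Measure ℝ :=
  volume.withDensity fun ξ => ENNReal.ofReal (specDensity H ξ)

instance (H : ℝ) : SFinite (specMeasure H) := by
  unfold specMeasure
  infer_instance

lemma fbmNormSq_eq_lintegral (H : ℝ) (g : ℝ → ℝ) :
    fbmNormSq H g = ∫⁻ ξ, ‖fourierInt g ξ‖ₑ ^ 2 ∂specMeasure H := by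
  rw [specMeasure, lintegral_withDensity_eq_lintegral_mul_non_measurable _
    (measurable_specDensity H).ennreal_ofReal (ae_of_all _ fun _ => ENNReal.ofReal_lt_top), fbmNormSq]
  refine lintegral_congr fun ξ => ?_
  rw [Pi.mul_apply, ← ofReal_norm, ← ENNReal.ofReal_pow (norm_nonneg _),
    ← ENNReal.ofReal_mul (specDensity_nonneg H ξ), specDensity]
  congr 1
  ring

lemma integrable_specMeasure_iff {f : ℝ → ℝ} :
    Integrable f (specMeasure H) ↔ Integrable fun ξ => specDensity H ξ * f ξ := by
  rw [specMeasure, integrable_withDensity_iff_integrable_smul'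
    (measurable_specDensity H).ennreal_ofReal (ae_of_all _ fun _ => ENNReal.ofReal_lt_top)]
  simp [ENNReal.toReal_ofReal (specDensity_nonneg H _)]

lemma integral_specMeasure (f : ℝ → ℝ) :
    ∫ ξ, f ξ ∂specMeasure H = ∫ ξ, specDensity H ξ * f ξ := by
  rw [specMeasure, integral_withDensity_eq_integral_toReal_smul
    (measurable_specDensity H).ennreal_ofReal (ae_of_all _ fun _ => ENNReal.ofReal_lt_top)]
  simp [ENNReal.toReal_ofReal (specDensity_nonneg H _)]

lemma integrable_comp_abs {f : ℝ → ℝ} (hf : IntegrableOn f (Set.Ioi 0)) :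
    Integrable fun x => f |x| := by
  have h1 : IntegrableOn (fun x => f |x|) (Set.Ioi 0) :=
    hf.congr_fun (fun x hx => by rw [abs_of_pos (Set.mem_Ioi.1 hx)]) measurableSet_Ioi
  have h2 : IntegrableOn (fun x => f |x|) (Set.Iic 0) := by
    rw [← Measure.map_neg_eq_self (volume : Measure ℝ)]
    have m : MeasurableEmbedding fun x : ℝ => -x := (Homeomorph.neg ℝ).measurableEmbedding
    rw [m.integrableOn_map_iff]
    simp_rw [Function.comp_def, abs_neg, Set.neg_preimage, Set.neg_Iic, neg_zero]
    exact (integrableOn_Ici_iff_integrableOn_Ioi).2 h1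
  rw [← integrableOn_univ, ← Set.Iic_union_Ioi (a := (0 : ℝ))]
  exact h2.union h1

lemma specDensity_of_pos {ξ : ℝ} (hξ : 0 < ξ) :
    specDensity H ξ = (fbmConst H ^ 2)⁻¹ * ξ ^ (1 - 2 * H) := by
  rw [specDensity, abs_of_pos hξ]

lemma specDensity_abs (ξ : ℝ) : specDensity H |ξ| = specDensity H ξ := by
  rw [specDensity, specDensity, abs_abs]

lemma apply_abs_of_even {f : ℝ → ℝ} (he : ∀ ξ, f (-ξ) = f ξ) (ξ : ℝ) : f |ξ| = f ξ := by
  rcases abs_choice ξ with h | h <;> rw [h]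
  exact he ξ

lemma integral_specMeasure_even {f : ℝ → ℝ} (he : ∀ ξ, f (-ξ) = f ξ) :
    ∫ ξ, f ξ ∂specMeasure H = 2 * (fbmConst H ^ 2)⁻¹ *
      ∫ ξ in Set.Ioi (0 : ℝ), ξ ^ (1 - 2 * H) * f ξ := by
  have h := integral_comp_abs (f := fun ξ => specDensity H ξ * f ξ)
  simp_rw [specDensity_abs, apply_abs_of_even he] at h
  have e : ∀ ξ ∈ Set.Ioi (0 : ℝ), specDensity H ξ * f ξ =
      (fbmConst H ^ 2)⁻¹ * (ξ ^ (1 - 2 * H) * f ξ) := fun ξ hξ => by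
    rw [specDensity_of_pos hξ, mul_assoc]
  rw [integral_specMeasure, h, setIntegral_congr_fun measurableSet_Ioi e, integral_const_mul,
    mul_assoc]

lemma integrable_specMeasure_even {f : ℝ → ℝ} (he : ∀ ξ, f (-ξ) = f ξ)
    (hf : IntegrableOn (fun ξ => ξ ^ (1 - 2 * H) * f ξ) (Set.Ioi 0)) :
    Integrable f (specMeasure H) := by
  rw [integrable_specMeasure_iff]
  have h := integrable_comp_abs (f := fun ξ => specDensity H ξ * f ξ)
    (IntegrableOn.congr_fun (hf.const_mul (fbmConst H ^ 2)⁻¹) (fun ξ hξ => by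
      rw [specDensity_of_pos hξ, mul_assoc]) measurableSet_Ioi)
  simp_rw [specDensity_abs, apply_abs_of_even he] at h
  exact h

lemma integrable_specMeasure_one_sub_cos (hH0 : 0 < H) (hH1 : H < 1) (u : ℝ) :
    Integrable (fun ξ => (1 - Real.cos (u * ξ)) / ξ ^ 2) (specMeasure H) := by
  refine integrable_specMeasure_even (fun ξ => by simp) ?_
  refine (integrableOn_one_sub_cos_mul_rpow (a := 2 * H) (by linarith) (by linarith) u).congr_fun
    (fun ξ hξ => ?_) measurableSet_Ioi
  have hξ0 : (0 : ℝ) < ξ := hξ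
  simp only
  rw [show -(2 * H) - 1 = (1 - 2 * H) - 2 by ring, Real.rpow_sub hξ0 _ 2, Real.rpow_two]
  ring

/-- The harmonizable representation of the variance of the increments of the fBm. -/
lemma integral_specMeasure_one_sub_cos (hH0 : 0 < H) (hH1 : H < 1) (u : ℝ) :
    ∫ ξ, (1 - Real.cos (u * ξ)) / ξ ^ 2 ∂specMeasure H = |u| ^ (2 * H) / 2 := by
  rw [integral_specMeasure_even (fun ξ => by simp)]
  have h := integral_one_sub_cos_mul_rpow (a := 2 * H) (by linarith) (by linarith) u
  have e : ∀ ξ ∈ Set.Ioi (0 : ℝ), ξ ^ (1 - 2 * H) * ((1 - Real.cos (u * ξ)) / ξ ^ 2) =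
      (1 - Real.cos (u * ξ)) * ξ ^ (-(2 * H) - 1) := by
    intro ξ hξ
    have hξ0 : (0 : ℝ) < ξ := hξ
    rw [show -(2 * H) - 1 = (1 - 2 * H) - 2 by ring, Real.rpow_sub hξ0 _ 2, Real.rpow_two]
    ring
  have hK := cosConst_pos (a := 2 * H) (by linarith) (by linarith)
  rw [setIntegral_congr_fun measurableSet_Ioi e, h, fbmConst_sq_eq_cosConst hH0 hH1]
  field_simp
  ring

/-- The Fourier transform `∫_a^b e^{iξx} dx` of the indicator function of `(a, b]`. -/
noncomputable def intervalFourier (a b ξ : ℝ) : ℂ :=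
  ∫ x in a..b, Complex.exp (Complex.I * ξ * x)

lemma continuous_intervalFourier (a b : ℝ) : Continuous (intervalFourier a b) := by
  unfold intervalFourier
  exact intervalIntegral.continuous_parametric_intervalIntegral_of_continuous' (by fun_prop) _ _

lemma intervalFourier_eq {a b ξ : ℝ} (hξ : ξ ≠ 0) : intervalFourier a b ξ =
    ⟨(Real.sin (b * ξ) - Real.sin (a * ξ)) / ξ, (Real.cos (a * ξ) - Real.cos (b * ξ)) / ξ⟩ := by
  have hc : Complex.I * ξ ≠ 0 := mul_ne_zero Complex.I_ne_zero (by exact_mod_cast hξ)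
  have e : ∀ x : ℝ, Complex.exp (Complex.I * ξ * x) =
      (Real.cos (x * ξ) : ℂ) + (Real.sin (x * ξ) : ℂ) * Complex.I := by
    intro x
    rw [show Complex.I * ξ * x = ((x * ξ : ℝ) : ℂ) * Complex.I by push_cast; ring,
      Complex.exp_mul_I, ← Complex.ofReal_cos, ← Complex.ofReal_sin]
  rw [intervalFourier, integral_exp_mul_complex hc, e, e, div_eq_iff hc]
  apply Complex.ext
  · simp [-Complex.ofReal_cos, -Complex.ofReal_sin]
    field_simp
    ring
  · simp [-Complex.ofReal_cos, -Complex.ofReal_sin]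
    field_simp

/-- The inner product is written with `1 - cos` so that each term is integrable against the
spectral measure. -/
lemma inner_intervalFourier {a b a' b' ξ : ℝ} (hξ : ξ ≠ 0) :
    ⟪intervalFourier a b ξ, intervalFourier a' b' ξ⟫ =
      (1 - Real.cos ((b - a') * ξ)) / ξ ^ 2 + (1 - Real.cos ((a - b') * ξ)) / ξ ^ 2 -
      (1 - Real.cos ((b - b') * ξ)) / ξ ^ 2 - (1 - Real.cos ((a - a') * ξ)) / ξ ^ 2 := by
  rw [intervalFourier_eq hξ, intervalFourier_eq hξ, Complex.inner]
  simp only [sub_mul, Real.cos_sub, Complex.mul_re, Complex.conj_re, Complex.conj_im]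
  field_simp
  ring

lemma ae_specMeasure_ne_zero : ∀ᵐ ξ ∂specMeasure H, ξ ≠ 0 :=
  (withDensity_absolutelyContinuous _ _).ae_le (Measure.ae_ne volume 0)

lemma integrable_inner_intervalFourier (hH0 : 0 < H) (hH1 : H < 1) (a b a' b' : ℝ) :
    Integrable (fun ξ => ⟪intervalFourier a b ξ, intervalFourier a' b' ξ⟫) (specMeasure H) := by
  have i := integrable_specMeasure_one_sub_cos hH0 hH1
  refine ((((i (b - a')).add (i (a - b'))).sub (i (b - b'))).sub (i (a - a'))).congr ?_
  filter_upwards [ae_specMeasure_ne_zero] with ξ hξ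
  rw [inner_intervalFourier hξ]
  rfl

/-- The right-hand side is the covariance of the increments of the fBm over `(a, b]` and
`(a', b']`, see `IsFBM.integral_increments`. -/
lemma integral_inner_intervalFourier (hH0 : 0 < H) (hH1 : H < 1) (a b a' b' : ℝ) :
    ∫ ξ, ⟪intervalFourier a b ξ, intervalFourier a' b' ξ⟫ ∂specMeasure H =
      (|b - a'| ^ (2 * H) + |a - b'| ^ (2 * H) - |b - b'| ^ (2 * H) - |a - a'| ^ (2 * H)) / 2 := by
  have i := integrable_specMeasure_one_sub_cos hH0 hH1
  have e : (fun ξ => ⟪intervalFourier a b ξ, intervalFourier a' b' ξ⟫) =ᵐ[specMeasure H]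
      fun ξ => (1 - Real.cos ((b - a') * ξ)) / ξ ^ 2 + (1 - Real.cos ((a - b') * ξ)) / ξ ^ 2 -
      (1 - Real.cos ((b - b') * ξ)) / ξ ^ 2 - (1 - Real.cos ((a - a') * ξ)) / ξ ^ 2 := by
    filter_upwards [ae_specMeasure_ne_zero] with ξ hξ
    exact inner_intervalFourier hξ
  rw [integral_congr_ae e, integral_add_sub_sub (i _) (i _) (i _) (i _)]
  simp_rw [integral_specMeasure_one_sub_cos hH0 hH1]
  ring

lemma memLp_intervalFourier (hH0 : 0 < H) (hH1 : H < 1) (a b : ℝ) :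
    MemLp (intervalFourier a b) 2 (specMeasure H) := by
  rw [memLp_two_iff_integrable_sq_norm (continuous_intervalFourier a b).aestronglyMeasurable]
  simpa only [real_inner_self_eq_norm_sq] using integrable_inner_intervalFourier hH0 hH1 a b a b

variable {Ω : Type*} [MeasurableSpace Ω] {P : Measure Ω} {B : ℝ≥0 → Ω → ℝ}

lemma IsFBM.integral_increments (hB : IsFBM H B P) (a b a' b' : ℝ≥0) :
    ∫ ω, (B b ω - B a ω) * (B b' ω - B a' ω) ∂P =
      (|(b : ℝ) - a'| ^ (2 * H) + |(a : ℝ) - b'| ^ (2 * H) - |(b : ℝ) - b'| ^ (2 * H) -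
        |(a : ℝ) - a'| ^ (2 * H)) / 2 := by
  have i : ∀ s t, Integrable (fun ω => B s ω * B t ω) P := fun s t =>
    (IsCenteredGaussian.memLp hB s).integrable_mul (IsCenteredGaussian.memLp hB t)
  have e : ∀ ω, (B b ω - B a ω) * (B b' ω - B a' ω) =
      B b ω * B b' ω + B a ω * B a' ω - B b ω * B a' ω - B a ω * B b' ω := fun ω => by ring
  simp_rw [e]
  rw [integral_add_sub_sub (i _ _) (i _ _) (i _ _) (i _ _)]
  have hc := IsCenteredGaussian.cov hB
  rw [hc, hc, hc, hc, abs_sub_comm (b' : ℝ), abs_sub_comm (a' : ℝ), abs_sub_comm (b' : ℝ),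
    abs_sub_comm (a' : ℝ)]
  ring

end Spectral

/-! ### The stochastic integral as an isometry -/

section StochasticIntegral
set_option linter.overlappingInstances false
open scoped RealInnerProductSpace

variable {H : ℝ} {α Ω : Type*} {𝓖 : MeasurableSpace Ω} [m : MeasurableSpace Ω] {P : Measure Ω}
  {B : ℝ≥0 → Ω → ℝ}

/-- The index set of the elementary integrands `F 1_{(a, b]}` with `F` square integrable and
`𝓖`-measurable. -/
abbrev StepIndex (𝓖 : MeasurableSpace Ω) [MeasurableSpace Ω] (P : Measure Ω) : Type _ :=
  {F : Ω → ℝ // Measurable[𝓖] F ∧ MemLp F 2 P} × ℝ≥0 × ℝ≥0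

lemma memLp_smul_intervalFourier [SFinite P] (hH0 : 0 < H) (hH1 : H < 1) {F : Ω → ℝ}
    (hF : MemLp F 2 P) (a b : ℝ) :
    MemLp (fun p : Ω × ℝ => F p.1 • intervalFourier a b p.2) 2 (P.prod (specMeasure H)) := by
  have hE := memLp_intervalFourier hH0 hH1 a b
  have hm : AEStronglyMeasurable (fun p : Ω × ℝ => F p.1 • intervalFourier a b p.2)
      (P.prod (specMeasure H)) := hF.1.comp_fst.smul hE.1.comp_snd
  rw [memLp_two_iff_integrable_sq_norm hm]
  refine (((memLp_two_iff_integrable_sq hF.1).1 hF).mul_prod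
    ((memLp_two_iff_integrable_sq_norm hE.1).1 hE)).congr (ae_of_all _ fun p => ?_)
  simp [mul_pow]

/-- The Fourier transform `F ⊗ ℱ 1_{(a, b]}` of an elementary integrand. -/
noncomputable def stepLp [SFinite P] (hH0 : 0 < H) (hH1 : H < 1) (τ : StepIndex 𝓖 P) :
    Lp ℂ 2 (P.prod (specMeasure H)) :=
  (memLp_smul_intervalFourier hH0 hH1 τ.1.2.2 τ.2.1 τ.2.2).toLp _

lemma inner_stepLp [SFinite P] (hH0 : 0 < H) (hH1 : H < 1) (σ τ : StepIndex 𝓖 P) :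
    ⟪stepLp hH0 hH1 σ, stepLp hH0 hH1 τ⟫ = (∫ ω, σ.1.1 ω * τ.1.1 ω ∂P) *
      ∫ ξ, ⟪intervalFourier σ.2.1 σ.2.2 ξ, intervalFourier τ.2.1 τ.2.2 ξ⟫ ∂specMeasure H := by
  rw [L2.inner_def, ← integral_prod_mul (fun ω => σ.1.1 ω * τ.1.1 ω) fun ξ =>
    ⟪intervalFourier σ.2.1 σ.2.2 ξ, intervalFourier τ.2.1 τ.2.2 ξ⟫]
  refine integral_congr_ae ?_
  filter_upwards [(memLp_smul_intervalFourier hH0 hH1 σ.1.2.2 σ.2.1 σ.2.2).coeFn_toLp,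
    (memLp_smul_intervalFourier hH0 hH1 τ.1.2.2 τ.2.1 τ.2.2).coeFn_toLp] with p h1 h2
  rw [stepLp, stepLp, h1, h2, real_inner_smul_left, real_inner_smul_right]
  ring

/-- Independence of the σ-algebra `𝓖` and the process `B`. -/
abbrev IndepProcess (𝓖 : MeasurableSpace Ω) [MeasurableSpace Ω] (B : ℝ≥0 → Ω → ℝ)
    (P : Measure Ω) : Prop :=
  Indep 𝓖 (MeasurableSpace.comap (fun ω t => B t ω) MeasurableSpace.pi) P

/-- A `𝓖`-measurable variable is independent of every functional of `B`. -/
lemma IndepProcess.indepFun (h : IndepProcess 𝓖 B P) {F : Ω → ℝ} (hF : Measurable[𝓖] F)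
    {φ : (ℝ≥0 → ℝ) → ℝ} (hφ : Measurable φ) : IndepFun F (fun ω => φ fun t => B t ω) P := by
  rw [IndepFun_iff_Indep]
  refine indep_of_indep_of_le_right (indep_of_indep_of_le_left h hF.comap_le) ?_
  have e : (fun ω => φ fun t => B t ω) = φ ∘ fun ω t => B t ω := rfl
  rw [e, ← MeasurableSpace.comap_comp]
  exact MeasurableSpace.comap_mono hφ.comap_le

/-- The product of a square integrable variable and an independent increment is square
integrable. -/
lemma IndepProcess.memLp_mul (h : IndepProcess 𝓖 B P) (hB : IsFBM H B P)
    (τ : StepIndex 𝓖 P) :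
    MemLp (fun ω => τ.1.1 ω * (B τ.2.2 ω - B τ.2.1 ω)) 2 P := by
  have hD : MemLp (fun ω => B τ.2.2 ω - B τ.2.1 ω) 2 P :=
    (IsCenteredGaussian.memLp hB _).sub (IsCenteredGaussian.memLp hB _)
  have hm : AEStronglyMeasurable (fun ω => τ.1.1 ω * (B τ.2.2 ω - B τ.2.1 ω)) P :=
    τ.1.2.2.1.mul hD.1
  rw [memLp_two_iff_integrable_sq hm]
  have hi : IndepFun (fun ω => τ.1.1 ω ^ 2) (fun ω => (B τ.2.2 ω - B τ.2.1 ω) ^ 2) P :=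
    h.indepFun (φ := fun f => (f τ.2.2 - f τ.2.1) ^ 2) (τ.1.2.1.pow_const 2) (by fun_prop)
  refine (hi.integrable_mul ((memLp_two_iff_integrable_sq τ.1.2.2.1).1 τ.1.2.2)
    ((memLp_two_iff_integrable_sq hD.1).1 hD)).congr (ae_of_all _ fun ω => ?_)
  simp [mul_pow]

/-- The elementary integral `F (B_b - B_a)`. -/
noncomputable def incrLp (h : IndepProcess 𝓖 B P) (hB : IsFBM H B P) (τ : StepIndex 𝓖 P) :
    Lp ℝ 2 P := (h.memLp_mul hB τ).toLp _

/-- The elementary integral is an isometry for the spectral norm. -/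
lemma inner_stepLp_eq_inner_incrLp [SFinite P] (hH0 : 0 < H) (hH1 : H < 1)
    (h : IndepProcess 𝓖 B P) (hB : IsFBM H B P) (σ τ : StepIndex 𝓖 P) :
    ⟪stepLp hH0 hH1 σ, stepLp hH0 hH1 τ⟫ = ⟪incrLp h hB σ, incrLp h hB τ⟫ := by
  have hi : IndepFun (fun ω => σ.1.1 ω * τ.1.1 ω)
      (fun ω => (B σ.2.2 ω - B σ.2.1 ω) * (B τ.2.2 ω - B τ.2.1 ω)) P :=
    h.indepFun (φ := fun f => (f σ.2.2 - f σ.2.1) * (f τ.2.2 - f τ.2.1))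
      (σ.1.2.1.mul τ.1.2.1) (by fun_prop)
  have hm := hB.measurable
  rw [inner_stepLp, integral_inner_intervalFourier hH0 hH1, ← hB.integral_increments,
    ← hi.integral_fun_mul_eq_mul_integral (σ.1.2.2.1.mul τ.1.2.2.1)
      (by fun_prop : Measurable _).aestronglyMeasurable, L2.inner_def]
  refine integral_congr_ae ?_
  filter_upwards [(h.memLp_mul hB σ).coeFn_toLp, (h.memLp_mul hB τ).coeFn_toLp] with ω h1 h2
  rw [incrLp, incrLp, h1, h2]
  simp only [RCLike.inner_apply, conj_trivial]
  ring

lemma RandomStep.integrable_toFun (φ : RandomStep α) (ω : α) :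
    Integrable fun x => φ.toFun x ω := by
  unfold RandomStep.toFun
  refine integrable_finsetSum _ fun i _ => Integrable.const_mul ?_ _
  rw [integrable_indicator_iff measurableSet_Ioc]
  simp

lemma integrable_mul_cexp {g : ℝ → ℝ} (hg : Integrable g) (ξ : ℝ) :
    Integrable fun x : ℝ => (g x : ℂ) * Complex.exp (Complex.I * ξ * x) := by
  refine Integrable.mono hg.norm (hg.1.aemeasurable.complex_ofReal.mul
    (by fun_prop)).aestronglyMeasurable (ae_of_all _ fun x => ?_)
  rw [norm_mul, show Complex.I * ξ * x = ((ξ * x : ℝ) : ℂ) * Complex.I by push_cast; ring,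
    Complex.norm_exp_ofReal_mul_I]
  simp

lemma fourierInt_sub {f g : ℝ → ℝ} (hf : Integrable f) (hg : Integrable g) (ξ : ℝ) :
    fourierInt (fun x => f x - g x) ξ = fourierInt f ξ - fourierInt g ξ := by
  rw [fourierInt, fourierInt, fourierInt, ← integral_sub (integrable_mul_cexp hf ξ)
    (integrable_mul_cexp hg ξ)]
  refine integral_congr_ae (ae_of_all _ fun x => ?_)
  simp only
  push_cast
  ring

lemma RandomStep.fourierInt_toFun (φ : RandomStep α) (ω : α) (ξ : ℝ) :
    fourierInt (fun x => φ.toFun x ω) ξ =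
      ∑ i, φ.coef i ω • intervalFourier (φ.left i) (φ.right i) ξ := by
  have hi : ∀ i, Integrable fun x : ℝ => (Set.Ioc (φ.left i : ℝ) (φ.right i : ℝ)).indicator
      (fun _ => (1 : ℝ)) x := fun i => by
    rw [integrable_indicator_iff measurableSet_Ioc]
    simp
  have e : ∀ x : ℝ, (φ.toFun x ω : ℂ) * Complex.exp (Complex.I * ξ * x) =
      ∑ i, (φ.coef i ω : ℂ) * ((((Set.Ioc (φ.left i : ℝ) (φ.right i : ℝ)).indicator
        (fun _ => (1 : ℝ)) x : ℝ) : ℂ) * Complex.exp (Complex.I * ξ * x)) := by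
    intro x
    rw [RandomStep.toFun]
    push_cast
    rw [Finset.sum_mul]
    exact Finset.sum_congr rfl fun i _ => mul_assoc _ _ _
  rw [fourierInt]
  simp_rw [e]
  rw [integral_finsetSum _ fun i _ => (integrable_mul_cexp (hi i) ξ).const_mul _]
  refine Finset.sum_congr rfl fun i _ => ?_
  rw [integral_const_mul, Complex.real_smul, intervalFourier,
    intervalIntegral.integral_of_le (by exact_mod_cast φ.le i),
    ← integral_indicator measurableSet_Ioc]
  congr 1
  refine integral_congr_ae (ae_of_all _ fun x => ?_)
  by_cases hx : x ∈ Set.Ioc (φ.left i : ℝ) (φ.right i : ℝ) <;> simp [hx]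

/-- The index of the `i`-th term of a random step function. -/
def RandomStep.index {φ : RandomStep Ω}
    (hφ : ∀ i, Measurable[𝓖] (φ.coef i) ∧ MemLp (φ.coef i) 2 P) (i : Fin φ.n) : StepIndex 𝓖 P :=
  (⟨φ.coef i, hφ i⟩, φ.left i, φ.right i)

lemma RandomStep.coeFn_sum_stepLp [SFinite P] (hH0 : 0 < H) (hH1 : H < 1) {φ : RandomStep Ω}
    (hφ : ∀ i, Measurable[𝓖] (φ.coef i) ∧ MemLp (φ.coef i) 2 P) :
    ⇑(∑ i, stepLp hH0 hH1 (RandomStep.index hφ i)) =ᵐ[P.prod (specMeasure H)]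
      fun p => fourierInt (fun x => φ.toFun x p.1) p.2 := by
  have h1 := Lp.coeFn_fun_finsetSum Finset.univ fun i => stepLp hH0 hH1 (RandomStep.index hφ i)
  have h2 : ∀ᵐ p ∂P.prod (specMeasure H), ∀ i, stepLp hH0 hH1 (RandomStep.index hφ i) p =
      φ.coef i p.1 • intervalFourier (φ.left i) (φ.right i) p.2 := by
    rw [ae_all_iff]
    exact fun i => MemLp.coeFn_toLp _
  filter_upwards [h1, h2] with p h1 h2
  rw [h1, φ.fourierInt_toFun]
  exact Finset.sum_congr rfl fun i _ => h2 i

lemma RandomStep.coeFn_sum_incrLp (h : IndepProcess 𝓖 B P) (hB : IsFBM H B P) {φ : RandomStep Ω}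
    (hφ : ∀ i, Measurable[𝓖] (φ.coef i) ∧ MemLp (φ.coef i) 2 P) :
    ⇑(∑ i, incrLp h hB (RandomStep.index hφ i)) =ᵐ[P] φ.integral B := by
  have h1 := Lp.coeFn_fun_finsetSum Finset.univ fun i => incrLp h hB (RandomStep.index hφ i)
  have h2 : ∀ᵐ ω ∂P, ∀ i, incrLp h hB (RandomStep.index hφ i) ω =
      φ.coef i ω * (B (φ.right i) ω - B (φ.left i) ω) := by
    rw [ae_all_iff]
    exact fun i => MemLp.coeFn_toLp _
  filter_upwards [h1, h2] with p h1 h2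
  rw [h1, RandomStep.integral]
  exact Finset.sum_congr rfl fun i _ => h2 i

lemma eLpNorm_two_sq {α E : Type*} [MeasurableSpace α] [NormedAddCommGroup E] {μ : Measure α}
    (f : α → E) : eLpNorm f 2 μ ^ 2 = ∫⁻ x, ‖f x‖ₑ ^ 2 ∂μ := by
  simpa using eLpNorm_nnreal_pow_eq_lintegral (f := f) (μ := μ) (p := 2) two_ne_zero

lemma tendsto_zero_of_sq {α : Type*} {l : Filter α} {u : α → ℝ≥0∞}
    (h : Tendsto (fun k => u k ^ 2) l (𝓝 0)) : Tendsto u l (𝓝 0) := by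
  have h2 := (ENNReal.continuous_rpow_const (y := 1 / 2)).tendsto 0 |>.comp h
  rw [ENNReal.zero_rpow_of_pos (by norm_num)] at h2
  refine h2.congr fun k => ?_
  rw [Function.comp_apply, ← ENNReal.rpow_natCast, ← ENNReal.rpow_mul]
  norm_num

/-- Convergence of step functions in mean square for the norm of the fBm is convergence of their
Fourier transforms in `L²`. -/
lemma tendsto_sum_stepLp [SFinite P] (hH0 : 0 < H) (hH1 : H < 1) {φ : ℕ → RandomStep Ω}
    (hφ : ∀ k i, Measurable[𝓖] ((φ k).coef i) ∧ MemLp ((φ k).coef i) 2 P) {f : ℝ → Ω → ℝ}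
    (hf : ∀ᵐ ω ∂P, Integrable fun x => f x ω)
    (hF : MemLp (fun p : Ω × ℝ => fourierInt (fun x => f x p.1) p.2) 2 (P.prod (specMeasure H)))
    (h : Tendsto (fun k => ∫⁻ ω, fbmNormSq H (fun x => (φ k).toFun x ω - f x ω) ∂P) atTop (𝓝 0)) :
    Tendsto (fun k => ∑ i, stepLp hH0 hH1 (RandomStep.index (hφ k) i)) atTop
      (𝓝 (hF.toLp _)) := by
  rw [Lp.tendsto_Lp_iff_tendsto_eLpNorm']
  refine tendsto_zero_of_sq (h.congr fun k => ?_)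
  rw [eLpNorm_two_sq, lintegral_prod _ (((Lp.aestronglyMeasurable _).sub
    (Lp.aestronglyMeasurable _)).enorm.pow_const 2)]
  have h1 := (RandomStep.coeFn_sum_stepLp hH0 hH1 (hφ k)).sub hF.coeFn_toLp
  refine lintegral_congr_ae ?_
  filter_upwards [hf, Measure.ae_ae_of_ae_prod h1] with ω h2 h3
  rw [fbmNormSq_eq_lintegral]
  refine lintegral_congr_ae ?_
  filter_upwards [h3] with ξ h3
  rw [fourierInt_sub ((φ k).integrable_toFun ω) h2, h3]
  rfl

lemma sum_index_mem_gramRel [SFinite P] (hH0 : 0 < H) (hH1 : H < 1) (h : IndepProcess 𝓖 B P)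
    (hB : IsFBM H B P) {φ : RandomStep Ω}
    (hφ : ∀ i, Measurable[𝓖] (φ.coef i) ∧ MemLp (φ.coef i) 2 P) :
    (∑ i, stepLp hH0 hH1 (RandomStep.index hφ i), ∑ i, incrLp h hB (RandomStep.index hφ i)) ∈
      gramRel (stepLp (𝓖 := 𝓖) (P := P) hH0 hH1) (incrLp h hB) := by
  have : (∑ i, stepLp hH0 hH1 (RandomStep.index hφ i),
      ∑ i, incrLp h hB (RandomStep.index hφ i)) = ∑ i, (stepLp hH0 hH1 (RandomStep.index hφ i),
      incrLp h hB (RandomStep.index hφ i)) := by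
    ext1 <;> simp [Prod.fst_sum, Prod.snd_sum]
  rw [this]
  exact Submodule.sum_mem _ fun i _ => mem_gramRel _ _ _

/-- The stochastic integral is the value of the isometric extension of the elementary integral. -/
lemma IsFBMIntegral.mem_gramGraph [SFinite P] (hH0 : 0 < H) (hH1 : H < 1)
    (h : IndepProcess 𝓖 B P) (hB : IsFBM H B P) {f : ℝ → Ω → ℝ} {J : Ω → ℝ}
    (hJ : IsFBMIntegral 𝓖 H B f J P)
    (hF : MemLp (fun p : Ω × ℝ => fourierInt (fun x => f x p.1) p.2) 2
      (P.prod (specMeasure H))) :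
    (hF.toLp _, hJ.2.1.toLp J) ∈ gramGraph (stepLp (𝓖 := 𝓖) (P := P) hH0 hH1) (incrLp h hB) := by
  obtain ⟨hf, hJm, φ, hφ, h1, h2⟩ := hJ
  refine mem_gramGraph_iff.2 ⟨fun k => (∑ i, stepLp hH0 hH1 (RandomStep.index (hφ k) i),
    ∑ i, incrLp h hB (RandomStep.index (hφ k) i)), fun k =>
    sum_index_mem_gramRel hH0 hH1 h hB (hφ k),
    (tendsto_sum_stepLp hH0 hH1 hφ hf hF h1).prodMk_nhds ?_⟩
  rw [Lp.tendsto_Lp_iff_tendsto_eLpNorm']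
  exact h2.congr fun k => eLpNorm_congr_ae
    ((RandomStep.coeFn_sum_incrLp h hB (hφ k)).sub hJm.coeFn_toLp).symm

/-- Isometry of the stochastic integral. -/
lemma IsFBMIntegral.integral_mul [SFinite P] (hH0 : 0 < H) (hH1 : H < 1)
    (h : IndepProcess 𝓖 B P) (hB : IsFBM H B P) {f f' : ℝ → Ω → ℝ} {J J' : Ω → ℝ}
    (hJ : IsFBMIntegral 𝓖 H B f J P) (hJ' : IsFBMIntegral 𝓖 H B f' J' P)
    (hF : MemLp (fun p : Ω × ℝ => fourierInt (fun x => f x p.1) p.2) 2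
      (P.prod (specMeasure H)))
    (hF' : MemLp (fun p : Ω × ℝ => fourierInt (fun x => f' x p.1) p.2) 2
      (P.prod (specMeasure H))) :
    ∫ ω, J ω * J' ω ∂P = ∫ p, ⟪fourierInt (fun x => f x p.1) p.2,
      fourierInt (fun x => f' x p.1) p.2⟫ ∂(P.prod (specMeasure H)) := by
  have key := inner_eq_of_mem_gramGraph (inner_stepLp_eq_inner_incrLp hH0 hH1 h hB)
    (hJ.mem_gramGraph hH0 hH1 h hB hF) (hJ'.mem_gramGraph hH0 hH1 h hB hF')
  simp only [L2.inner_def] at key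
  calc ∫ ω, J ω * J' ω ∂P = _ := ?_
    _ = _ := key.symm
    _ = _ := ?_
  · refine integral_congr_ae ?_
    filter_upwards [hJ.2.1.coeFn_toLp, hJ'.2.1.coeFn_toLp] with ω h1 h2
    simp [h1, h2, mul_comm]
  · refine integral_congr_ae ?_
    filter_upwards [hF.coeFn_toLp, hF'.coeFn_toLp] with p h1 h2
    rw [h1, h2]

/-- Existence of the stochastic integral of a random function that can be approximated by random
step functions. -/
lemma exists_isFBMIntegral [SFinite P] (hH0 : 0 < H) (hH1 : H < 1)
    (h : IndepProcess 𝓖 B P) (hB : IsFBM H B P) {φ : ℕ → RandomStep Ω}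
    (hφ : ∀ k i, Measurable[𝓖] ((φ k).coef i) ∧ MemLp ((φ k).coef i) 2 P) {f : ℝ → Ω → ℝ}
    (hf : ∀ᵐ ω ∂P, Integrable fun x => f x ω)
    (hF : MemLp (fun p : Ω × ℝ => fourierInt (fun x => f x p.1) p.2) 2 (P.prod (specMeasure H)))
    (hφf : Tendsto (fun k => ∫⁻ ω, fbmNormSq H (fun x => (φ k).toFun x ω - f x ω) ∂P)
      atTop (𝓝 0)) :
    ∃ J, IsFBMIntegral 𝓖 H B f J P := by
  obtain ⟨j, hj, -⟩ := exists_tendsto_of_mem_gramRel (inner_stepLp_eq_inner_incrLp hH0 hH1 h hB)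
    (fun k => sum_index_mem_gramRel hH0 hH1 h hB (hφ k))
    (tendsto_sum_stepLp hH0 hH1 hφ hf hF hφf)
  refine ⟨j, hf, Lp.memLp j, φ, hφ, hφf, ?_⟩
  refine ((Lp.tendsto_Lp_iff_tendsto_eLpNorm' _ _).1 hj).congr fun k => eLpNorm_congr_ae ?_
  exact (RandomStep.coeFn_sum_incrLp h hB (hφ k)).sub (ae_eq_refl _)

end StochasticIntegral

/-! ### Mean square integrable processes and their Fourier transforms -/

section MeanSquare
open scoped RealInnerProductSpace ComplexConjugate

variable {Ω Ω' : Type*} [MeasurableSpace Ω] [MeasurableSpace Ω'] {P : Measure Ω} {ρ : Measure Ω'}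
  {u v : ℝ → Ω → ℝ} {u' v' : ℝ → Ω' → ℝ}

/-- A jointly measurable process `u` with `∫ ‖u_r‖_{L²(P)} dr < ∞`. -/
structure MeanSqIntegrable (u : ℝ → Ω → ℝ) (P : Measure Ω) : Prop where
  measurable : Measurable fun p : ℝ × Ω => u p.1 p.2
  lintegral_ne_top : ∫⁻ r, eLpNorm (u r) 2 P ≠ ∞

lemma eLpNorm_two_eq_sqrt {E : Type*} [NormedAddCommGroup E] (f : Ω → E) :
    eLpNorm f 2 P = (∫⁻ x, ‖f x‖ₑ ^ 2 ∂P) ^ (1 / 2 : ℝ) := by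
  rw [← eLpNorm_two_sq, ← ENNReal.rpow_natCast, ← ENNReal.rpow_mul]
  norm_num

lemma measurable_eLpNorm_two [SFinite P] (hu : Measurable fun p : ℝ × Ω => u p.1 p.2) :
    Measurable fun r => eLpNorm (u r) 2 P := by
  simp_rw [eLpNorm_two_eq_sqrt]
  exact (Measurable.lintegral_prod_right' (f := fun p : ℝ × Ω => ‖u p.1 p.2‖ₑ ^ 2)
    (hu.enorm.pow_const 2)).pow_const _

lemma lintegral_enorm_mul_le {f g : Ω → ℝ} (hf : AEMeasurable f P) (hg : AEMeasurable g P) :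
    ∫⁻ ω, ‖f ω‖ₑ * ‖g ω‖ₑ ∂P ≤ eLpNorm f 2 P * eLpNorm g 2 P := by
  have h := ENNReal.lintegral_mul_le_Lp_mul_Lq P Real.HolderConjugate.two_two hf.enorm hg.enorm
  rw [eLpNorm_two_eq_sqrt, eLpNorm_two_eq_sqrt]
  simpa using h

lemma MeanSqIntegrable.sub [SFinite P] (hu : MeanSqIntegrable u P) (hv : MeanSqIntegrable v P) :
    MeanSqIntegrable (fun r ω => u r ω - v r ω) P := by
  refine ⟨hu.measurable.sub hv.measurable, ne_top_of_le_ne_top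
    (ENNReal.add_ne_top.2 ⟨hu.lintegral_ne_top, hv.lintegral_ne_top⟩) ?_⟩
  rw [← lintegral_add_left (measurable_eLpNorm_two hu.measurable)]
  refine lintegral_mono fun r => eLpNorm_sub_le ?_ ?_ one_le_two
  · exact (hu.measurable.comp measurable_prodMk_left).aestronglyMeasurable
  · exact (hv.measurable.comp measurable_prodMk_left).aestronglyMeasurable

lemma MeanSqIntegrable.add [SFinite P] (hu : MeanSqIntegrable u P) (hv : MeanSqIntegrable v P) :
    MeanSqIntegrable (fun r ω => u r ω + v r ω) P := by
  refine ⟨hu.measurable.add hv.measurable, ne_top_of_le_ne_top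
    (ENNReal.add_ne_top.2 ⟨hu.lintegral_ne_top, hv.lintegral_ne_top⟩) ?_⟩
  rw [← lintegral_add_left (measurable_eLpNorm_two hu.measurable)]
  refine lintegral_mono fun r => eLpNorm_add_le ?_ ?_ one_le_two
  · exact (hu.measurable.comp measurable_prodMk_left).aestronglyMeasurable
  · exact (hv.measurable.comp measurable_prodMk_left).aestronglyMeasurable

lemma MeanSqIntegrable.sum [SFinite P] {ι : Type*} (s : Finset ι) {w : ι → ℝ → Ω → ℝ}
    (hw : ∀ i, MeanSqIntegrable (w i) P) :
    MeanSqIntegrable (fun r ω => ∑ i ∈ s, w i r ω) P := by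
  classical
  induction s using Finset.induction_on with
  | empty => exact ⟨by simp, by simp⟩
  | insert i s hi ih =>
    simp_rw [Finset.sum_insert hi]
    exact (hw i).add ih

lemma RandomStep.meanSqIntegrable [SFinite P] {φ : RandomStep Ω}
    (hm : ∀ i, Measurable (φ.coef i)) (hL : ∀ i, MemLp (φ.coef i) 2 P) :
    MeanSqIntegrable φ.toFun P := by
  refine MeanSqIntegrable.sum _ fun i => ⟨?_, ?_⟩
  · exact ((hm i).comp measurable_snd).mul
      ((measurable_const.indicator measurableSet_Ioc).comp measurable_fst)
  · have e : ∀ r, eLpNorm (fun ω => φ.coef i ω *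
        (Set.Ioc (φ.left i : ℝ) (φ.right i : ℝ)).indicator (fun _ => (1 : ℝ)) r) 2 P =
        (Set.Ioc (φ.left i : ℝ) (φ.right i : ℝ)).indicator
          (fun _ => eLpNorm (φ.coef i) 2 P) r := by
      intro r
      by_cases hr : r ∈ Set.Ioc (φ.left i : ℝ) (φ.right i : ℝ) <;> simp [hr]
    simp_rw [e]
    rw [lintegral_indicator measurableSet_Ioc, setLIntegral_const]
    exact ENNReal.mul_ne_top (hL i).2.ne (by simp)

/-- The trajectories of a mean square integrable process are integrable. -/
lemma MeanSqIntegrable.ae_integrable [IsProbabilityMeasure P] (hu : MeanSqIntegrable u P) :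
    ∀ᵐ ω ∂P, Integrable fun r => u r ω := by
  have hm : Measurable fun p : Ω × ℝ => ‖u p.2 p.1‖ₑ :=
    (hu.measurable.comp measurable_swap).enorm
  have h : ∫⁻ ω, (∫⁻ r, ‖u r ω‖ₑ) ∂P ≠ ∞ := by
    rw [lintegral_lintegral_swap hm.aemeasurable]
    refine ne_top_of_le_ne_top hu.lintegral_ne_top (lintegral_mono fun r => ?_)
    rw [← eLpNorm_one_eq_lintegral_enorm]
    exact eLpNorm_le_eLpNorm_of_exponent_le one_le_two
      (hu.measurable.comp measurable_prodMk_left).aestronglyMeasurable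
  filter_upwards [ae_lt_top hm.lintegral_prod_right' h] with ω hω
  exact ⟨(hu.measurable.comp measurable_prodMk_right).aestronglyMeasurable, hω⟩

lemma norm_cexp_I_mul (ξ x : ℝ) : ‖Complex.exp (Complex.I * ξ * x)‖ = 1 := by
  rw [show Complex.I * ξ * x = ((ξ * x : ℝ) : ℂ) * Complex.I by push_cast; ring,
    Complex.norm_exp_ofReal_mul_I]

/-- The integrability on `Ω × ℝ × ℝ` that allows the exchange of the expectation with the two
Fourier integrals. -/
lemma MeanSqIntegrable.integrable_mul_cexp [SFinite P] (hu : MeanSqIntegrable u P)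
    (hv : MeanSqIntegrable v P) (ξ : ℝ) :
    Integrable (fun q : Ω × (ℝ × ℝ) => ((u q.2.1 q.1 * v q.2.2 q.1 : ℝ) : ℂ) *
      Complex.exp (Complex.I * ξ * ((q.2.2 - q.2.1 : ℝ) : ℂ))) (P.prod (volume.prod volume)) := by
  have mu : Measurable fun q : Ω × (ℝ × ℝ) => u q.2.1 q.1 :=
    hu.measurable.comp (f := fun q : Ω × (ℝ × ℝ) => (q.2.1, q.1)) (by fun_prop)
  have mv : Measurable fun q : Ω × (ℝ × ℝ) => v q.2.2 q.1 :=
    hv.measurable.comp (f := fun q : Ω × (ℝ × ℝ) => (q.2.2, q.1)) (by fun_prop)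
  refine ⟨(((mu.mul mv).complex_ofReal).mul (by fun_prop)).aestronglyMeasurable, ?_⟩
  have e : ∀ q : Ω × (ℝ × ℝ), ‖((u q.2.1 q.1 * v q.2.2 q.1 : ℝ) : ℂ) *
      Complex.exp (Complex.I * ξ * ((q.2.2 - q.2.1 : ℝ) : ℂ))‖ₑ =
      ‖u q.2.1 q.1‖ₑ * ‖v q.2.2 q.1‖ₑ := by
    intro q
    rw [← ofReal_norm, norm_mul, norm_cexp_I_mul, mul_one, Complex.norm_real, norm_mul,
      ENNReal.ofReal_mul (norm_nonneg _), ofReal_norm, ofReal_norm]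
  rw [HasFiniteIntegral]
  simp_rw [e]
  have mm : Measurable fun q : Ω × (ℝ × ℝ) => ‖u q.2.1 q.1‖ₑ * ‖v q.2.2 q.1‖ₑ :=
    mu.enorm.mul mv.enorm
  rw [lintegral_prod_symm' _ mm]
  -- By Cauchy–Schwarz in `ω`, the double integral is at most a product of two finite integrals.
  calc _ ≤ ∫⁻ p : ℝ × ℝ, eLpNorm (u p.1) 2 P * eLpNorm (v p.2) 2 P ∂(volume.prod volume) :=
        lintegral_mono fun p => lintegral_enorm_mul_le
          (hu.measurable.comp measurable_prodMk_left).aemeasurable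
          (hv.measurable.comp measurable_prodMk_left).aemeasurable
    _ = (∫⁻ r, eLpNorm (u r) 2 P) * ∫⁻ r, eLpNorm (v r) 2 P :=
        lintegral_prod_mul (measurable_eLpNorm_two hu.measurable).aemeasurable
          (measurable_eLpNorm_two hv.measurable).aemeasurable
    _ < ∞ := ENNReal.mul_lt_top hu.lintegral_ne_top.lt_top hv.lintegral_ne_top.lt_top

lemma conj_fourierInt_mul_fourierInt (g h : ℝ → ℝ) (ξ : ℝ) :
    conj (fourierInt g ξ) * fourierInt h ξ = ∫ p : ℝ × ℝ, ((g p.1 * h p.2 : ℝ) : ℂ) *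
      Complex.exp (Complex.I * ξ * ((p.2 - p.1 : ℝ) : ℂ)) ∂(volume.prod volume) := by
  rw [fourierInt, fourierInt, ← integral_conj, ← integral_prod_mul]
  refine integral_congr_ae (ae_of_all _ fun p => ?_)
  simp only [map_mul, Complex.conj_ofReal, ← Complex.exp_conj, Complex.conj_I]
  push_cast
  rw [show Complex.I * ξ * (p.2 - p.1) = -Complex.I * ξ * p.1 + Complex.I * ξ * p.2 by ring,
    Complex.exp_add]
  ring

lemma MeanSqIntegrable.integrable_conj_mul [SFinite P] (hu : MeanSqIntegrable u P)
    (hv : MeanSqIntegrable v P) (ξ : ℝ) :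
    Integrable (fun ω => conj (fourierInt (fun x => u x ω) ξ) * fourierInt (fun x => v x ω) ξ)
      P := by
  simp_rw [conj_fourierInt_mul_fourierInt]
  exact (hu.integrable_mul_cexp hv ξ).integral_prod_left

lemma MeanSqIntegrable.integrable_inner [SFinite P] (hu : MeanSqIntegrable u P)
    (hv : MeanSqIntegrable v P) (ξ : ℝ) :
    Integrable (fun ω => ⟪fourierInt (fun x => u x ω) ξ, fourierInt (fun x => v x ω) ξ⟫) P := by
  simp_rw [Complex.inner, mul_comm _ (conj _)]
  exact (hu.integrable_conj_mul hv ξ).re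

/-- Fubini: the second moments of the Fourier transforms of two processes are a double Fourier
integral of their covariance. -/
lemma MeanSqIntegrable.integral_inner [SFinite P] (hu : MeanSqIntegrable u P)
    (hv : MeanSqIntegrable v P) (ξ : ℝ) :
    ∫ ω, ⟪fourierInt (fun x => u x ω) ξ, fourierInt (fun x => v x ω) ξ⟫ ∂P =
      (∫ p : ℝ × ℝ, ((∫ ω, u p.1 ω * v p.2 ω ∂P : ℝ) : ℂ) *
        Complex.exp (Complex.I * ξ * ((p.2 - p.1 : ℝ) : ℂ)) ∂(volume.prod volume)).re := by
  simp_rw [Complex.inner, mul_comm _ (conj _)]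
  have h := integral_re (hu.integrable_conj_mul hv ξ)
  simp only [RCLike.re_to_complex] at h
  rw [h]
  simp_rw [conj_fourierInt_mul_fourierInt]
  rw [integral_integral_swap (hu.integrable_mul_cexp hv ξ)]
  congr 1
  refine integral_congr_ae (ae_of_all _ fun p => ?_)
  simp only
  rw [integral_mul_const, integral_complex_ofReal]

/-- The second moments of the Fourier transforms depend on the covariances only. -/
lemma MeanSqIntegrable.integral_inner_congr [SFinite P] [SFinite ρ] (hu : MeanSqIntegrable u P)
    (hv : MeanSqIntegrable v P) (hu' : MeanSqIntegrable u' ρ) (hv' : MeanSqIntegrable v' ρ)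
    (h : ∀ r s, ∫ ω, u r ω * v s ω ∂P = ∫ ω, u' r ω * v' s ω ∂ρ) (ξ : ℝ) :
    ∫ ω, ⟪fourierInt (fun x => u x ω) ξ, fourierInt (fun x => v x ω) ξ⟫ ∂P =
      ∫ ω, ⟪fourierInt (fun x => u' x ω) ξ, fourierInt (fun x => v' x ω) ξ⟫ ∂ρ := by
  rw [hu.integral_inner hv, hu'.integral_inner hv']
  simp_rw [h]

lemma MeanSqIntegrable.lintegral_enorm_sq [SFinite P] (hu : MeanSqIntegrable u P) (ξ : ℝ) :
    ∫⁻ ω, ‖fourierInt (fun x => u x ω) ξ‖ₑ ^ 2 ∂P =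
      ENNReal.ofReal (∫ ω, ⟪fourierInt (fun x => u x ω) ξ, fourierInt (fun x => u x ω) ξ⟫ ∂P) := by
  rw [ofReal_integral_eq_lintegral_ofReal (hu.integrable_inner hu ξ)
    (ae_of_all _ fun ω => real_inner_self_nonneg)]
  refine lintegral_congr fun ω => ?_
  rw [real_inner_self_eq_norm_sq, ENNReal.ofReal_pow (norm_nonneg _), ofReal_norm]

lemma MeanSqIntegrable.measurable_fourierInt (hu : MeanSqIntegrable u P) :
    Measurable fun p : Ω × ℝ => fourierInt (fun x => u x p.1) p.2 := by
  have : Measurable fun q : (Ω × ℝ) × ℝ =>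
      (u q.2 q.1.1 : ℂ) * Complex.exp (Complex.I * q.1.2 * q.2) :=
    (hu.measurable.comp (f := fun q : (Ω × ℝ) × ℝ => (q.2, q.1.1)) (by fun_prop)).complex_ofReal.mul
      (by fun_prop)
  exact (this.stronglyMeasurable.integral_prod_right' (ν := volume)).measurable

/-- The mean square norm with respect to the fBm depends on the covariances only. -/
lemma MeanSqIntegrable.lintegral_prod_congr [SFinite P] [SFinite ρ] (ν : Measure ℝ) [SFinite ν]
    (hu : MeanSqIntegrable u P) (hu' : MeanSqIntegrable u' ρ)
    (h : ∀ r s, ∫ ω, u r ω * u s ω ∂P = ∫ ω, u' r ω * u' s ω ∂ρ) :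
    ∫⁻ p, ‖fourierInt (fun x => u x p.1) p.2‖ₑ ^ 2 ∂(P.prod ν) =
      ∫⁻ p, ‖fourierInt (fun x => u' x p.1) p.2‖ₑ ^ 2 ∂(ρ.prod ν) := by
  rw [lintegral_prod_symm' _ (hu.measurable_fourierInt.enorm.pow_const 2),
    lintegral_prod_symm' _ (hu'.measurable_fourierInt.enorm.pow_const 2)]
  refine lintegral_congr fun ξ => ?_
  rw [hu.lintegral_enorm_sq, hu'.lintegral_enorm_sq, hu.integral_inner_congr hu hu' hu' h]

end MeanSquare

/-! ### Processes with covariance `(s + t)^{-γ}` -/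

section Laplace
open scoped RealInnerProductSpace

variable {γ : ℝ} {α α' Ω Ω' : Type*} [MeasurableSpace Ω] [MeasurableSpace Ω'] {P : Measure Ω}
  {ρ : Measure Ω'} {Q : ℝ → Ω → ℝ} {Q' : ℝ → Ω' → ℝ}

/-- A jointly measurable square integrable process `{Q_s, s > 0}` with covariance `(s + t)^{-γ}`,
extended by `0` to the real line. The measure `P` need not be finite. -/
structure IsLaplaceProcess (γ : ℝ) (Q : ℝ → Ω → ℝ) (P : Measure Ω) : Prop where
  measurable : Measurable fun p : ℝ × Ω => Q p.1 p.2
  memLp : ∀ s, MemLp (Q s) 2 P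
  cov : ∀ s r, 0 < s → 0 < r → ∫ ω, Q s ω * Q r ω ∂P = (s + r) ^ (-γ)
  zero : ∀ s ≤ 0, Q s = 0

/-- The random function `r ↦ 1_{[0, t)}(r) Q_{t-r}`. -/
noncomputable def lagged (Q : ℝ → Ω → ℝ) (t : ℝ≥0) (r : ℝ) (ω : Ω) : ℝ :=
  if 0 ≤ r then Q (t - r) ω else 0

/-- The approximation of `lagged Q t` by the values at the left end points of `n + 1` intervals
of equal length. -/
noncomputable def laggedStep (Q : ℝ → Ω → ℝ) (t : ℝ≥0) (n : ℕ) : RandomStep Ω where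
  n := n + 1
  left k := k * (t / (n + 1))
  right k := (k + 1) * (t / (n + 1))
  le k := by gcongr; exact le_self_add
  coef k := Q (t - k * (t / (n + 1)))

/-- The finite linear combinations with the same coefficients of two processes. -/
def jointSpan (Q : ℝ → Ω → ℝ) (Q' : ℝ → Ω' → ℝ) : Submodule ℝ ((Ω → ℝ) × (Ω' → ℝ)) :=
  Submodule.span ℝ (Set.range fun s => (Q s, Q' s))

lemma mem_jointSpan (Q : ℝ → α → ℝ) (Q' : ℝ → α' → ℝ) (s : ℝ) : (Q s, Q' s) ∈ jointSpan Q Q' :=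
  Submodule.subset_span ⟨s, rfl⟩

lemma memLp_of_mem_jointSpan (hQ : IsLaplaceProcess γ Q P) (hQ' : IsLaplaceProcess γ Q' ρ)
    {p : (Ω → ℝ) × (Ω' → ℝ)} (hp : p ∈ jointSpan Q Q') : MemLp p.1 2 P ∧ MemLp p.2 2 ρ := by
  induction hp using Submodule.span_induction with
  | mem p hp =>
    obtain ⟨s, rfl⟩ := hp
    exact ⟨hQ.memLp s, hQ'.memLp s⟩
  | zero => exact ⟨MemLp.zero, MemLp.zero⟩
  | add p q _ _ hp hq => exact ⟨hp.1.add hq.1, hp.2.add hq.2⟩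
  | smul c p _ hp => exact ⟨hp.1.const_smul c, hp.2.const_smul c⟩

/-- Two such processes have the same covariance, also at non-positive times, where both vanish. -/
lemma IsLaplaceProcess.cov_eq (hQ : IsLaplaceProcess γ Q P) (hQ' : IsLaplaceProcess γ Q' ρ)
    (s r : ℝ) : ∫ ω, Q s ω * Q r ω ∂P = ∫ ω, Q' s ω * Q' r ω ∂ρ := by
  rcases le_or_gt s 0 with hs | hs
  · simp [hQ.zero s hs, hQ'.zero s hs]
  rcases le_or_gt r 0 with hr | hr
  · simp [hQ.zero r hr, hQ'.zero r hr]
  rw [hQ.cov s r hs hr, hQ'.cov s r hs hr]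

/-- Finite linear combinations of two processes with the same covariance have the same second
moments, if the coefficients are the same. -/
lemma integral_mul_eq_of_mem_jointSpan (hQ : IsLaplaceProcess γ Q P)
    (hQ' : IsLaplaceProcess γ Q' ρ) {p q : (Ω → ℝ) × (Ω' → ℝ)} (hp : p ∈ jointSpan Q Q')
    (hq : q ∈ jointSpan Q Q') : ∫ ω, p.1 ω * q.1 ω ∂P = ∫ ω, p.2 ω * q.2 ω ∂ρ := by
  have key : ∀ s, ∀ q ∈ jointSpan Q Q', ∫ ω, Q s ω * q.1 ω ∂P = ∫ ω, Q' s ω * q.2 ω ∂ρ := by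
    intro s q hq
    induction hq using Submodule.span_induction with
    | mem q hq =>
      obtain ⟨r, rfl⟩ := hq
      exact hQ.cov_eq hQ' s r
    | zero => simp
    | add q q' hq hq' ih ih' =>
      have h := memLp_of_mem_jointSpan hQ hQ' hq
      have h' := memLp_of_mem_jointSpan hQ hQ' hq'
      simp only [Prod.fst_add, Prod.snd_add, Pi.add_apply, mul_add]
      have i1 : ∫ ω, (Q s ω * q.1 ω + Q s ω * q'.1 ω) ∂P = _ :=
        integral_add ((hQ.memLp s).integrable_mul h.1) ((hQ.memLp s).integrable_mul h'.1)
      have i2 : ∫ ω, (Q' s ω * q.2 ω + Q' s ω * q'.2 ω) ∂ρ = _ :=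
        integral_add ((hQ'.memLp s).integrable_mul h.2) ((hQ'.memLp s).integrable_mul h'.2)
      exact i1.trans ((congrArg₂ (· + ·) ih ih').trans i2.symm)
    | smul c q _ ih =>
      simp only [Prod.smul_fst, Prod.smul_snd, Pi.smul_apply, smul_eq_mul, mul_left_comm _ c,
        integral_const_mul, ih]
  have hq2 := memLp_of_mem_jointSpan hQ hQ' hq
  induction hp using Submodule.span_induction with
  | mem p hp =>
    obtain ⟨s, rfl⟩ := hp
    exact key s q hq
  | zero => simp
  | add p p' hp hp' ih ih' =>
    have h := memLp_of_mem_jointSpan hQ hQ' hp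
    have h' := memLp_of_mem_jointSpan hQ hQ' hp'
    simp only [Prod.fst_add, Prod.snd_add, Pi.add_apply, add_mul]
    have i1 : ∫ ω, (p.1 ω * q.1 ω + p'.1 ω * q.1 ω) ∂P = _ :=
      integral_add (h.1.integrable_mul hq2.1) (h'.1.integrable_mul hq2.1)
    have i2 : ∫ ω, (p.2 ω * q.2 ω + p'.2 ω * q.2 ω) ∂ρ = _ :=
      integral_add (h.2.integrable_mul hq2.2) (h'.2.integrable_mul hq2.2)
    exact i1.trans ((congrArg₂ (· + ·) ih ih').trans i2.symm)
  | smul c p _ ih =>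
    simp only [Prod.smul_fst, Prod.smul_snd, Pi.smul_apply, smul_eq_mul, mul_assoc,
      integral_const_mul, ih]

lemma lagged_mem_jointSpan (Q : ℝ → α → ℝ) (Q' : ℝ → α' → ℝ) (t : ℝ≥0) (r : ℝ) :
    (lagged Q t r, lagged Q' t r) ∈ jointSpan Q Q' := by
  by_cases h : 0 ≤ r
  · have e : (lagged Q t r, lagged Q' t r) = (Q (t - r), Q' (t - r)) := by
      ext x <;> simp [lagged, h]
    rw [e]
    exact mem_jointSpan Q Q' _
  · have e : (lagged Q t r, lagged Q' t r) = 0 := by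
      ext x <;> simp [lagged, h]
    rw [e]
    exact zero_mem _

lemma laggedStep_mem_jointSpan (Q : ℝ → α → ℝ) (Q' : ℝ → α' → ℝ) (t : ℝ≥0) (n : ℕ) (r : ℝ) :
    ((laggedStep Q t n).toFun r, (laggedStep Q' t n).toFun r) ∈ jointSpan Q Q' := by
  have e : ((laggedStep Q t n).toFun r, (laggedStep Q' t n).toFun r) =
      ∑ k : Fin (n + 1), (Set.Ioc (((laggedStep Q t n).left k : ℝ≥0) : ℝ)
        ((laggedStep Q t n).right k : ℝ≥0)).indicator (fun _ => (1 : ℝ)) r •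
        ((laggedStep Q t n).coef k, (laggedStep Q' t n).coef k) := by
    ext x
    · simp only [Prod.fst_sum, Prod.smul_fst, Finset.sum_apply, Pi.smul_apply, smul_eq_mul]
      exact Finset.sum_congr rfl fun k _ => mul_comm _ _
    · simp only [Prod.snd_sum, Prod.smul_snd, Finset.sum_apply, Pi.smul_apply, smul_eq_mul]
      exact Finset.sum_congr rfl fun k _ => mul_comm _ _
  rw [e]
  exact Submodule.sum_mem _ fun k _ => Submodule.smul_mem _ _ (mem_jointSpan Q Q' _)

lemma IsLaplaceProcess.eLpNorm_eq (hQ : IsLaplaceProcess γ Q P) {s : ℝ} (hs : 0 < s) :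
    eLpNorm (Q s) 2 P = ENNReal.ofReal ((s + s) ^ (-γ / 2)) := by
  have h : eLpNorm (Q s) 2 P ^ 2 = ENNReal.ofReal ((s + s) ^ (-γ)) := by
    have i : Integrable (fun ω => Q s ω * Q s ω) P := (hQ.memLp s).integrable_mul (hQ.memLp s)
    rw [eLpNorm_two_sq, ← hQ.cov s s hs hs, ofReal_integral_eq_lintegral_ofReal
      i (ae_of_all _ fun ω => mul_self_nonneg _)]
    refine lintegral_congr fun ω => ?_
    rw [← pow_two, ← sq_abs, ENNReal.ofReal_pow (abs_nonneg _), ← Real.norm_eq_abs, ofReal_norm]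
  have h2 : eLpNorm (Q s) 2 P = (eLpNorm (Q s) 2 P ^ 2) ^ (1 / 2 : ℝ) := by
    rw [← ENNReal.rpow_natCast, ← ENNReal.rpow_mul]
    norm_num
  rw [h2, h, ENNReal.ofReal_rpow_of_pos (by positivity), ← Real.rpow_mul (by positivity)]
  congr 2
  ring

/-- Since `‖Q_s‖_{L²} = (2s)^{-γ/2}`, the condition `γ < 2` makes `∫_0^t ‖Q_{t-r}‖_{L²} dr` finite. -/
lemma IsLaplaceProcess.meanSqIntegrable_lagged (hQ : IsLaplaceProcess γ Q P) (hγ2 : γ < 2)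
    (t : ℝ≥0) : MeanSqIntegrable (lagged Q t) P := by
  constructor
  · exact Measurable.ite (measurableSet_le measurable_const measurable_fst)
      (hQ.measurable.comp (f := fun p : ℝ × Ω => ((t : ℝ) - p.1, p.2)) (by fun_prop))
      measurable_const
  · have hi : IntegrableOn (fun s : ℝ => (s + s) ^ (-γ / 2)) (Set.Ioc 0 t) := by
      have := (intervalIntegral.intervalIntegrable_rpow' (a := 0) (b := t) (r := -γ / 2)
        (by linarith)).1.const_mul (2 ^ (-γ / 2) : ℝ)
      refine IntegrableOn.congr_fun this (fun s hs => ?_) measurableSet_Ioc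
      rw [← two_mul, Real.mul_rpow (by norm_num) hs.1.le]
    have e : ∀ r, eLpNorm (lagged Q t r) 2 P = (Set.Ioc (0 : ℝ) t).indicator
        (fun s => ENNReal.ofReal ((s + s) ^ (-γ / 2))) (t - r) := by
      intro r
      by_cases h0 : 0 ≤ r
      · have e1 : lagged Q t r = Q (t - r) := by
          ext x
          simp [lagged, h0]
        rw [e1]
        rcases le_or_gt ((t : ℝ) - r) 0 with h1 | h1
        · rw [hQ.zero _ h1, Set.indicator_of_notMem fun h => absurd h.1 (not_lt.2 h1)]
          simp
        · rw [Set.indicator_of_mem (show (t : ℝ) - r ∈ Set.Ioc (0 : ℝ) t from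
            ⟨h1, by linarith⟩), hQ.eLpNorm_eq h1]
      · have e1 : lagged Q t r = 0 := by
          ext x
          simp [lagged, h0]
        rw [e1, Set.indicator_of_notMem fun h => absurd h.2 (by linarith [not_le.1 h0])]
        simp
    simp_rw [e]
    rw [lintegral_sub_left_eq_self (fun s => (Set.Ioc (0 : ℝ) t).indicator
        (fun s => ENNReal.ofReal ((s + s) ^ (-γ / 2))) s) (t : ℝ),
      lintegral_indicator measurableSet_Ioc]
    exact hi.lintegral_lt_top.ne

lemma IsLaplaceProcess.measurable_apply (hQ : IsLaplaceProcess γ Q P) (s : ℝ) :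
    Measurable (Q s) :=
  hQ.measurable.comp measurable_prodMk_left

lemma IsLaplaceProcess.meanSqIntegrable_laggedStep [SFinite P] (hQ : IsLaplaceProcess γ Q P)
    (t : ℝ≥0) (n : ℕ) : MeanSqIntegrable (laggedStep Q t n).toFun P :=
  RandomStep.meanSqIntegrable (fun _ => hQ.measurable_apply _) fun _ => hQ.memLp _

/-- The process `{Z_t, t > 0}` extended by `0` to the real line. -/
noncomputable def zeroExtend (Z : Set.Ioi (0 : ℝ) → α → ℝ) (s : ℝ) (ω : α) : ℝ :=
  if h : 0 < s then Z ⟨s, h⟩ ω else 0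

lemma zeroExtend_of_pos (Z : Set.Ioi (0 : ℝ) → α → ℝ) {s : ℝ} (h : 0 < s) :
    zeroExtend Z s = Z ⟨s, h⟩ := by
  ext ω
  simp [zeroExtend, h]

lemma zeroExtend_of_nonpos (Z : Set.Ioi (0 : ℝ) → α → ℝ) {s : ℝ} (h : s ≤ 0) :
    zeroExtend Z s = 0 := by
  ext ω
  simp [zeroExtend, not_lt.2 h]

lemma shiftedIntegrand_eq_lagged (Z : Set.Ioi (0 : ℝ) → α → ℝ) (t : ℝ≥0) :
    shiftedIntegrand Z t = lagged (zeroExtend Z) t := by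
  ext r ω
  by_cases h0 : 0 ≤ r <;> by_cases h1 : r < t <;>
    simp [shiftedIntegrand, lagged, zeroExtend, h0, h1]

/-- The process `Z`, extended by `0`, and its only properties that matter for the covariances. -/
lemma isLaplaceProcess_zeroExtend {Z : Set.Ioi (0 : ℝ) → Ω → ℝ}
    (hZ : IsCenteredGaussian Z (fun s t => ((s : ℝ) + (t : ℝ)) ^ (-γ)) P)
    (hZm : Measurable fun p : Set.Ioi (0 : ℝ) × Ω => Z p.1 p.2) :
    IsLaplaceProcess γ (zeroExtend Z) P where
  measurable := by
    classical
    have hs : MeasurableSet {p : ℝ × Ω | 0 < p.1} := measurableSet_lt measurable_const measurable_fst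
    exact Measurable.dite (s := {p : ℝ × Ω | 0 < p.1}) (f := fun p => Z ⟨p.1.1, p.2⟩ p.1.2)
      (hZm.comp (f := fun p : {p : ℝ × Ω | 0 < p.1} => ((⟨p.1.1, p.2⟩ : Set.Ioi (0 : ℝ)), p.1.2))
        (by fun_prop)) (g := fun _ => 0) measurable_const hs
  memLp s := by
    rcases le_or_gt s 0 with h | h
    · rw [zeroExtend_of_nonpos Z h]
      exact MemLp.zero
    · rw [zeroExtend_of_pos Z h]
      exact hZ.memLp _
  cov s r hs hr := by
    rw [zeroExtend_of_pos Z hs, zeroExtend_of_pos Z hr]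
    exact hZ.cov ⟨s, hs⟩ ⟨r, hr⟩
  zero s hs := zeroExtend_of_nonpos Z hs

/-- The measure `Γ(γ)⁻¹ y^{γ-1} dy` on `(0, ∞)`, whose Laplace transform is `s^{-γ}`. -/
noncomputable def gammaWeight (γ : ℝ) : Measure ℝ :=
  halfLine.withDensity fun y => ENNReal.ofReal (y ^ (γ - 1) / Real.Gamma γ)

instance (γ : ℝ) : SFinite (gammaWeight γ) := by
  unfold gammaWeight
  infer_instance

lemma gammaWeight_density_nonneg (hγ0 : 0 < γ) {y : ℝ} (hy : 0 < y) :
    0 ≤ y ^ (γ - 1) / Real.Gamma γ := by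
  have := Real.Gamma_pos_of_pos hγ0
  positivity

lemma measurable_gammaWeight_density :
    Measurable fun y : ℝ => ENNReal.ofReal (y ^ (γ - 1) / Real.Gamma γ) := by
  fun_prop

lemma integrable_gammaWeight_iff (hγ0 : 0 < γ) {f : ℝ → ℝ} :
    Integrable f (gammaWeight γ) ↔
      IntegrableOn (fun y => y ^ (γ - 1) / Real.Gamma γ * f y) (Set.Ioi 0) := by
  rw [gammaWeight, integrable_withDensity_iff_integrable_smul'
    measurable_gammaWeight_density (ae_of_all _ fun _ => ENNReal.ofReal_lt_top)]
  refine integrable_congr ?_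
  filter_upwards [ae_restrict_mem measurableSet_Ioi] with y hy
  rw [ENNReal.toReal_ofReal (gammaWeight_density_nonneg hγ0 hy), smul_eq_mul]

lemma integral_gammaWeight (hγ0 : 0 < γ) (f : ℝ → ℝ) :
    ∫ y, f y ∂gammaWeight γ = ∫ y in Set.Ioi (0 : ℝ), y ^ (γ - 1) / Real.Gamma γ * f y := by
  rw [gammaWeight, integral_withDensity_eq_integral_toReal_smul
    measurable_gammaWeight_density (ae_of_all _ fun _ => ENNReal.ofReal_lt_top)]
  refine integral_congr_ae ?_
  filter_upwards [ae_restrict_mem measurableSet_Ioi] with y hy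
  rw [ENNReal.toReal_ofReal (gammaWeight_density_nonneg hγ0 hy), smul_eq_mul]

lemma ae_gammaWeight_pos : ∀ᵐ y ∂gammaWeight γ, 0 < y :=
  (withDensity_absolutelyContinuous _ _).ae_le (ae_restrict_mem measurableSet_Ioi)

/-- The exponentials `s ↦ e^{-ys}`, as a process on the measure space `gammaWeight γ`. -/
noncomputable def expProcess (s y : ℝ) : ℝ := if 0 < s then Real.exp (-(s * y)) else 0

lemma measurable_expProcess : Measurable fun p : ℝ × ℝ => expProcess p.1 p.2 :=
  Measurable.ite (measurableSet_lt measurable_const measurable_fst) (by fun_prop) measurable_const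

/-- The exponentials have the same covariance as `Z`, as `∫ e^{-sy} e^{-ry} y^{γ-1} dy` is the Gamma
integral. The underlying measure `gammaWeight γ` is infinite. -/
lemma isLaplaceProcess_expProcess (hγ0 : 0 < γ) :
    IsLaplaceProcess γ expProcess (gammaWeight γ) where
  measurable := measurable_expProcess
  zero s hs := by
    ext y
    simp [expProcess, not_lt.2 hs]
  memLp s := by
    have hm : Measurable (expProcess s) := measurable_expProcess.comp measurable_prodMk_left
    rw [memLp_two_iff_integrable_sq hm.aestronglyMeasurable, integrable_gammaWeight_iff hγ0]
    rcases le_or_gt s 0 with h | h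
    · simp [expProcess, not_lt.2 h]
    · refine IntegrableOn.congr_fun ((integrableOn_rpow_mul_exp_neg hγ0 (add_pos h h)).const_mul
        (Real.Gamma γ)⁻¹) (fun y _ => ?_) measurableSet_Ioi
      simp only [expProcess, h, if_true]
      rw [pow_two, ← Real.exp_add, add_mul, neg_add]
      ring
  cov s r hs hr := by
    have e : ∀ y ∈ Set.Ioi (0 : ℝ), y ^ (γ - 1) / Real.Gamma γ *
        (expProcess s y * expProcess r y) =
        (Real.Gamma γ)⁻¹ * (y ^ (γ - 1) * Real.exp (-((s + r) * y))) := by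
      intro y _
      simp only [expProcess, hs, hr, if_true]
      rw [← Real.exp_add, add_mul, neg_add]
      ring
    have := (Real.Gamma_pos_of_pos hγ0).ne'
    rw [integral_gammaWeight hγ0, setIntegral_congr_fun measurableSet_Ioi e, integral_const_mul,
      integral_rpow_mul_exp_neg hγ0 (add_pos hs hr), inv_mul_cancel_left₀ this]

end Laplace

/-! ### Fourier transforms of the exponential process -/

section ExpFourier
open scoped RealInnerProductSpace ComplexConjugate

variable {H γ : ℝ}

/-- The Fourier transform `∫_0^t e^{iξr} e^{-y(t-r)} dr` of the exponential process. -/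
noncomputable def lagExp (t : ℝ≥0) (y ξ : ℝ) : ℂ :=
  (Complex.exp (Complex.I * ξ * t) - Complex.exp (-(t * y))) / (y + Complex.I * ξ)

lemma add_I_mul_ne_zero {y : ℝ} (hy : 0 < y) (ξ : ℝ) : (y + Complex.I * ξ : ℂ) ≠ 0 := by
  intro h
  have := congrArg Complex.re h
  simp at this
  exact hy.ne' this

lemma lagged_expProcess (t : ℝ≥0) (x y : ℝ) : lagged expProcess t x y =
    (Set.Ico (0 : ℝ) t).indicator (fun x => Real.exp (-((t - x) * y))) x := by
  by_cases h0 : 0 ≤ x <;> by_cases h1 : x < t <;> simp [lagged, expProcess, h0, h1]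

lemma integrable_lagged_expProcess (t : ℝ≥0) (y : ℝ) :
    Integrable fun x => lagged expProcess t x y := by
  simp_rw [lagged_expProcess]
  rw [integrable_indicator_iff measurableSet_Ico]
  exact ((by fun_prop : Continuous fun x : ℝ => Real.exp (-((t - x) * y))).integrableOn_Icc).mono_set
    Set.Ico_subset_Icc_self

lemma fourierInt_lagged_expProcess (t : ℝ≥0) {y : ℝ} (hy : 0 < y) (ξ : ℝ) :
    fourierInt (fun x => lagged expProcess t x y) ξ = lagExp t y ξ := by
  have e : ∀ x : ℝ, (lagged expProcess t x y : ℂ) * Complex.exp (Complex.I * ξ * x) =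
      (Set.Ico (0 : ℝ) t).indicator (fun x : ℝ => Complex.exp (-(t * y)) *
        Complex.exp ((y + Complex.I * ξ) * x)) x := by
    intro x
    rw [lagged_expProcess]
    by_cases hx : x ∈ Set.Ico (0 : ℝ) t
    · rw [Set.indicator_of_mem hx, Set.indicator_of_mem hx]
      push_cast
      rw [← Complex.exp_add, ← Complex.exp_add]
      congr 1
      ring
    · simp [Set.indicator_of_notMem hx]
  have hz := add_I_mul_ne_zero hy ξ
  rw [fourierInt]
  simp_rw [e]
  rw [integral_indicator measurableSet_Ico, integral_Ico_eq_integral_Ioc,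
    ← intervalIntegral.integral_of_le (NNReal.coe_nonneg t), intervalIntegral.integral_const_mul,
    integral_exp_mul_complex hz, lagExp, mul_div_assoc', mul_sub, ← Complex.exp_add,
    ← Complex.exp_add]
  congr 3
  · ring
  · simp

lemma inner_lagExp (s t : ℝ≥0) (y ξ : ℝ) : ⟪lagExp s y ξ, lagExp t y ξ⟫ =
    ((Real.cos (ξ * s) - Real.exp (-(s * y))) * (Real.cos (ξ * t) - Real.exp (-(t * y))) +
      Real.sin (ξ * s) * Real.sin (ξ * t)) / (y ^ 2 + ξ ^ 2) := by
  have e : ∀ t : ℝ≥0, Complex.exp (Complex.I * ξ * t) - Complex.exp (-(t * y)) =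
      ⟨Real.cos (ξ * t) - Real.exp (-(t * y)), Real.sin (ξ * t)⟩ := by
    intro t
    rw [show Complex.I * ξ * (t : ℝ) = ((ξ * t : ℝ) : ℂ) * Complex.I by push_cast; ring,
      Complex.exp_mul_I, ← Complex.ofReal_cos, ← Complex.ofReal_sin,
      show (-(((t : ℝ) : ℂ) * (y : ℂ))) = ((-(t * y) : ℝ) : ℂ) by push_cast; ring,
      ← Complex.ofReal_exp]
    apply Complex.ext <;> simp [-Complex.ofReal_cos, -Complex.ofReal_sin, -Complex.ofReal_exp]
  have en : Complex.normSq (y + Complex.I * ξ) = y ^ 2 + ξ ^ 2 := by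
    simp [Complex.normSq_apply]
    ring
  rw [lagExp, lagExp, e, e, Complex.inner, map_div₀, div_mul_div_comm, Complex.mul_conj,
    Complex.div_ofReal_re, en]
  congr 1
  simp
  ring

/-- The elementary sums for `n + 1` intervals, as a multiple of `lagExp`. The multiplier is
bounded and tends to `1` as `δ = t / (n + 1)` tends to `0`. -/
noncomputable def stepRatio (y ξ δ : ℝ) : ℂ :=
  (y + Complex.I * ξ) / (Complex.I * ξ) * ((Complex.exp (Complex.I * ξ * δ) - 1) /
    (Complex.exp ((y + Complex.I * ξ) * δ) - 1))

lemma exp_sub_one_ne_zero {y δ : ℝ} (hy : 0 < y) (hδ : 0 < δ) (ξ : ℝ) :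
    Complex.exp ((y + Complex.I * ξ) * δ) - 1 ≠ 0 := by
  intro h
  have h2 := congrArg norm (sub_eq_zero.1 h)
  rw [Complex.norm_exp] at h2
  simp at h2
  rcases h2 with h2 | h2
  · exact hy.ne' h2
  · exact hδ.ne' h2

/-- The sum over the `n + 1` intervals is a geometric series with ratio `e^{(y + iξ)δ}`, where
`δ = t / (n + 1)`. -/
lemma fourierInt_laggedStep {t : ℝ≥0} (ht : 0 < t) {y ξ : ℝ} (hy : 0 < y) (hξ : ξ ≠ 0) (n : ℕ) :
    fourierInt (fun x => (laggedStep expProcess t n).toFun x y) ξ =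
      lagExp t y ξ * stepRatio y ξ (t / (n + 1)) := by
  have hξ' : Complex.I * ξ ≠ 0 := mul_ne_zero Complex.I_ne_zero (by exact_mod_cast hξ)
  have ht' : (0 : ℝ) < t := ht
  have hn : (0 : ℝ) < n + 1 := by positivity
  have hδ : (0 : ℝ) < t / (n + 1) := by positivity
  have hw := exp_sub_one_ne_zero hy hδ ξ
  have hz := add_I_mul_ne_zero hy ξ
  set δ : ℝ := t / (n + 1) with hδe
  have hδt : (t : ℝ) = (n + 1) * δ := by rw [hδe]; field_simp
  clear_value δ
  have e : ∀ k : Fin (n + 1), (laggedStep expProcess t n).coef k y •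
      intervalFourier ((laggedStep expProcess t n).left k) ((laggedStep expProcess t n).right k) ξ =
      Complex.exp (-(t * y)) * ((Complex.exp (Complex.I * ξ * δ) - 1) / (Complex.I * ξ)) *
        Complex.exp ((y + Complex.I * ξ) * δ) ^ (k : ℕ) := by
    intro k
    have hk : (k : ℝ) * δ < t := by
      rw [hδt]
      have : ((k : ℕ) : ℝ) < n + 1 := by exact_mod_cast k.2
      gcongr
    have h1 : (laggedStep expProcess t n).coef k y = Real.exp (-((t - k * δ) * y)) := by
      simp [laggedStep, expProcess, ← hδe, hk]
    have h2 : (((laggedStep expProcess t n).left k : ℝ≥0) : ℝ) = k * δ := by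
      simp [laggedStep, hδe]
    have h3 : (((laggedStep expProcess t n).right k : ℝ≥0) : ℝ) = (k + 1) * δ := by
      simp [laggedStep, hδe]
    rw [h1, h2, h3, intervalFourier, integral_exp_mul_complex hξ', Complex.real_smul,
      ← Complex.exp_nat_mul, mul_div_assoc', mul_div_assoc', div_mul_eq_mul_div]
    congr 1
    push_cast
    rw [mul_sub, mul_sub, mul_one, ← Complex.exp_add, ← Complex.exp_add, ← Complex.exp_add,
      sub_mul (Complex.exp _), ← Complex.exp_add, ← Complex.exp_add]
    congr 2 <;> ring
  have hN : Complex.exp ((y + Complex.I * ξ) * δ) ^ (n + 1) =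
      Complex.exp ((y + Complex.I * ξ) * t) := by
    rw [← Complex.exp_nat_mul, hδt]
    congr 1
    push_cast
    ring
  rw [RandomStep.fourierInt_toFun]
  refine (Finset.sum_congr rfl fun k _ => e k).trans ?_
  change ∑ k : Fin (n + 1), _ = _
  rw [← Finset.mul_sum, Fin.sum_univ_eq_sum_range
    (fun k => Complex.exp ((y + Complex.I * ξ) * δ) ^ k),
    geom_sum_eq (sub_ne_zero.1 hw), hN, lagExp, stepRatio]
  have h4 : Complex.exp (Complex.I * ξ * t) = Complex.exp (-(t * y)) *
      Complex.exp ((y + Complex.I * ξ) * t) := by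
    rw [← Complex.exp_add]
    congr 1
    ring
  rw [h4]
  field_simp

/-- With `q = e^{iξδ}` and `w = e^{(y + iξ)δ}`, the claim is `|y + iξ| |q - 1| ≤ 2 |ξ| |w - 1|`. Both
`y |q - 1|` and `|ξ| |q - 1|` are at most `|ξ| |w - 1|`: the first because `|q - 1| ≤ |ξ| δ` and
`y δ ≤ |w| - 1`, the second because `w` is a multiple of `q` outside the unit circle. -/
lemma norm_stepRatio_le {y δ : ℝ} (hy : 0 < y) (hδ : 0 < δ) {ξ : ℝ} (hξ : ξ ≠ 0) :
    ‖stepRatio y ξ δ‖ ≤ 2 := by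
  have hw := norm_pos_iff.2 (exp_sub_one_ne_zero hy hδ ξ)
  have hξ0 : 0 < |ξ| := abs_pos.2 hξ
  set w := Complex.exp ((y + Complex.I * ξ) * δ) with hwe
  set q := Complex.exp (Complex.I * ξ * δ) with hqe
  have hwq : w = Real.exp (y * δ) * q := by
    rw [hwe, hqe, Complex.ofReal_exp, ← Complex.exp_add]
    congr 1
    push_cast
    ring
  have hq1 : ‖q‖ = 1 := norm_cexp_I_mul ξ δ
  have h1 : y * δ ≤ ‖w - 1‖ := by
    have hn : ‖w‖ = Real.exp (y * δ) := by
      rw [hwq, norm_mul, hq1, mul_one, Complex.norm_real, Real.norm_eq_abs, abs_of_pos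
        (Real.exp_pos _)]
    have := norm_sub_norm_le w 1
    rw [hn, norm_one] at this
    linarith [Real.add_one_le_exp (y * δ)]
  have h2 : ‖q - 1‖ ≤ ‖w - 1‖ := by
    have hR : 1 ≤ Real.exp (y * δ) := Real.one_le_exp (by positivity)
    have hns : q.re * q.re + q.im * q.im = 1 := by
      rw [← Complex.normSq_apply, Complex.normSq_eq_norm_sq, hq1, one_pow]
    rw [← sq_le_sq₀ (norm_nonneg _) (norm_nonneg _), Complex.sq_norm, Complex.sq_norm, hwq,
      Complex.normSq_apply, Complex.normSq_apply]
    simp only [Complex.sub_re, Complex.sub_im, Complex.re_ofReal_mul, Complex.im_ofReal_mul,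
      Complex.one_re, Complex.one_im, sub_zero]
    have hre : q.re ≤ 1 := by nlinarith [mul_self_nonneg q.im]
    nlinarith [mul_nonneg (sub_nonneg.2 hR) (sub_nonneg.2 hre), mul_self_nonneg
      (Real.exp (y * δ) - 1)]
  have h3 : ‖q - 1‖ ≤ |ξ| * δ := by
    have := Real.norm_exp_I_mul_ofReal_sub_one_le (x := ξ * δ)
    push_cast at this
    rw [← mul_assoc] at this
    rwa [Real.norm_eq_abs, abs_mul, abs_of_pos hδ] at this
  have h4 : ‖(y + Complex.I * ξ : ℂ)‖ ≤ y + |ξ| := by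
    refine (norm_add_le _ _).trans ?_
    simp [abs_of_pos hy]
  rw [stepRatio, norm_mul, norm_div, norm_div, norm_mul, Complex.norm_I, one_mul,
    Complex.norm_real, Real.norm_eq_abs, div_mul_div_comm, div_le_iff₀ (by positivity)]
  calc ‖(y + Complex.I * ξ : ℂ)‖ * ‖q - 1‖ ≤ (y + |ξ|) * ‖q - 1‖ := by gcongr
    _ = y * ‖q - 1‖ + |ξ| * ‖q - 1‖ := by ring
    _ ≤ y * (|ξ| * δ) + |ξ| * ‖w - 1‖ := by gcongr
    _ = |ξ| * (y * δ) + |ξ| * ‖w - 1‖ := by ring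
    _ ≤ |ξ| * ‖w - 1‖ + |ξ| * ‖w - 1‖ := by gcongr
    _ = 2 * (|ξ| * ‖w - 1‖) := by ring

lemma tendsto_exp_sub_one_div (c : ℂ) :
    Tendsto (fun δ : ℝ => (Complex.exp (c * δ) - 1) / δ) (𝓝[>] 0) (𝓝 c) := by
  have h : HasDerivAt (fun δ : ℝ => Complex.exp (c * δ)) c 0 := by
    have h1 : HasDerivAt (fun δ : ℝ => c * (δ : ℂ)) c 0 := by
      simpa using (Complex.ofRealCLM.hasDerivAt (x := 0)).const_mul c
    simpa using h1.cexp
  refine h.tendsto_slope_zero_right.congr fun δ => ?_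
  simp only [zero_add, Complex.ofReal_zero, mul_zero, Complex.exp_zero, Complex.real_smul]
  push_cast
  ring

lemma tendsto_stepRatio {y ξ : ℝ} (hy : 0 < y) (hξ : ξ ≠ 0) :
    Tendsto (stepRatio y ξ) (𝓝[>] 0) (𝓝 1) := by
  have hξ' : Complex.I * ξ ≠ 0 := mul_ne_zero Complex.I_ne_zero (by exact_mod_cast hξ)
  have hξ0 : (ξ : ℂ) ≠ 0 := by exact_mod_cast hξ
  have hz := add_I_mul_ne_zero hy ξ
  have h := ((tendsto_exp_sub_one_div (Complex.I * ξ)).div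
    (tendsto_exp_sub_one_div (y + Complex.I * ξ)) hz).const_mul
      ((y + Complex.I * ξ) / (Complex.I * ξ))
  rw [show (y + Complex.I * ξ) / (Complex.I * ξ) * ((Complex.I * ξ) / (y + Complex.I * ξ)) = 1 by
    field_simp] at h
  refine h.congr' ?_
  filter_upwards [self_mem_nhdsWithin] with δ hδ
  have hδ' : (δ : ℂ) ≠ 0 := by exact_mod_cast (Set.mem_Ioi.1 hδ).ne'
  rw [stepRatio, Pi.div_apply, div_div_div_cancel_right₀ hδ']

end ExpFourier

/-! ### The spectral change of variables `ξ = η y` -/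

section ChangeOfVariables
open scoped RealInnerProductSpace

variable {H γ : ℝ}

/-- The substitution `ξ = η y` in `∫ f dμ_H` for fixed `y > 0` and even `f`. The integral over `ℝ`
is twice that over `(0, ∞)`, which accounts for the `2` in `weightConst`. -/
lemma spectral_fibre (hγ0 : 0 < γ) {y : ℝ} (hy : 0 < y) {f g : ℝ → ℝ} (he : ∀ ξ, f (-ξ) = f ξ)
    (hg : ∀ η, 0 < η → g η =
      weightConst H γ * (η ^ (1 - 2 * H) * y ^ (1 - (2 * H - γ)) * f (η * y))) :
    (IntegrableOn (fun η => η ^ (1 - 2 * H) * f (η * y)) (Set.Ioi 0) →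
      Integrable f (specMeasure H)) ∧
    y ^ (γ - 1) / Real.Gamma γ * ∫ ξ, f ξ ∂specMeasure H = ∫ η in Set.Ioi (0 : ℝ), g η := by
  have e : ∀ η ∈ Set.Ioi (0 : ℝ), (y * η) ^ (1 - 2 * H) * f (y * η) =
      y ^ (1 - 2 * H) * (η ^ (1 - 2 * H) * f (η * y)) := by
    intro η hη
    rw [Real.mul_rpow hy.le (le_of_lt hη), mul_comm y η]
    ring
  constructor
  · intro h
    refine integrable_specMeasure_even he ?_
    have h2 := integrableOn_Ioi_comp_mul_left_iff (fun ξ => ξ ^ (1 - 2 * H) * f ξ) 0 hy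
    rw [mul_zero] at h2
    exact h2.1 (IntegrableOn.congr_fun (h.const_mul _) (fun η hη => (e η hη).symm)
      measurableSet_Ioi)
  · have h2 := integral_comp_mul_left_Ioi (fun ξ => ξ ^ (1 - 2 * H) * f ξ) 0 hy
    rw [mul_zero, setIntegral_congr_fun measurableSet_Ioi e, integral_const_mul, smul_eq_mul,
      eq_inv_mul_iff_mul_eq₀ hy.ne'] at h2
    have hG := (Real.Gamma_pos_of_pos hγ0).ne'
    have e2 : ∀ η ∈ Set.Ioi (0 : ℝ), g η = weightConst H γ * y ^ (1 - (2 * H - γ)) *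
        (η ^ (1 - 2 * H) * f (η * y)) := fun η hη => by
      rw [hg η hη]
      ring
    have hp : y ^ (1 - (2 * H - γ)) = y * y ^ (1 - 2 * H) * y ^ (γ - 1) := by
      rw [show 1 - (2 * H - γ) = 1 + (1 - 2 * H) + (γ - 1) by ring, Real.rpow_add hy,
        Real.rpow_add hy, Real.rpow_one]
    rw [integral_specMeasure_even he, ← h2, setIntegral_congr_fun measurableSet_Ioi e2,
      integral_const_mul, weightConst, hp]
    field_simp

/-- The change of variables `ξ = η y`, from `gammaWeight γ ⊗ specMeasure H` to the quadrant. -/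
lemma integral_gammaWeight_prod_specMeasure (hH0 : 0 < H) (hH1 : H < 1) (hγ0 : 0 < γ)
    {F h : ℝ × ℝ → ℝ} (hm : Measurable F) (he : ∀ y ξ, F (y, -ξ) = F (y, ξ))
    (hh : Integrable h quadrant)
    (hF : ∀ η y, 0 < η → 0 < y → h (η, y) =
      weightConst H γ * (η ^ (1 - 2 * H) * y ^ (1 - (2 * H - γ)) * F (y, η * y))) :
    Integrable F ((gammaWeight γ).prod (specMeasure H)) ∧
      ∫ p, F p ∂((gammaWeight γ).prod (specMeasure H)) = ∫ p, h p ∂quadrant := by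
  have hc := weightConst_pos hH0 hH1 hγ0
  rw [quadrant_eq_prod] at hh ⊢
  have key : ∀ y, 0 < y → y ^ (γ - 1) / Real.Gamma γ * ∫ ξ, F (y, ξ) ∂specMeasure H =
      ∫ η in Set.Ioi (0 : ℝ), h (η, y) := fun y hy =>
    (spectral_fibre hγ0 hy (he y) fun η hη => hF η y hη hy).2
  have keyn : ∀ y, 0 < y → y ^ (γ - 1) / Real.Gamma γ * ∫ ξ, ‖F (y, ξ)‖ ∂specMeasure H =
      ∫ η in Set.Ioi (0 : ℝ), ‖h (η, y)‖ := fun y hy =>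
    (spectral_fibre hγ0 hy (f := fun ξ => ‖F (y, ξ)‖) (g := fun η => ‖h (η, y)‖)
      (fun ξ => by rw [he]) fun η hη => by
        rw [hF η y hη hy, norm_mul, norm_mul, norm_mul, Real.norm_of_nonneg hc.le,
          Real.norm_of_nonneg (Real.rpow_nonneg hη.le _),
          Real.norm_of_nonneg (Real.rpow_nonneg hy.le _)]).2
  have hi : Integrable F ((gammaWeight γ).prod (specMeasure H)) := by
    rw [integrable_prod_iff hm.aestronglyMeasurable]
    constructor
    · have h1 : ∀ᵐ y ∂gammaWeight γ, Integrable (fun η => h (η, y)) halfLine :=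
        (withDensity_absolutelyContinuous _ _).ae_le hh.prod_left_ae
      filter_upwards [h1, ae_gammaWeight_pos] with y h1 hy
      refine (spectral_fibre hγ0 hy (he y) fun η hη => hF η y hη hy).1 ?_
      have hyp := Real.rpow_pos_of_pos hy (1 - (2 * H - γ))
      refine IntegrableOn.congr_fun (h1.const_mul
        (weightConst H γ * y ^ (1 - (2 * H - γ)))⁻¹) (fun η hη => ?_) measurableSet_Ioi
      rw [hF η y hη hy]
      field_simp
    · rw [integrable_gammaWeight_iff hγ0]
      exact IntegrableOn.congr_fun hh.integral_norm_prod_right (fun y hy => (keyn y hy).symm)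
        measurableSet_Ioi
  refine ⟨hi, ?_⟩
  rw [integral_prod _ hi, integral_gammaWeight hγ0, integral_prod_symm _ hh]
  exact setIntegral_congr_fun measurableSet_Ioi fun y hy => key y hy

lemma sheetCos_add_sheetExp (t : ℝ≥0) (p : ℝ × ℝ) : sheetCos H γ t p + sheetExp H γ t p =
    sheetWeight H γ p * (Real.cos (p.1 * p.2 * t) - Real.exp (-(p.2 * t))) := by
  rw [sheetCos, sheetExp]
  ring

lemma measurable_inner_lagExp (s t : ℝ≥0) :
    Measurable fun p : ℝ × ℝ => ⟪lagExp s p.1 p.2, lagExp t p.1 p.2⟫ := by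
  simp_rw [inner_lagExp]
  fun_prop

/-- The inner products of the Fourier transforms of the exponential process are those of the
integrands of `U + Y` and `V`. -/
lemma integral_inner_lagExp (hH0 : 0 < H) (hH1 : H < 1) (hγ0 : 0 < γ) (hγ1 : γ < 2 * H)
    (s t : ℝ≥0) :
    Integrable (fun p : ℝ × ℝ => ⟪lagExp s p.1 p.2, lagExp t p.1 p.2⟫)
      ((gammaWeight γ).prod (specMeasure H)) ∧
    ∫ p : ℝ × ℝ, ⟪lagExp s p.1 p.2, lagExp t p.1 p.2⟫ ∂((gammaWeight γ).prod (specMeasure H)) =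
      ∫ p, ((sheetCos H γ s p + sheetExp H γ s p) * (sheetCos H γ t p + sheetExp H γ t p) +
        sheetSin H γ s p * sheetSin H γ t p) ∂quadrant := by
  have hC := memLp_sheetCos hH0 hH1 hγ0 hγ1
  have hS := memLp_sheetSin hH0 hH1 hγ0 hγ1
  have hE := memLp_sheetExp hH0 hH1 hγ0 hγ1
  refine integral_gammaWeight_prod_specMeasure hH0 hH1 hγ0 (measurable_inner_lagExp s t)
    (fun y ξ => by rw [inner_lagExp, inner_lagExp]; simp) ?_ fun η y hη hy => ?_
  · exact (((hC s).add (hE s)).integrable_mul ((hC t).add (hE t))).add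
      ((hS s).integrable_mul (hS t))
  · have h := sheetWeight_mul_self (H := H) (p := (η, y)) hγ0 hη hy
    have hp : y ^ (1 - (2 * H - γ)) = y ^ (-(2 * H - γ) - 1) * y ^ 2 := by
      rw [← Real.rpow_two, ← Real.rpow_add hy]
      congr 1
      ring
    rw [inner_lagExp, sheetCos_add_sheetExp, sheetCos_add_sheetExp, sheetSin, sheetSin]
    calc _ = (sheetWeight H γ (η, y) * sheetWeight H γ (η, y)) *
        ((Real.cos (η * y * s) - Real.exp (-(s * y))) *
          (Real.cos (η * y * t) - Real.exp (-(t * y))) +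
          Real.sin (η * y * s) * Real.sin (η * y * t)) := by
          rw [mul_comm y (s : ℝ), mul_comm y (t : ℝ)]
          ring
      _ = _ := by
        rw [h, hp]
        simp only
        have h1 : y ^ 2 + (η * y) ^ 2 = y ^ 2 * (1 + η ^ 2) := by ring
        rw [h1]
        have h2 : (1 + η ^ 2) ≠ 0 := by positivity
        field_simp

variable {Ω : Type*} [MeasurableSpace Ω] {P : Measure Ω} {Q : ℝ → Ω → ℝ}

lemma ae_prod_gammaWeight_specMeasure :
    ∀ᵐ p ∂(gammaWeight γ).prod (specMeasure H), 0 < p.1 ∧ p.2 ≠ 0 := by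
  have h1 : ∀ᵐ p ∂(gammaWeight γ).prod (specMeasure H), 0 < p.1 :=
    Measure.quasiMeasurePreserving_fst.ae ae_gammaWeight_pos
  have h2 : ∀ᵐ p ∂(gammaWeight γ).prod (specMeasure H), p.2 ≠ 0 :=
    Measure.quasiMeasurePreserving_snd.ae ae_specMeasure_ne_zero
  filter_upwards [h1, h2] with p h1 h2 using ⟨h1, h2⟩

lemma lintegral_lagExp_ne_top (hH0 : 0 < H) (hH1 : H < 1) (hγ0 : 0 < γ) (hγ1 : γ < 2 * H)
    (t : ℝ≥0) : ∫⁻ p, ‖fourierInt (fun x => lagged expProcess t x p.1) p.2‖ₑ ^ 2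
      ∂((gammaWeight γ).prod (specMeasure H)) ≠ ∞ := by
  have h := (integral_inner_lagExp hH0 hH1 hγ0 hγ1 t t).1.lintegral_lt_top.ne
  convert h using 1
  refine lintegral_congr_ae ?_
  filter_upwards [ae_prod_gammaWeight_specMeasure] with p hp
  rw [fourierInt_lagged_expProcess t hp.1, real_inner_self_eq_norm_sq,
    ENNReal.ofReal_pow (norm_nonneg _), ofReal_norm]

/-- The Fourier transform of `r ↦ 1_{[0, t)}(r) Q_{t-r}` is square integrable. -/
lemma IsLaplaceProcess.memLp_fourierInt_lagged [SFinite P] (hH0 : 0 < H) (hH1 : H < 1)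
    (hγ0 : 0 < γ) (hγ1 : γ < 2 * H) (hQ : IsLaplaceProcess γ Q P) (t : ℝ≥0) :
    MemLp (fun p : Ω × ℝ => fourierInt (fun x => lagged Q t x p.1) p.2) 2
      (P.prod (specMeasure H)) := by
  have hE := isLaplaceProcess_expProcess hγ0
  have hu := hQ.meanSqIntegrable_lagged (by linarith) t
  refine ⟨hu.measurable_fourierInt.aestronglyMeasurable, ?_⟩
  rw [eLpNorm_two_eq_sqrt, hu.lintegral_prod_congr _
    (hE.meanSqIntegrable_lagged (by linarith) t) fun r s =>
      integral_mul_eq_of_mem_jointSpan hQ hE (lagged_mem_jointSpan Q expProcess t r)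
        (lagged_mem_jointSpan Q expProcess t s)]
  exact ENNReal.rpow_lt_top_of_nonneg (by norm_num)
    (lintegral_lagExp_ne_top hH0 hH1 hγ0 hγ1 t)

lemma integrable_inner_of_memLp {E : Type*} [NormedAddCommGroup E] [InnerProductSpace ℝ E]
    {f g : Ω → E} (hf : MemLp f 2 P) (hg : MemLp g 2 P) : Integrable (fun x => ⟪f x, g x⟫) P := by
  refine (L2.integrable_inner (𝕜 := ℝ) (hf.toLp f) (hg.toLp g)).congr ?_
  filter_upwards [hf.coeFn_toLp, hg.coeFn_toLp] with x h1 h2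
  rw [h1, h2]

/-- The inner products of the Fourier transforms of `r ↦ 1_{[0, t)}(r) Q_{t-r}`. -/
lemma IsLaplaceProcess.integral_inner_fourierInt_lagged [SFinite P] (hH0 : 0 < H) (hH1 : H < 1)
    (hγ0 : 0 < γ) (hγ1 : γ < 2 * H) (hQ : IsLaplaceProcess γ Q P) (s t : ℝ≥0) :
    ∫ p : Ω × ℝ, ⟪fourierInt (fun x => lagged Q s x p.1) p.2,
      fourierInt (fun x => lagged Q t x p.1) p.2⟫ ∂(P.prod (specMeasure H)) =
    ∫ p, ((sheetCos H γ s p + sheetExp H γ s p) * (sheetCos H γ t p + sheetExp H γ t p) +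
        sheetSin H γ s p * sheetSin H γ t p) ∂quadrant := by
  have hE := isLaplaceProcess_expProcess hγ0
  have i : ∀ {Ω' : Type _} [MeasurableSpace Ω'] {ρ : Measure Ω'} [SFinite ρ] {Q' : ℝ → Ω' → ℝ},
      IsLaplaceProcess γ Q' ρ → Integrable (fun p : Ω' × ℝ =>
        ⟪fourierInt (fun x => lagged Q' s x p.1) p.2, fourierInt (fun x => lagged Q' t x p.1) p.2⟫)
        (ρ.prod (specMeasure H)) := fun hQ' =>
    integrable_inner_of_memLp (hQ'.memLp_fourierInt_lagged hH0 hH1 hγ0 hγ1 s)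
      (hQ'.memLp_fourierInt_lagged hH0 hH1 hγ0 hγ1 t)
  rw [integral_prod_symm _ (i hQ), ← (integral_inner_lagExp hH0 hH1 hγ0 hγ1 s t).2]
  have e : ∀ ξ, ∫ ω, ⟪fourierInt (fun x => lagged Q s x ω) ξ,
      fourierInt (fun x => lagged Q t x ω) ξ⟫ ∂P =
      ∫ y, ⟪fourierInt (fun x => lagged expProcess s x y) ξ,
      fourierInt (fun x => lagged expProcess t x y) ξ⟫ ∂gammaWeight γ := fun ξ =>
    (hQ.meanSqIntegrable_lagged (by linarith) s).integral_inner_congr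
      (hQ.meanSqIntegrable_lagged (by linarith) t)
      (hE.meanSqIntegrable_lagged (by linarith) s) (hE.meanSqIntegrable_lagged (by linarith) t)
      (fun r r' => integral_mul_eq_of_mem_jointSpan hQ hE (lagged_mem_jointSpan Q expProcess s r)
        (lagged_mem_jointSpan Q expProcess t r')) ξ
  simp_rw [e]
  have i2 : Integrable (fun p : ℝ × ℝ =>
        ⟪fourierInt (fun x => lagged expProcess s x p.1) p.2,
          fourierInt (fun x => lagged expProcess t x p.1) p.2⟫)
        ((gammaWeight γ).prod (specMeasure H)) :=
    integrable_inner_of_memLp (hE.memLp_fourierInt_lagged hH0 hH1 hγ0 hγ1 s)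
      (hE.memLp_fourierInt_lagged hH0 hH1 hγ0 hγ1 t)
  rw [← integral_prod_symm _ i2]
  refine integral_congr_ae ?_
  filter_upwards [ae_prod_gammaWeight_specMeasure] with p hp
  rw [fourierInt_lagged_expProcess s hp.1, fourierInt_lagged_expProcess t hp.1]

lemma enorm_stepRatio_sub_one_sq_le {y δ : ℝ} (hy : 0 < y) (hδ : 0 < δ) {ξ : ℝ} (hξ : ξ ≠ 0) :
    ‖stepRatio y ξ δ - 1‖ₑ ^ 2 ≤ 9 := by
  have h3 : ‖stepRatio y ξ δ - 1‖ ≤ 3 := (norm_sub_le _ _).trans (by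
    rw [norm_one]
    linarith [norm_stepRatio_le hy hδ hξ])
  rw [← ofReal_norm, ← ENNReal.ofReal_pow (norm_nonneg _)]
  refine (ENNReal.ofReal_le_ofReal (pow_le_pow_left₀ (norm_nonneg _) h3 2)).trans ?_
  norm_num

lemma fourierInt_laggedStep_sub {t : ℝ≥0} (ht : 0 < t) {y ξ : ℝ} (hy : 0 < y) (hξ : ξ ≠ 0)
    (n : ℕ) :
    fourierInt (fun x => (laggedStep expProcess t n).toFun x y - lagged expProcess t x y) ξ =
      lagExp t y ξ * (stepRatio y ξ (t / (n + 1)) - 1) := by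
  rw [fourierInt_sub ((laggedStep expProcess t n).integrable_toFun y)
    (integrable_lagged_expProcess t y), fourierInt_laggedStep ht hy hξ,
    fourierInt_lagged_expProcess t hy]
  ring

lemma tendsto_stepRatio_atTop {t : ℝ≥0} (ht : 0 < t) {y ξ : ℝ} (hy : 0 < y) (hξ : ξ ≠ 0) :
    Tendsto (fun n : ℕ => ‖lagExp t y ξ * (stepRatio y ξ (t / (n + 1)) - 1)‖ₑ ^ 2) atTop
      (𝓝 0) := by
  have ht' : (0 : ℝ) < t := ht
  have h1 : Tendsto (fun n : ℕ => (t : ℝ) / (n + 1)) atTop (𝓝[>] 0) := by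
    refine tendsto_nhdsWithin_iff.2 ⟨?_, Eventually.of_forall fun n => ?_⟩
    · simpa [div_eq_mul_inv] using
        (tendsto_one_div_add_atTop_nhds_zero_nat (𝕜 := ℝ)).const_mul (t : ℝ)
    · exact Set.mem_Ioi.2 (by positivity)
  have h2 := (((tendsto_stepRatio hy hξ).comp h1).sub_const 1).const_mul (lagExp t y ξ)
  rw [sub_self, mul_zero] at h2
  have h3 := h2.enorm
  rw [enorm_zero] at h3
  have h4 := ((ENNReal.continuous_pow 2).tendsto 0).comp h3
  rw [zero_pow two_ne_zero] at h4
  exact h4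

/-- The step functions `laggedStep` converge in the norm of the fBm, for the exponential
process. -/
lemma tendsto_lintegral_laggedStep_expProcess (hH0 : 0 < H) (hH1 : H < 1) (hγ0 : 0 < γ)
    (hγ1 : γ < 2 * H) {t : ℝ≥0} (ht : 0 < t) :
    Tendsto (fun n => ∫⁻ p, ‖fourierInt (fun x => (laggedStep expProcess t n).toFun x p.1 -
      lagged expProcess t x p.1) p.2‖ₑ ^ 2 ∂((gammaWeight γ).prod (specMeasure H))) atTop
      (𝓝 0) := by
  have hE := isLaplaceProcess_expProcess hγ0
  have ht' : (0 : ℝ) < t := ht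
  have hm : ∀ n, Measurable fun p : ℝ × ℝ => ‖fourierInt (fun x =>
      (laggedStep expProcess t n).toFun x p.1 - lagged expProcess t x p.1) p.2‖ₑ ^ 2 := fun n =>
    ((hE.meanSqIntegrable_laggedStep t n).sub
      (hE.meanSqIntegrable_lagged (by linarith) t)).measurable_fourierInt.enorm.pow_const 2
  have h0 : ∫⁻ _ : ℝ × ℝ, 0 ∂((gammaWeight γ).prod (specMeasure H)) = 0 := lintegral_zero
  refine Eq.subst (motive := fun c => Tendsto _ atTop (𝓝 c)) h0 <|
    tendsto_lintegral_of_dominated_convergence (fun p : ℝ × ℝ => ‖fourierInt (fun x => lagged expProcess t x p.1) p.2‖ₑ ^ 2 * 9) hm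
    (fun n => ?_) ?_ ?_
  · filter_upwards [ae_prod_gammaWeight_specMeasure] with p hp
    have hδ : 0 < (t : ℝ) / (n + 1) := by positivity
    rw [fourierInt_laggedStep_sub ht hp.1 hp.2, fourierInt_lagged_expProcess t hp.1, enorm_mul,
      mul_pow]
    exact mul_le_mul_right (enorm_stepRatio_sub_one_sq_le hp.1 hδ hp.2) _
  · rw [lintegral_mul_const' _ _ (by norm_num)]
    exact ENNReal.mul_ne_top (lintegral_lagExp_ne_top hH0 hH1 hγ0 hγ1 t) (by norm_num)
  · filter_upwards [ae_prod_gammaWeight_specMeasure] with p hp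
    refine (tendsto_stepRatio_atTop ht hp.1 hp.2).congr fun n => ?_
    rw [fourierInt_laggedStep_sub ht hp.1 hp.2]

/-- The step functions `laggedStep` converge in the norm of the fBm. -/
lemma IsLaplaceProcess.tendsto_fbmNormSq [SFinite P] (hH0 : 0 < H) (hH1 : H < 1) (hγ0 : 0 < γ)
    (hγ1 : γ < 2 * H) (hQ : IsLaplaceProcess γ Q P) {t : ℝ≥0} (ht : 0 < t) :
    Tendsto (fun n => ∫⁻ ω, fbmNormSq H fun x => (laggedStep Q t n).toFun x ω - lagged Q t x ω ∂P)
      atTop (𝓝 0) := by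
  have hE := isLaplaceProcess_expProcess hγ0
  refine (tendsto_lintegral_laggedStep_expProcess hH0 hH1 hγ0 hγ1 ht).congr fun n => ?_
  have hu := (hQ.meanSqIntegrable_laggedStep t n).sub
    (hQ.meanSqIntegrable_lagged (by linarith) t)
  have hu' := (hE.meanSqIntegrable_laggedStep t n).sub
    (hE.meanSqIntegrable_lagged (by linarith) t)
  have hmem : ∀ r, (fun ω => (laggedStep Q t n).toFun r ω - lagged Q t r ω,
      fun y => (laggedStep expProcess t n).toFun r y - lagged expProcess t r y) ∈
      jointSpan Q expProcess := fun r =>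
    Submodule.sub_mem _ (laggedStep_mem_jointSpan Q expProcess t n r)
      (lagged_mem_jointSpan Q expProcess t r)
  have h1 := hu.lintegral_prod_congr (specMeasure H) hu' fun r s =>
    integral_mul_eq_of_mem_jointSpan hQ hE (hmem r) (hmem s)
  rw [← h1]
  have h2 := lintegral_prod _ (hu.measurable_fourierInt.enorm.pow_const 2).aemeasurable
    (μ := P) (ν := specMeasure H)
  rw [h2]
  simp_rw [fbmNormSq_eq_lintegral]

end ChangeOfVariables

/-! ### The stochastic convolution -/

section Convolution
open scoped RealInnerProductSpace

lemma measurable_comap_zeroExtend {Ω : Type*} (Z : Set.Ioi (0 : ℝ) → Ω → ℝ) (s : ℝ) :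
    Measurable[MeasurableSpace.comap (fun ω s => Z s ω) MeasurableSpace.pi] (zeroExtend Z s) := by
  let : MeasurableSpace Ω := MeasurableSpace.comap (fun ω s => Z s ω) MeasurableSpace.pi
  rcases le_or_gt s 0 with h | h
  · rw [zeroExtend_of_nonpos Z h]
    exact measurable_zero
  · rw [zeroExtend_of_pos Z h]
    exact (measurable_pi_apply (X := fun _ => ℝ) (⟨s, h⟩ : Set.Ioi (0 : ℝ))).comp
      (comap_measurable fun ω s => Z s ω)

lemma isFBMIntegral_zero {Ω : Type*} (𝓖 : MeasurableSpace Ω) [MeasurableSpace Ω] (H : ℝ)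
    (B : ℝ≥0 → Ω → ℝ) (P : Measure Ω) : IsFBMIntegral 𝓖 H B (fun _ _ => 0) (fun _ => 0) P := by
  refine ⟨by simp, MemLp.zero',
    fun _ => ⟨0, Fin.elim0, Fin.elim0, fun i => i.elim0, Fin.elim0⟩,
    fun _ i => i.elim0, ?_, ?_⟩
  · simp [fbmNormSq, RandomStep.toFun, fourierInt]
  · simp [RandomStep.integral]

variable {H γ : ℝ} {Ω : Type*} [MeasurableSpace Ω] {P : Measure Ω}
  {B : ℝ≥0 → Ω → ℝ} {Z : Set.Ioi (0 : ℝ) → Ω → ℝ}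

/-- For `t > 0` the integral is the limit of the elementary integrals of the left-point step
functions `laggedStep`; for `t = 0` the integrand vanishes. -/
lemma exists_isConvolution [IsProbabilityMeasure P] (hH0 : 0 < H) (hH1 : H < 1) (hγ0 : 0 < γ)
    (hγ1 : γ < 2 * H) (hB : IsFBM H B P)
    (hZ : IsCenteredGaussian Z (fun s t => ((s : ℝ) + (t : ℝ)) ^ (-γ)) P)
    (hZmeas : Measurable fun p : Set.Ioi (0 : ℝ) × Ω => Z p.1 p.2)
    (hindep : IndepFun (fun ω s => Z s ω) (fun ω t => B t ω) P) (t : ℝ≥0) :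
    ∃ J : Ω → ℝ, IsConvolution H B Z t J P := by
  rcases eq_or_ne t 0 with rfl | ht
  · have e : shiftedIntegrand Z 0 = fun _ _ => 0 := by
      ext r ω
      have : ¬ (0 ≤ r ∧ r < ((0 : ℝ≥0) : ℝ)) := fun h => absurd h.2 (not_lt.2 h.1)
      simp only [shiftedIntegrand, this, dif_neg, not_false_eq_true]
    refine ⟨fun _ => 0, ?_⟩
    rw [IsConvolution, e]
    exact isFBMIntegral_zero _ H B P
  · have hQ := isLaplaceProcess_zeroExtend hZ hZmeas
    simp_rw [IsConvolution, shiftedIntegrand_eq_lagged]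
    exact exists_isFBMIntegral hH0 hH1 ((IndepFun_iff_Indep _ _ _).1 hindep) hB
      (φ := fun n => laggedStep (zeroExtend Z) t n)
      (fun n k => ⟨measurable_comap_zeroExtend Z _, hQ.memLp _⟩)
      (hQ.meanSqIntegrable_lagged (by linarith) t).ae_integrable
      (hQ.memLp_fourierInt_lagged hH0 hH1 hγ0 hγ1 t)
      (hQ.tendsto_fbmNormSq hH0 hH1 hγ0 hγ1 (pos_iff_ne_zero.2 ht))

/-- The covariance of the stochastic convolution, in terms of the integrands on the quadrant. -/
lemma IsConvolution.integral_mul [IsProbabilityMeasure P] (hH0 : 0 < H) (hH1 : H < 1)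
    (hγ0 : 0 < γ) (hγ1 : γ < 2 * H) (hB : IsFBM H B P)
    (hZ : IsCenteredGaussian Z (fun s t => ((s : ℝ) + (t : ℝ)) ^ (-γ)) P)
    (hZmeas : Measurable fun p : Set.Ioi (0 : ℝ) × Ω => Z p.1 p.2)
    (hindep : IndepFun (fun ω s => Z s ω) (fun ω t => B t ω) P) {s t : ℝ≥0} {I J : Ω → ℝ}
    (hI : IsConvolution H B Z s I P) (hJ : IsConvolution H B Z t J P) :
    ∫ ω, I ω * J ω ∂P =
      ∫ p, ((sheetCos H γ s p + sheetExp H γ s p) * (sheetCos H γ t p + sheetExp H γ t p) +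
        sheetSin H γ s p * sheetSin H γ t p) ∂quadrant := by
  have hQ := isLaplaceProcess_zeroExtend hZ hZmeas
  rw [IsConvolution, shiftedIntegrand_eq_lagged] at hI hJ
  rw [IsFBMIntegral.integral_mul hH0 hH1 ((IndepFun_iff_Indep _ _ _).1 hindep) hB hI hJ
    (hQ.memLp_fourierInt_lagged hH0 hH1 hγ0 hγ1 s) (hQ.memLp_fourierInt_lagged hH0 hH1 hγ0 hγ1 t),
    hQ.integral_inner_fourierInt_lagged hH0 hH1 hγ0 hγ1]

end Convolution

/-! ### The decomposition from an isonormal pair -/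

section Decomposition
open scoped RealInnerProductSpace

variable {H γ : ℝ} {Ω Ω₁ S T : Type*} [MeasurableSpace Ω] [MeasurableSpace Ω₁] {P : Measure Ω}
  {P₁ : Measure Ω₁}

lemma isGaussianProcess_of_forall_eq_sum {X : T → Ω → ℝ} {Y : S → Ω → ℝ}
    (hX : IsGaussianProcess X P)
    (h : ∀ s, ∃ (n : ℕ) (c : Fin n → ℝ) (τ : Fin n → T), ∀ ω, Y s ω = ∑ i, c i * X (τ i) ω) :
    IsGaussianProcess Y P := by
  classical
  refine hX.of_isGaussianProcess fun s => ?_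
  obtain ⟨n, c, τ, hs⟩ := h s
  refine ⟨Finset.univ.image τ, ∑ i, c i • ContinuousLinearMap.proj (R := ℝ)
    (φ := fun _ : Finset.univ.image τ => ℝ)
    ⟨τ i, Finset.mem_image_of_mem _ (Finset.mem_univ i)⟩, fun ω => ?_⟩
  rw [hs]
  simp

lemma integral_mul_eq_inner {f g : Ω → ℝ} {F G : Lp ℝ 2 P} (hf : F =ᵐ[P] f) (hg : G =ᵐ[P] g) :
    ∫ ω, f ω * g ω ∂P = ⟪F, G⟫ := by
  rw [L2.inner_def]
  refine integral_congr_ae ?_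
  filter_upwards [hf, hg] with ω h1 h2
  simp [h1, h2, mul_comm]

variable [IsProbabilityMeasure P]

/-- Two independent isonormal processes `j true` and `j false` on `L²((0, ∞)²)` realize the
decomposition of `X`: `U` and `Y` are values of the first, `V` those of the second. Independence is
only used as absence of correlation. The covariance of `X` is that of `U + V + Y` since
`sheetCos + sheetExp` is the integrand of `U + Y`. -/
lemma isDecomposition_of_isonormal (hH0 : 0 < H) (hH1 : H < 1) (hγ0 : 0 < γ) (hγ1 : γ < 2 * H)
    (hC : ∀ t, MemLp (sheetCos H γ t) 2 quadrant) (hS : ∀ t, MemLp (sheetSin H γ t) 2 quadrant)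
    (hE : ∀ t, MemLp (sheetExp H γ t) 2 quadrant) {X : ℝ≥0 → Ω₁ → ℝ}
    (hX : IsCenteredGaussian X (fun s t =>
      ∫ p, ((sheetCos H γ s p + sheetExp H γ s p) * (sheetCos H γ t p + sheetExp H γ t p) +
        sheetSin H γ s p * sheetSin H γ t p) ∂quadrant) P₁)
    {j : Bool → Lp ℝ 2 quadrant → Lp ℝ 2 P}
    (hg : IsGaussianProcess (fun p : Bool × Lp ℝ 2 quadrant => ⇑(j p.1 p.2)) P)
    (h0 : ∀ i x, ∫ ω, j i x ω ∂P = 0)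
    (h1 : ∀ i x y, ∫ ω, j i x ω * j i y ω ∂P = ⟪x, y⟫)
    (h2 : ∀ i k, i ≠ k → ∀ x y, ∫ ω, j i x ω * j k y ω ∂P = 0) :
    IsDecomposition H γ X P₁
      (fun t ω => (√(kappa H γ))⁻¹ * (j true ((hC t).toLp _) ω + j false ((hS t).toLp _) ω))
      (fun t => j true ((hE t).toLp _)) P := by
  have hκ := kappa_pos hH0 hH1 hγ0 hγ1
  have hm : ∀ i x, Measurable (j i x) := fun i x => (Lp.stronglyMeasurable _).measurable
  have hi : ∀ i x, Integrable (j i x) P := fun i x => (Lp.memLp _).integrable one_le_two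
  have i1 : ∀ i x y, ⟪j i x, j i y⟫ = ⟪x, y⟫ := fun i x y => by
    rw [← h1 i, integral_mul_eq_inner (ae_eq_refl _) (ae_eq_refl _)]
  have i2 : ∀ i k, i ≠ k → ∀ x y, ⟪j i x, j k y⟫ = 0 := fun i k hik x y => by
    rw [← h2 i k hik x y, integral_mul_eq_inner (ae_eq_refl _) (ae_eq_refl _)]
  have i3 := i2 true false (by simp)
  have i4 := i2 false true (by simp)
  have hUV : ∀ x y, ⇑(j true x + j false y) =ᵐ[P] fun ω => j true x ω + j false y ω :=
    fun x y => Lp.coeFn_add _ _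
  have toLp_inner : ∀ {f g : ℝ × ℝ → ℝ} (hf : MemLp f 2 quadrant) (hg : MemLp g 2 quadrant),
      ⟪hf.toLp f, hg.toLp g⟫ = ∫ p, f p * g p ∂quadrant := fun hf hg =>
    (integral_mul_eq_inner hf.coeFn_toLp hg.coeFn_toLp).symm
  have e : ∀ t ω, √(kappa H γ) * ((√(kappa H γ))⁻¹ *
      (j true ((hC t).toLp _) ω + j false ((hS t).toLp _) ω)) + j true ((hE t).toLp _) ω =
      j true ((hC t).toLp _) ω + j false ((hS t).toLp _) ω + j true ((hE t).toLp _) ω :=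
    fun t ω => by rw [mul_inv_cancel_left₀ (Real.sqrt_pos.2 hκ).ne']
  refine ⟨⟨fun t => ?_, ?_, fun t => ?_, fun s t => ?_⟩, ⟨fun t => hm _ _, ?_, fun t => h0 _ _,
    fun s t => ?_⟩, ?_, ?_⟩
  · have := hm true ((hC t).toLp _)
    have := hm false ((hS t).toLp _)
    fun_prop
  · refine isGaussianProcess_of_forall_eq_sum hg fun t => ⟨2, fun _ => (√(kappa H γ))⁻¹,
      ![(true, (hC t).toLp _), (false, (hS t).toLp _)], fun ω => ?_⟩
    simp [Fin.sum_univ_two, mul_add]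
  · rw [integral_const_mul, integral_add (hi _ _) (hi _ _), h0, h0]
    simp
  · have e1 : ∀ ω, (√(kappa H γ))⁻¹ * (j true ((hC s).toLp _) ω + j false ((hS s).toLp _) ω) *
        ((√(kappa H γ))⁻¹ * (j true ((hC t).toLp _) ω + j false ((hS t).toLp _) ω)) =
        (kappa H γ)⁻¹ * ((j true ((hC s).toLp _) ω + j false ((hS s).toLp _) ω) *
          (j true ((hC t).toLp _) ω + j false ((hS t).toLp _) ω)) := by
      intro ω
      have : (√(kappa H γ))⁻¹ * (√(kappa H γ))⁻¹ = (kappa H γ)⁻¹ := by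
        rw [← mul_inv, Real.mul_self_sqrt hκ.le]
      rw [← this]
      ring
    simp_rw [e1]
    rw [integral_const_mul, integral_mul_eq_inner (hUV _ _) (hUV _ _), inner_add_left,
      inner_add_right, inner_add_right, i1, i1, i3, i4, add_zero, zero_add, toLp_inner,
      toLp_inner, integral_sheetCos_add_sheetSin hH0 hH1 hγ0 hγ1, inv_mul_cancel_left₀ hκ.ne',
      show 2 * ((2 * H - γ) / 2) = 2 * H - γ by ring]
  · refine isGaussianProcess_of_forall_eq_sum hg fun t => ⟨1, fun _ => 1,
      ![(true, (hE t).toLp _)], fun ω => ?_⟩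
    simp
  · rw [h1, toLp_inner, integral_sheetExp hH0 hH1 hγ0]
  · refine isGaussianProcess_of_forall_eq_sum hg ?_
    rintro (t | t)
    · refine ⟨2, fun _ => (√(kappa H γ))⁻¹,
        ![(true, (hC t).toLp _), (false, (hS t).toLp _)], fun ω => ?_⟩
      simp [Fin.sum_univ_two, mul_add]
    · refine ⟨1, fun _ => 1, ![(true, (hE t).toLp _)], fun ω => ?_⟩
      simp
  · refine hX.identDistrib ⟨fun t => ?_, ?_, fun t => ?_, fun s t => ?_⟩
    · have := hm true ((hC t).toLp _)
      have := hm false ((hS t).toLp _)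
      have := hm true ((hE t).toLp _)
      fun_prop
    · refine isGaussianProcess_of_forall_eq_sum hg fun t => ⟨3, fun _ => 1,
        ![(true, (hC t).toLp _), (false, (hS t).toLp _), (true, (hE t).toLp _)], fun ω => ?_⟩
      rw [e]
      simp [Fin.sum_univ_three]
    · simp_rw [e]
      have hi2 : Integrable (fun ω => j true ((hC t).toLp _) ω + j false ((hS t).toLp _) ω) P :=
        (hi _ _).add (hi _ _)
      rw [integral_add hi2 (hi _ _), integral_add (hi _ _) (hi _ _), h0, h0, h0]
      simp
    · simp_rw [e]
      have hUVY : ∀ x y z, ⇑(j true x + j false y + j true z) =ᵐ[P]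
          fun ω => j true x ω + j false y ω + j true z ω := by
        intro x y z
        filter_upwards [Lp.coeFn_add (j true x + j false y) (j true z), hUV x y] with ω h3 h4
        rw [h3, Pi.add_apply, h4]
      have hCE := fun t => (hC t).add (hE t)
      have hq : ∫ p, ((sheetCos H γ s p + sheetExp H γ s p) *
          (sheetCos H γ t p + sheetExp H γ t p) + sheetSin H γ s p * sheetSin H γ t p) ∂quadrant =
          ⟪(hCE s).toLp _, (hCE t).toLp _⟫ + ⟪(hS s).toLp _, (hS t).toLp _⟫ := by
        rw [toLp_inner, toLp_inner]
        exact integral_add ((hCE s).integrable_mul (hCE t)) ((hS s).integrable_mul (hS t))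
      rw [integral_mul_eq_inner (hUVY _ _ _) (hUVY _ _ _), hq, MemLp.toLp_add (hC s) (hE s),
        MemLp.toLp_add (hC t) (hE t)]
      simp only [inner_add_left, inner_add_right, i1, i3, i4]
      ring

end Decomposition

/-! ### Gaussian families that carry an isonormal process -/

section Families
open scoped RealInnerProductSpace

variable {Ω T : Type*} [MeasurableSpace Ω] {P : Measure Ω}

/-- Two independent Gaussian processes are jointly Gaussian. -/
lemma isGaussianProcess_bool_of_indepFun {G : Bool → T → Ω → ℝ}
    (hG : ∀ i, IsGaussianProcess (G i) P)
    (h : IndepFun (fun ω t => G true t ω) (fun ω t => G false t ω) P) :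
    IsGaussianProcess (fun p : Bool × T => G p.1 p.2) P := by
  refine isGaussianProcess_of_forall_sum (fun p => (hG p.1).aemeasurable p.2) fun I c => ?_
  have key : ∀ (b : Bool), HasGaussianLaw
      (fun ω => ∑ p : I, (if p.1.1 = b then c p else 0) * G b p.1.2 ω) P := by
    intro b
    have := (isGaussianProcess_of_forall_eq_sum (S := Unit) (hG b) (Y := fun _ ω =>
      ∑ p : I, (if p.1.1 = b then c p else 0) * G b p.1.2 ω) fun _ =>
      ⟨Fintype.card I, fun k => if ((Fintype.equivFin I).symm k).1.1 = b then
        c ((Fintype.equivFin I).symm k) else 0, fun k => ((Fintype.equivFin I).symm k).1.2,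
        fun ω => ((Fintype.equivFin I).symm.sum_comp
          fun p : I => (if p.1.1 = b then c p else 0) * G b p.1.2 ω).symm⟩)
    exact this.hasGaussianLaw_eval ()
  have hind : IndepFun (fun ω => ∑ p : I, (if p.1.1 = true then c p else 0) * G true p.1.2 ω)
      (fun ω => ∑ p : I, (if p.1.1 = false then c p else 0) * G false p.1.2 ω) P :=
    h.comp (φ := fun f : T → ℝ => ∑ p : I, (if p.1.1 = true then c p else 0) * f p.1.2)
      (ψ := fun f : T → ℝ => ∑ p : I, (if p.1.1 = false then c p else 0) * f p.1.2) (by fun_prop)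
      (by fun_prop)
  have e : (fun ω => ∑ p : I, c p * G p.1.1 p.1.2 ω) = fun ω =>
      ∑ p : I, (if p.1.1 = true then c p else 0) * G true p.1.2 ω +
        ∑ p : I, (if p.1.1 = false then c p else 0) * G false p.1.2 ω := by
    ext ω
    rw [← Finset.sum_add_distrib]
    refine Finset.sum_congr rfl fun p _ => ?_
    cases hb : p.1.1 <;> simp
  rw [e]
  exact iIndepFun.hasGaussianLaw_fun_add (key true) (key false) hind

variable {ι : Type*}

/-- The coordinates of a product of standard Gaussian measures are a Gaussian process. -/
lemma isGaussianProcess_infinitePi :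
    IsGaussianProcess (fun (i : ι) (ω : ι → ℝ) => ω i)
      (Measure.infinitePi fun _ => gaussianReal 0 1) := by
  refine ⟨fun I => ?_⟩
  have h : iIndepFun (fun (i : ι) (ω : ι → ℝ) => ω i)
      (Measure.infinitePi fun _ => gaussianReal 0 1) :=
    iIndepFun_infinitePi (X := fun _ x => x) fun _ => measurable_id
  refine iIndepFun.hasGaussianLaw (X := fun (i : I) (ω : ι → ℝ) => ω i) (fun i => ⟨?_⟩)
    (h.precomp Subtype.val_injective)
  rw [Measure.infinitePi_map_eval]
  infer_instance

lemma memLp_infinitePi (i : ι) :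
    MemLp (fun ω : ι → ℝ => ω i) 2 (Measure.infinitePi fun _ => gaussianReal 0 1) :=
  (isGaussianProcess_infinitePi.hasGaussianLaw_eval i).memLp_two

lemma integral_infinitePi_apply (i : ι) :
    ∫ ω : ι → ℝ, ω i ∂(Measure.infinitePi fun _ => gaussianReal 0 1) = 0 := by
  have h := (measurePreserving_eval_infinitePi (fun _ : ι => gaussianReal 0 1) i)
  have h2 := integral_map (μ := Measure.infinitePi fun _ : ι => gaussianReal 0 1)
    (f := fun x : ℝ => x) h.measurable.aemeasurable
    (by fun_prop : Continuous _).aestronglyMeasurable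
  rw [h.map_eq, integral_id_gaussianReal] at h2
  exact h2.symm

lemma integral_infinitePi_mul [DecidableEq ι] (i k : ι) :
    ∫ ω : ι → ℝ, ω i * ω k ∂(Measure.infinitePi fun _ => gaussianReal 0 1) =
      if i = k then 1 else 0 := by
  split_ifs with hik
  · subst hik
    have h := (measurePreserving_eval_infinitePi (fun _ : ι => gaussianReal 0 1) i)
    have h2 := integral_map (μ := Measure.infinitePi fun _ : ι => gaussianReal 0 1)
      (f := fun x : ℝ => x * x) h.measurable.aemeasurable
      (by fun_prop : Continuous _).aestronglyMeasurable
    have h3 := variance_of_integral_eq_zero (μ := gaussianReal 0 1) (X := fun x : ℝ => x)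
      aemeasurable_id' integral_id_gaussianReal
    rw [variance_fun_id_gaussianReal] at h3
    rw [h.map_eq] at h2
    calc _ = _ := h2.symm
      _ = 1 := by simpa [pow_two] using h3.symm
  · have h : iIndepFun (fun (i : ι) (ω : ι → ℝ) => ω i)
        (Measure.infinitePi fun _ => gaussianReal 0 1) :=
      iIndepFun_infinitePi (X := fun _ x => x) fun _ => measurable_id
    rw [(h.indepFun hik).integral_fun_mul_eq_mul_integral
      (measurable_pi_apply i).aestronglyMeasurable (measurable_pi_apply k).aestronglyMeasurable,
      integral_infinitePi_apply, zero_mul]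

end Families

/-! ### The representations of the decomposition -/

section Representations
open scoped RealInnerProductSpace

variable {H γ : ℝ} {Ω Ω₁ : Type*} [MeasurableSpace Ω] [MeasurableSpace Ω₁] {P : Measure Ω}
  {P₁ : Measure Ω₁} [IsProbabilityMeasure P] {X : ℝ≥0 → Ω₁ → ℝ}

/-- The isonormal processes come from an orthonormal basis of `L²((0, ∞)²)` and two independent
families of independent standard Gaussian variables indexed by it. -/
lemma exists_isDecomposition (hH0 : 0 < H) (hH1 : H < 1) (hγ0 : 0 < γ) (hγ1 : γ < 2 * H)
    (hX : IsCenteredGaussian X (fun s t =>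
      ∫ p, ((sheetCos H γ s p + sheetExp H γ s p) * (sheetCos H γ t p + sheetExp H γ t p) +
        sheetSin H γ s p * sheetSin H γ t p) ∂quadrant) P₁) :
    ∃ (Ω' : Type) (_ : MeasurableSpace Ω') (P' : Measure Ω') (_ : IsProbabilityMeasure P')
      (B Y : ℝ≥0 → Ω' → ℝ), IsDecomposition H γ X P₁ B Y P' := by
  classical
  obtain ⟨w, b, hb⟩ := exists_hilbertBasis ℝ (Lp ℝ 2 quadrant)
  have ho := orthonormal_iff_ite.1 b.orthonormal
  obtain ⟨j, -, hg, h0, h1, h2⟩ := exists_isonormal (ι := Bool) (e := b) b.dense_span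
    (P := Measure.infinitePi fun _ : Bool × w => gaussianReal 0 1)
    (G := fun i t ω => ω (i, t)) isGaussianProcess_infinitePi
    (fun i t => integral_infinitePi_apply (i, t)) (fun i t => memLp_infinitePi (i, t))
    (fun i s t => by rw [integral_infinitePi_mul, ho]; simp)
    (fun i k hik s t => by rw [integral_infinitePi_mul]; simp [hik])
  exact ⟨_, _, _, inferInstance, _, _, isDecomposition_of_isonormal hH0 hH1 hγ0 hγ1
    (memLp_sheetCos hH0 hH1 hγ0 hγ1) (memLp_sheetSin hH0 hH1 hγ0 hγ1)
    (memLp_sheetExp hH0 hH1 hγ0 hγ1) hX hg h0 h1 h2⟩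

/-- The isonormal processes come from the two Brownian sheets, as the indicators of the rectangles
`(0, p₁] × (0, p₂]` are total in `L²((0, ∞)²)`. -/
lemma exists_isSheetIntegral_isDecomposition (hH0 : 0 < H) (hH1 : H < 1) (hγ0 : 0 < γ)
    (hγ1 : γ < 2 * H) (hX : IsCenteredGaussian X (fun s t =>
      ∫ p, ((sheetCos H γ s p + sheetExp H γ s p) * (sheetCos H γ t p + sheetExp H γ t p) +
        sheetSin H γ s p * sheetSin H γ t p) ∂quadrant) P₁)
    {W₁ W₂ : ℝ≥0 × ℝ≥0 → Ω → ℝ} (h₁ : IsBrownianSheet W₁ P) (h₂ : IsBrownianSheet W₂ P)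
    (hind : IndepFun (fun ω p => W₁ p ω) (fun ω p => W₂ p ω) P) :
    ∃ U V Y : ℝ≥0 → Ω → ℝ,
      (∀ t, IsSheetIntegral W₁ (sheetCos H γ t) (U t) P) ∧
      (∀ t, IsSheetIntegral W₂ (sheetSin H γ t) (V t) P) ∧
      (∀ t, IsSheetIntegral W₁ (sheetExp H γ t) (Y t) P) ∧
      IsDecomposition H γ X P₁ (fun t ω => (√(kappa H γ))⁻¹ * (U t ω + V t ω)) Y P := by
  have hC := memLp_sheetCos hH0 hH1 hγ0 hγ1
  have hS := memLp_sheetSin hH0 hH1 hγ0 hγ1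
  have hE := memLp_sheetExp hH0 hH1 hγ0 hγ1
  let G : Bool → ℝ≥0 × ℝ≥0 → Ω → ℝ := fun i => if i then W₁ else W₂
  have hG : ∀ i, IsBrownianSheet (G i) P := by
    rintro (_ | _)
    exacts [h₂, h₁]
  have hm := fun i t => (hG i).gaussian.measurable t
  have hL : ∀ i t, MemLp (G i t) 2 P := fun i t => (hG i).gaussian.memLp t
  have hzero : ∀ i, ∀ p : ℝ≥0 × ℝ≥0, p.1 = 0 ∨ p.2 = 0 → G i p =ᵐ[P] 0 := by
    intro i p hp
    refine ae_eq_zero_of_integral_mul_self (hL i p) ?_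
    rw [(hG i).gaussian.cov]
    rcases hp with hp | hp <;> simp [hp]
  have hcross : ∀ i k, i ≠ k → ∀ s t, ∫ ω, G i s ω * G k t ω ∂P = 0 := by
    have h12 : ∀ s t, ∫ ω, W₁ s ω * W₂ t ω ∂P = 0 := by
      intro s t
      have : IndepFun (fun ω => W₁ s ω) (fun ω => W₂ t ω) P :=
        hind.comp (φ := fun f : ℝ≥0 × ℝ≥0 → ℝ => f s) (ψ := fun f : ℝ≥0 × ℝ≥0 → ℝ => f t)
          (measurable_pi_apply s) (measurable_pi_apply t)
      rw [this.integral_fun_mul_eq_mul_integral (h₁.gaussian.measurable s).aestronglyMeasurable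
        (h₂.gaussian.measurable t).aestronglyMeasurable, h₁.gaussian.mean, zero_mul]
    rintro (_ | _) (_ | _) hik s t
    · exact absurd rfl hik
    · simp_rw [mul_comm (G false s _)]
      exact h12 t s
    · exact h12 s t
    · exact absurd rfl hik
  obtain ⟨j, hj, hg, h0, h1, h2⟩ := exists_isonormal (ι := Bool) (e := rectLp) span_rectLp_dense
    (G := G) (isGaussianProcess_bool_of_indepFun (fun i => (hG i).gaussian.gaussian) hind)
    (fun i t => (hG i).gaussian.mean t) hL
    (fun i s t => by rw [(hG i).gaussian.cov, inner_rectLp]) hcross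
  exact ⟨_, _, _,
    fun t => isSheetIntegral_of_mem_gramGraph (hL true) (hzero true) (hC t) (hj true _),
    fun t => isSheetIntegral_of_mem_gramGraph (hL false) (hzero false) (hS t) (hj false _),
    fun t => isSheetIntegral_of_mem_gramGraph (hL true) (hzero true) (hE t) (hj true _),
    isDecomposition_of_isonormal hH0 hH1 hγ0 hγ1 hC hS hE hX hg h0 h1 h2⟩

/-- The Wiener integral is isonormal on `L²(0, ∞)`, and the Gram matrix of the functions `lineExp`
is the covariance of `Y` divided by `λ₁`. -/
lemma exists_isWienerIntegral_isCenteredGaussian (hH0 : 0 < H) (hH1 : H < 1) (hγ0 : 0 < γ)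
    (hγ1 : γ < 2 * H) {W : ℝ≥0 → Ω → ℝ} (hW : IsBrownianReal W P) :
    ∃ Y : ℝ≥0 → Ω → ℝ, (∀ t, IsWienerIntegral W (lineExp H γ t) (Y t) P) ∧
      IsCenteredGaussian (fun t ω => √(lambdaOne H γ) * Y t ω) (covY H γ) P := by
  have hE := memLp_lineExp hγ1 hH1 hγ0
  have hWp := hW.toIsPreBrownianReal
  have hL : ∀ t, MemLp (W t) 2 P := fun t =>
    (hWp.isGaussianProcess.hasGaussianLaw_eval t).memLp_two
  have hcov : ∀ s t, ∫ ω, W s ω * W t ω ∂P = min (s : ℝ) (t : ℝ) := by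
    intro s t
    have h := covariance_eq_sub (hL s) (hL t)
    rw [hWp.covariance_eval, hWp.integral_eval, zero_mul, sub_zero] at h
    rw [← NNReal.coe_min, h]
    rfl
  obtain ⟨j, hj, hg, h0, h1, -⟩ := exists_isonormal (ι := Unit) (e := intervalLp)
    span_intervalLp_dense (G := fun _ => W) (hWp.isGaussianProcess.comp_right Prod.snd)
    (fun _ t => hWp.integral_eval t) (fun _ => hL)
    (fun _ s t => by rw [hcov, inner_intervalLp]) fun i k hik => absurd rfl hik
  refine ⟨fun t => j () ((hE t).toLp _), fun t => isWienerIntegral_of_mem_gramGraph hL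
    hWp.eval_zero_ae_eq_zero (hE t) (hj () _), fun t => ?_, ?_, fun t => ?_, fun s t => ?_⟩
  · exact (Lp.stronglyMeasurable _).measurable.const_mul _
  · refine isGaussianProcess_of_forall_eq_sum hg fun t => ⟨1, fun _ => √(lambdaOne H γ),
      fun _ => ((), (hE t).toLp _), fun ω => ?_⟩
    simp
  · rw [integral_const_mul, h0, mul_zero]
  · have e : ∀ ω, √(lambdaOne H γ) * j () ((hE s).toLp _) ω *
        (√(lambdaOne H γ) * j () ((hE t).toLp _) ω) =
        lambdaOne H γ * (j () ((hE s).toLp _) ω * j () ((hE t).toLp _) ω) := by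
      intro ω
      nth_rewrite 3 [← Real.mul_self_sqrt (lambdaOne_pos hH0 hH1 hγ0).le]
      ring
    simp_rw [e]
    rw [integral_const_mul, h1, ← integral_mul_eq_inner (hE s).coeFn_toLp (hE t).coeFn_toLp,
      integral_lineExp]

end Representations

theorem theorem1 {Ω : Type*} [MeasurableSpace Ω] (P : Measure Ω) [IsProbabilityMeasure P]
    (H γ : ℝ) (hH0 : 0 < H) (hH1 : H < 1) (hγ0 : 0 < γ) (hγ1 : γ < 2 * H)
    -- the fBm `B` and the independent Gaussian process `Z = {Z_t, t > 0}`
    (B : ℝ≥0 → Ω → ℝ) (hB : IsFBM H B P)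
    (Z : Set.Ioi (0 : ℝ) → Ω → ℝ)
    (hZ : IsCenteredGaussian Z (fun s t => ((s : ℝ) + (t : ℝ)) ^ (-γ)) P)
    (hZmeas : Measurable fun p : Set.Ioi (0 : ℝ) × Ω => Z p.1 p.2)
    (hindep : IndepFun (fun ω s => Z s ω) (fun ω t => B t ω) P) :
    -- the stochastic integrals `∫_0^t Z_{t-r} dB_r` exist
    (∀ t : ℝ≥0, ∃ J : Ω → ℝ, IsConvolution H B Z t J P) ∧
    ∀ I : ℝ≥0 → Ω → ℝ, (∀ t : ℝ≥0, IsConvolution H B Z t (I t) P) →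
      -- `X` is any centered Gaussian process with the covariance of these integrals
      ∀ (Ω₁ : Type*) [MeasurableSpace Ω₁] (P₁ : Measure Ω₁) [IsProbabilityMeasure P₁]
        (X : ℝ≥0 → Ω₁ → ℝ),
        IsCenteredGaussian X (fun s t => ∫ ω, I s ω * I t ω ∂P) P₁ →
        -- the decomposition in law `X = √κ B^{α/2} + Y`
        (∃ (Ω' : Type) (_ : MeasurableSpace Ω') (P' : Measure Ω') (_ : IsProbabilityMeasure P')
          (B' Y : ℝ≥0 → Ω' → ℝ), IsDecomposition H γ X P₁ B' Y P') ∧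
        -- `Y` has the law of a constant multiple of the process
        -- `∫_0^∞ y^{-(1+α)/2} (1 - e^{-yt}) dW_y` for a Brownian motion `W`
        (∀ (Ω₂ : Type*) [MeasurableSpace Ω₂] (P₂ : Measure Ω₂) [IsProbabilityMeasure P₂]
          (W : ℝ≥0 → Ω₂ → ℝ), IsBrownianReal W P₂ →
          ∃ Yα : ℝ≥0 → Ω₂ → ℝ,
            (∀ t : ℝ≥0, IsWienerIntegral W
              (fun y => y ^ (-(1 + (2 * H - γ)) / 2) * (1 - Real.exp (-(y * t)))) (Yα t) P₂) ∧
            IsCenteredGaussian (fun t ω => √(lambdaOne H γ) * Yα t ω) (covY H γ) P₂) ∧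
        -- construction from two independent Brownian sheets
        (∀ (Ω₂ : Type*) [MeasurableSpace Ω₂] (P₂ : Measure Ω₂) [IsProbabilityMeasure P₂]
          (W₁ W₂ : ℝ≥0 × ℝ≥0 → Ω₂ → ℝ), IsBrownianSheet W₁ P₂ → IsBrownianSheet W₂ P₂ →
          IndepFun (fun ω p => W₁ p ω) (fun ω p => W₂ p ω) P₂ →
          ∃ U V Y : ℝ≥0 → Ω₂ → ℝ,
            (∀ t : ℝ≥0, IsSheetIntegral W₁
              (fun p => sheetWeight H γ p * (Real.cos (p.1 * p.2 * t) - 1)) (U t) P₂) ∧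
            (∀ t : ℝ≥0, IsSheetIntegral W₂
              (fun p => sheetWeight H γ p * Real.sin (p.1 * p.2 * t)) (V t) P₂) ∧
            (∀ t : ℝ≥0, IsSheetIntegral W₁
              (fun p => sheetWeight H γ p * (1 - Real.exp (-(p.2 * t)))) (Y t) P₂) ∧
            IsDecomposition H γ X P₁
              (fun t ω => (√(kappa H γ))⁻¹ * (U t ω + V t ω)) Y P₂) := by
  refine ⟨exists_isConvolution hH0 hH1 hγ0 hγ1 hB hZ hZmeas hindep,
    fun I hI Ω₁ _ P₁ _ X hX => ?_⟩
  simp_rw [fun s t => (hI s).integral_mul hH0 hH1 hγ0 hγ1 hB hZ hZmeas hindep (hI t)] at hX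
  exact ⟨exists_isDecomposition hH0 hH1 hγ0 hγ1 hX,
    fun Ω₂ _ P₂ _ W hW => exists_isWienerIntegral_isCenteredGaussian hH0 hH1 hγ0 hγ1 hW,
    fun Ω₂ _ P₂ _ W₁ W₂ h₁ h₂ hind =>
      exists_isSheetIntegral_isDecomposition hH0 hH1 hγ0 hγ1 hX h₁ h₂ hind⟩
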